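/- All formulas are first-order formulas with equality over variables $x_0,x_1,x_2,\dots$, and interpretations have nonempty domains and assign values to all variables. Signatures are effectively presented: their symbols are named by natural numbers and it is decidable whether a number names a function (or predicate) symbol of a given arity. A theory $\mathcal T$ is the class of interpretations satisfying a given set of axioms (sentences). $\mathcal T$ is *decidable* if the set of $\mathcal T$-satisfiable quantifier-free formulas is decidable. For $\mathcal T_1,\mathcal T_2$ over disjoint signatures (sharing only equality), $\mathcal T_1\oplus\mathcal T_2$ is the theory over the union of the signatures axiomatized by the union of the axioms. $\mathcal T$ is *smooth* if whenever a $\mathcal T$-interpretation $\mathcal A$ satisfies a quantifier-free formula $\varphi$ and $\kappa>|\mathcal A|$ is a cardinal, some $\mathcal T$-interpretation of cardinality $\kappa$ satisfies $\varphi$. $\mathcal T$ is *finitely witnessable* if there is a computable map $\mathrm{wit}$ from quantifier-free formulas to quantifier-free formulas such that for every quantifier-free $\varphi$: (I) $\varphi$ and $\exists\vec x\,\mathrm{wit}(\varphi)$, where $\vec x=\mathrm{vars}(\mathrm{wit}(\varphi))\setminus\mathrm{vars}(\varphi)$, are satisfied by the same $\mathcal T$-interpretations; (II) if $\mathrm{wit}(\varphi)$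 is $\mathcal T$-satisfiable, it is satisfied by a $\mathcal T$-interpretation whose domain is the set of values of the variables of $\mathrm{wit}(\varphi)$. $\mathcal T$ is *polite* if it is smooth and finitely witnessable. Write $\mathbb N^*=\{1,2,\dots\}$, and let $\psi_{\le n}$, $\psi_{=n}$ be the sentences saying that the domain has at most, respectively exactly, $n$ elements. * $\mathcal T_=$ has as signature the $0$-ary predicates $P_n$ ($n\in\mathbb N^*$), and the axioms $P_n\to\psi_{=n}$ ($n\in\mathbb N^*$). * Call $f:\mathbb N^*\to\{0,1\}$ *admissible* if $f$ is not computable, $f(1)=1$, and for every $k\ge1$, $f$ maps half of the numbers in $\{1,\dots,2^k\}$ to $1$ and the other half to $0$. Let $f_b(k)=|\{1\le i\le k: f(i)=b\}|$. The theory $\mathcal T_f$ has as signature one unary function symbol $s$, and for each $k\in\mathbb N^*$ the axiom $$[\psi^{=}_{\ge f_1(k)}\wedge\psi^{\ne}_{\ge f_0(k)}]\vee\bigvee_{i=1}^{k}[\psi^{=}_{=f_1(i)}\wedge\psi^{\ne}_{=f_0(i)}],$$ where $\psi^{=}_{\ge n}$, $\psi^{=}_{=n}$ (respectively $\psi^{\ne}_{\ge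 n}$, $\psi^{\ne}_{=n}$) say that there are at least $n$, exactly $n$, elements $x$ with $s(x)=x$ (respectively $s(x)\ne x$). * $\mathcal T_{orb}^2$ has as signature a constant $a$ and a unary function symbol $t$, and for each $n\in\mathbb N^*$ the axiom $orb_n(a)\to\psi_{\le 2n}$, where $orb_n(a)$ says that the orbit $\{a,t(a),t^2(a),\dots\}$ has exactly $n$ elements ($orb_1(a)$ is $t(a)=a$; for $n\ge2$, $orb_n(a)$ says that $a,\dots,t^{n-1}(a)$ are distinct and $a,\dots,t^{n}(a)$ are not). * $\mathcal T_g$ is $\mathcal T_f$ with $f=g$, where $g$ is admissible and moreover $g(2n+1)=g(2n+2)$ for all $n\ge2$. **Theorem.** 1. There are decidable theories $\mathcal T_1$ and $\mathcal T_2$ over disjoint signatures such that $\mathcal T_2$ is polite but $\mathcal T_1\oplus\mathcal T_2$ is undecidable. Hence the claim "if $\mathcal T_1,\mathcal T_2$ are decidable theories over disjoint signatures and $\mathcal T_2$ is polite, then $\mathcal T_1\oplus\mathcal T_2$ is decidable" is false. 2. Witnesses are $\mathcal T_1=\mathcal T_=$ and $\mathcal T_2=\mathcal T_f$: admissible functions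 exist, and for every admissible $f$, $\mathcal T_=$ and $\mathcal T_f$ are decidable, $\mathcal T_f$ is polite, and $\mathcal T_=\oplus\mathcal T_f$ is undecidable. 3. In the first assertion both signatures can be taken finite. Witnesses are $\mathcal T_1=\mathcal T_{orb}^2$ and $\mathcal T_2=\mathcal T_g$: functions $g$ as above exist, and for every such $g$, $\mathcal T_{orb}^2$ and $\mathcal T_g$ are decidable, $\mathcal T_g$ is polite, and $\mathcal T_{orb}^2\oplus\mathcal T_g$ is undecidable. -/

import Mathlib

universe w

namespace TheoryCombination

open FirstOrder FirstOrder.Language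

/-! ## Effectively presented signatures and codes of formulas -/

/-- A signature whose symbols are named by natural numbers, injectively in each arity, in such a
way that it is decidable whether a number names a function (predicate) symbol of a given arity.
Equality is a logical symbol and is not part of the signature. -/
class EffectiveSignature (L : FirstOrder.Language.{0, 0}) where
  funCode : ∀ {n : ℕ}, L.Functions n → ℕ
  relCode : ∀ {n : ℕ}, L.Relations n → ℕ
  funCode_injective : ∀ n : ℕ, Function.Injective (funCode (n := n))
  relCode_injective : ∀ n : ℕ, Function.Injective (relCode (n := n))
  funCode_decidable : ComputablePred fun p : ℕ × ℕ => ∃ s : L.Functions p.1, funCode s = p.2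
  relCode_decidable : ComputablePred fun p : ℕ × ℕ => ∃ r : L.Relations p.1, relCode r = p.2

open EffectiveSignature

/-- The code of a term, where a free variable is a natural number and a bound variable an element
of `Fin m`. A function symbol is coded together with its arity and the list of its arguments. -/
def termCode {L : FirstOrder.Language.{0, 0}} [EffectiveSignature L] {m : ℕ} : L.Term (ℕ ⊕ Fin m) → ℕ
  | .var (Sum.inl x) => Nat.pair 0 x
  | .var (Sum.inr i) => Nat.pair 1 i
  | @Term.func _ _ n s ts =>
      Nat.pair 2 (Nat.pair n (Nat.pair (funCode s)
        (Encodable.encode (List.ofFn fun i => termCode (ts i)))))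

/-- The code of a formula with free variables in `ℕ`. -/
def formulaCode {L : FirstOrder.Language.{0, 0}} [EffectiveSignature L] :
    ∀ {m : ℕ}, L.BoundedFormula ℕ m → ℕ
  | _, .falsum => Nat.pair 0 0
  | _, .equal t₁ t₂ => Nat.pair 1 (Nat.pair (termCode t₁) (termCode t₂))
  | _, @BoundedFormula.rel _ _ _ n r ts =>
      Nat.pair 2 (Nat.pair n (Nat.pair (relCode r)
        (Encodable.encode (List.ofFn fun i => termCode (ts i)))))
  | _, .imp φ ψ => Nat.pair 3 (Nat.pair (formulaCode φ) (formulaCode ψ))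
  | _, .all φ => Nat.pair 4 (formulaCode φ)

/-- The quantifier-free formulas of a signature, over the variables `0, 1, 2, …`. -/
abbrev QFFormula (L : FirstOrder.Language.{0, 0}) : Type := {φ : L.Formula ℕ // φ.IsQF}

/-- The finite set of variables of a quantifier-free formula. -/
def QFFormula.vars {L : FirstOrder.Language.{0, 0}} (φ : QFFormula L) : Finset ℕ :=
  φ.1.freeVarFinset

/-! ## Notions concerning theories

A theory is given by its axioms; its interpretations are pairs of a nonempty model `M` of the
axioms (`T.ModelType`) and an assignment `v : ℕ → M` of values to the variables. The domains
range over an arbitrary universe `w`. -/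

/-- `φ` is `T`-satisfiable. -/
def IsSat {L : FirstOrder.Language.{0, 0}} (T : L.Theory) (φ : L.Formula ℕ) : Prop :=
  ∃ (M : Theory.ModelType.{0, 0, w} T) (v : ℕ → M), φ.Realize v

/-- `T` is decidable: the set of `T`-satisfiable quantifier-free formulas is decidable. -/
def IsDecidable {L : FirstOrder.Language.{0, 0}} [EffectiveSignature L] (T : L.Theory) : Prop :=
  ComputablePred fun c : ℕ => ∃ φ : QFFormula L, formulaCode φ.1 = c ∧ IsSat.{w} T φ.1

/-- `T` is smooth: a quantifier-free formula satisfied by a `T`-interpretation is satisfied by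
`T`-interpretations of every larger cardinality. -/
def IsSmooth {L : FirstOrder.Language.{0, 0}} (T : L.Theory) : Prop :=
  ∀ (φ : QFFormula L) (M : Theory.ModelType.{0, 0, w} T) (v : ℕ → M), φ.1.Realize v →
    ∀ κ : Cardinal.{w}, Cardinal.mk M < κ →
      ∃ (N : Theory.ModelType.{0, 0, w} T) (v' : ℕ → N),
        φ.1.Realize v' ∧ Cardinal.mk N = κ

/-- The interpretation `(M, v)` satisfies `∃ x⃗. φ`, where `x⃗` lists the variables in `X`. -/
def RealizeExists {L : FirstOrder.Language.{0, 0}} {M : Type w} [L.Structure M] (X : Finset ℕ)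
    (φ : L.Formula ℕ) (v : ℕ → M) : Prop :=
  ∃ v' : ℕ → M, (∀ x, x ∉ X → v' x = v x) ∧ φ.Realize v'

/-- `T` is finitely witnessable: there is a computable witness. -/
def IsFinitelyWitnessable {L : FirstOrder.Language.{0, 0}} [EffectiveSignature L] (T : L.Theory) : Prop :=
  ∃ wit : QFFormula L → QFFormula L,
    (∃ h : ℕ → ℕ, Computable h ∧
      ∀ φ : QFFormula L, h (formulaCode φ.1) = formulaCode (wit φ).1) ∧
    ∀ φ : QFFormula L,
      (∀ (M : Theory.ModelType.{0, 0, w} T) (v : ℕ → M),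
        φ.1.Realize v ↔ RealizeExists ((wit φ).vars \ φ.vars) (wit φ).1 v) ∧
      (IsSat.{w} T (wit φ).1 →
        ∃ (M : Theory.ModelType.{0, 0, w} T) (v : ℕ → M),
          (wit φ).1.Realize v ∧ v '' (↑(wit φ).vars : Set ℕ) = Set.univ)

/-- `T` is polite: smooth and finitely witnessable. -/
def IsPolite {L : FirstOrder.Language.{0, 0}} [EffectiveSignature L] (T : L.Theory) : Prop :=
  IsSmooth.{w} T ∧ IsFinitelyWitnessable.{w} T

/-- The combination `T₁ ⊕ T₂`, over the disjoint union of the two signatures, axiomatized by the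
union of the two sets of axioms. -/
def combine {L₁ L₂ : FirstOrder.Language.{0, 0}} (T₁ : L₁.Theory) (T₂ : L₂.Theory) :
    (L₁.sum L₂).Theory :=
  (LHom.sumInl : L₁ →ᴸ L₁.sum L₂).onTheory T₁ ∪ (LHom.sumInr : L₂ →ᴸ L₁.sum L₂).onTheory T₂

/-- A signature is finite if it has finitely many function and predicate symbols. -/
def IsFiniteSignature (L : FirstOrder.Language.{0, 0}) : Prop :=
  Finite (Σ n, L.Functions n) ∧ Finite (Σ n, L.Relations n)

/-! ### Disjoint unions of effectively presented signatures -/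

theorem computablePred_sum {A B : ℕ → Type} (a : ∀ n, A n → ℕ) (b : ∀ n, B n → ℕ)
    (ha : ComputablePred fun p : ℕ × ℕ => ∃ s : A p.1, a p.1 s = p.2)
    (hb : ComputablePred fun p : ℕ × ℕ => ∃ s : B p.1, b p.1 s = p.2) :
    ComputablePred fun p : ℕ × ℕ => ∃ s : A p.1 ⊕ B p.1,
      Sum.elim (fun s => 2 * a p.1 s) (fun s => 2 * b p.1 s + 1) s = p.2 := by
  classical
  obtain ⟨_, ha⟩ := ha
  obtain ⟨_, hb⟩ := hb
  have hdiv : Computable fun p : ℕ × ℕ => (p.1, p.2 / 2) :=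
    (Primrec.pair Primrec.fst (Primrec.nat_div.comp Primrec.snd (Primrec.const 2))).to_comp
  have hmod : Computable fun p : ℕ × ℕ => decide (p.2 % 2 = 0) :=
    (Primrec.eq.decide.comp
      (Primrec.nat_mod.comp Primrec.snd (Primrec.const 2)) (Primrec.const 0)).to_comp
  refine ⟨fun _ => Classical.propDecidable _,
    (Computable.cond hmod (ha.comp hdiv) (hb.comp hdiv)).of_eq ?_⟩
  rintro ⟨n, c⟩
  rcases Nat.mod_two_eq_zero_or_one c with h | h
  · simp only [h, decide_true, cond_true, decide_eq_decide, Sum.exists, Sum.elim_inl, Sum.elim_inr]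
    constructor
    · rintro ⟨s, hs⟩
      exact Or.inl ⟨s, by omega⟩
    · rintro (⟨s, hs⟩ | ⟨s, hs⟩)
      · exact ⟨s, by omega⟩
      · omega
  · simp only [h, one_ne_zero, decide_false, cond_false, decide_eq_decide, Sum.exists,
      Sum.elim_inl, Sum.elim_inr]
    constructor
    · rintro ⟨s, hs⟩
      exact Or.inr ⟨s, by omega⟩
    · rintro (⟨s, hs⟩ | ⟨s, hs⟩)
      · omega
      · exact ⟨s, by omega⟩

theorem injective_sum {A B : Type} {a : A → ℕ} {b : B → ℕ} (ha : Function.Injective a)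
    (hb : Function.Injective b) :
    Function.Injective (Sum.elim (fun s => 2 * a s) (fun s => 2 * b s + 1)) := by
  rintro (x | x) (y | y) h <;> simp only [Sum.elim_inl, Sum.elim_inr] at h
  · rw [ha (show a x = a y by omega)]
  · omega
  · omega
  · rw [hb (show b x = b y by omega)]

/-- Symbols of the first signature get the even codes, symbols of the second one the odd codes. -/
instance instSum (L₁ L₂ : FirstOrder.Language.{0, 0}) [EffectiveSignature L₁] [EffectiveSignature L₂] :
    EffectiveSignature (L₁.sum L₂) where
  funCode := Sum.elim (fun s => 2 * funCode s) (fun s => 2 * funCode s + 1)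
  relCode := Sum.elim (fun r => 2 * relCode r) (fun r => 2 * relCode r + 1)
  funCode_injective n := injective_sum (funCode_injective n) (funCode_injective n)
  relCode_injective n := injective_sum (relCode_injective n) (relCode_injective n)
  funCode_decidable := computablePred_sum (A := L₁.Functions) (B := L₂.Functions)
    (fun _ => funCode) (fun _ => funCode)
    funCode_decidable funCode_decidable
  relCode_decidable := computablePred_sum (A := L₁.Relations) (B := L₂.Relations)
    (fun _ => relCode) (fun _ => relCode)
    relCode_decidable relCode_decidable

/-! ## The signatures -/

/-- The `0`-ary predicate symbols `P₁, P₂, …`. -/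
inductive SymP : ℕ → Type
  | P (n : ℕ+) : SymP 0

/-- One unary function symbol `s`. -/
inductive SymS : ℕ → Type
  | s : SymS 1

/-- A constant symbol `a` and a unary function symbol `t`. -/
inductive SymT : ℕ → Type
  | a : SymT 0
  | t : SymT 1

/-- The signature `Σ_P`, with the predicate symbols `P₁, P₂, …` only. -/
abbrev sigP : FirstOrder.Language.{0, 0} := ⟨fun _ => Empty, SymP⟩

/-- The signature `Σ_s`, with the unary function symbol `s` only. -/
abbrev sigS : FirstOrder.Language.{0, 0} := ⟨SymS, fun _ => Empty⟩

/-- The signature `Σ_t^a`, with the constant `a` and the unary function symbol `t` only. -/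
abbrev sigT : FirstOrder.Language.{0, 0} := ⟨SymT, fun _ => Empty⟩

/-- `Pₙ` has the code `n`. -/
def SymP.code : ∀ {n : ℕ}, SymP n → ℕ
  | _, .P n => n

theorem computablePred_empty :
    ComputablePred fun p : ℕ × ℕ => ∃ s : (fun _ : ℕ => Empty) p.1, Empty.elim s = p.2 := by
  refine ⟨fun _ => Classical.propDecidable _, (Computable.const false).of_eq fun p => ?_⟩
  simp

instance instSigP : EffectiveSignature sigP where
  funCode := Empty.elim
  relCode := SymP.code
  funCode_injective _ := fun x => x.elim
  relCode_injective _ := by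
    rintro ⟨x⟩ ⟨y⟩ h
    exact congrArg SymP.P (PNat.coe_injective h)
  funCode_decidable := computablePred_empty
  relCode_decidable := by
    have h : PrimrecPred fun p : ℕ × ℕ => p.1 = 0 ∧ 0 < p.2 :=
      (Primrec.eq.comp Primrec.fst (Primrec.const 0)).and
        (Primrec.nat_lt.comp (Primrec.const 0) Primrec.snd)
    obtain ⟨_, h⟩ := h
    refine ⟨fun _ => Classical.propDecidable _, h.to_comp.of_eq ?_⟩
    rintro ⟨n, c⟩
    rw [decide_eq_decide]
    constructor
    · rintro ⟨h0, hc⟩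
      obtain rfl : n = 0 := h0
      exact ⟨SymP.P ⟨c, hc⟩, rfl⟩
    · rintro ⟨⟨m⟩, hs⟩
      exact ⟨rfl, hs ▸ m.pos⟩

instance instSigS : EffectiveSignature sigS where
  funCode _ := 0
  relCode := Empty.elim
  funCode_injective _ := by
    rintro ⟨⟩ ⟨⟩ _
    rfl
  relCode_injective _ := fun x => x.elim
  funCode_decidable := by
    have h : PrimrecPred fun p : ℕ × ℕ => p.1 = 1 ∧ p.2 = 0 :=
      (Primrec.eq.comp Primrec.fst (Primrec.const 1)).and
        (Primrec.eq.comp Primrec.snd (Primrec.const 0))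
    obtain ⟨_, h⟩ := h
    refine ⟨fun _ => Classical.propDecidable _, h.to_comp.of_eq ?_⟩
    rintro ⟨n, c⟩
    rw [decide_eq_decide]
    constructor
    · rintro ⟨h0, hc⟩
      obtain rfl : n = 1 := h0
      exact ⟨SymS.s, hc.symm⟩
    · rintro ⟨⟨⟩, hs⟩
      exact ⟨rfl, hs.symm⟩
  relCode_decidable := computablePred_empty

instance instSigT : EffectiveSignature sigT where
  funCode _ := 0
  relCode := Empty.elim
  funCode_injective _ := by
    rintro ⟨⟩ y _ <;> cases y <;> rfl
  relCode_injective _ := fun x => x.elim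
  funCode_decidable := by
    have h : PrimrecPred fun p : ℕ × ℕ => p.1 < 2 ∧ p.2 = 0 :=
      (Primrec.nat_lt.comp Primrec.fst (Primrec.const 2)).and
        (Primrec.eq.comp Primrec.snd (Primrec.const 0))
    obtain ⟨_, h⟩ := h
    refine ⟨fun _ => Classical.propDecidable _, h.to_comp.of_eq ?_⟩
    rintro ⟨n, c⟩
    rw [decide_eq_decide]
    constructor
    · rintro ⟨h0, hc⟩
      match n, h0 with
      | 0, _ => exact ⟨SymT.a, hc.symm⟩
      | 1, _ => exact ⟨SymT.t, hc.symm⟩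
    · rintro ⟨⟨⟩, hs⟩
      · exact ⟨Nat.zero_lt_two, hs.symm⟩
      · exact ⟨Nat.one_lt_two, hs.symm⟩
  relCode_decidable := computablePred_empty

/-! ## The formulas -/

/-- The formula `≠(x₁, …, xₙ)` saying that the bound variables `x₁, …, xₙ` are distinct. -/
noncomputable def distinct (L : FirstOrder.Language.{0, 0}) (n : ℕ) : L.BoundedFormula Empty n :=
  BoundedFormula.iInf fun p : {p : Fin n × Fin n // p.1 < p.2} => ∼(&p.1.1 =' &p.1.2)

/-- `ψ_{≥n}`: there are at least `n` elements. -/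
noncomputable def psiGe (L : FirstOrder.Language.{0, 0}) (n : ℕ) : L.Sentence :=
  (distinct L n).exs

/-- `ψ_{≤n}`: `∃ x₁ … xₙ ∀ y, y = x₁ ∨ … ∨ y = xₙ`. -/
noncomputable def psiLe (L : FirstOrder.Language.{0, 0}) (n : ℕ) : L.Sentence :=
  (∀' BoundedFormula.iSup fun i : Fin n =>
    (&(Fin.last n) =' &(Fin.castSucc i) : L.BoundedFormula Empty (n + 1))).exs

/-- `ψ_{=n}`: there are exactly `n` elements. -/
noncomputable def psiEq (L : FirstOrder.Language.{0, 0}) (n : ℕ) : L.Sentence :=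
  psiGe L n ⊓ psiLe L n

/-- `p(xᵢ)`, that is, `s(xᵢ) = xᵢ`, for the bound variable `xᵢ`. -/
def fixS {n : ℕ} (i : Fin n) : sigS.BoundedFormula Empty n :=
  Functions.apply₁ (L := sigS) SymS.s (&i) =' &i

/-- `p(xᵢ)` if `b = 1`, and `¬ p(xᵢ)` if `b = 0`. -/
def fixLit (b : Fin 2) {n : ℕ} (i : Fin n) : sigS.BoundedFormula Empty n :=
  if b = 1 then fixS i else ∼(fixS i)

/-- `ψ^=_{≥n}` if `b = 1`, and `ψ^≠_{≥n}` if `b = 0`: there are at least `n` elements `x` with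
`s(x) = x`, respectively `s(x) ≠ x`. -/
noncomputable def psiFixGe (b : Fin 2) (n : ℕ) : sigS.Sentence :=
  (distinct sigS n ⊓ BoundedFormula.iInf fun i : Fin n => fixLit b i).exs

/-- `ψ^=_{=n}` if `b = 1`, and `ψ^≠_{=n}` if `b = 0`: there are exactly `n` elements `x` with
`s(x) = x`, respectively `s(x) ≠ x`. -/
noncomputable def psiFixEq (b : Fin 2) (n : ℕ) : sigS.Sentence :=
  (distinct sigS n ⊓ (BoundedFormula.iInf fun i : Fin n => fixLit b i) ⊓
    ∀' ((fixLit b (Fin.last n)).imp (BoundedFormula.iSup fun i : Fin n =>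
      (&(Fin.last n) =' &(Fin.castSucc i) : sigS.BoundedFormula Empty (n + 1))))).exs

/-- The closed term `tⁱ(a)`. -/
def iterA (i : ℕ) : sigT.Term (Empty ⊕ Fin 0) :=
  (fun τ => Functions.apply₁ (L := sigT) SymT.t τ)^[i] (Constants.term (L := sigT) SymT.a)

/-- `dif_n(a)`: the values of `a, t(a), …, tⁿ⁻¹(a)` are distinct. -/
noncomputable def difA (n : ℕ) : sigT.Sentence :=
  BoundedFormula.iInf fun p : {p : Fin n × Fin n // p.1 < p.2} => ∼(iterA p.1.1 =' iterA p.1.2)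

/-- `orb_n(a)`, for `n ≥ 1`: the orbit of `a` under `t` has exactly `n` elements. -/
noncomputable def orbA (n : ℕ) : sigT.Sentence :=
  if n = 1 then iterA 1 =' iterA 0 else difA n ⊓ ∼(difA (n + 1))

/-! ## The theories -/

/-- The atomic formula `Pₙ`, as a sentence. -/
def atomP (n : ℕ+) : sigP.Sentence :=
  Relations.formula (L := sigP) (SymP.P n) Fin.elim0

/-- `T_=`, axiomatized by `Pₙ → ψ_{=n}` for `n ≥ 1`. -/
def TEq : sigP.Theory :=
  {σ | ∃ n : ℕ+, σ = (atomP n).imp (psiEq sigP n)}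

/-- `f_b(k)`: the number of `i` with `1 ≤ i ≤ k` and `f(i) = b`. -/
def count (f : ℕ+ → Fin 2) (b : Fin 2) (k : ℕ) : ℕ :=
  ((Finset.range k).filter fun i => f i.succPNat = b).card

/-- The functions `f` from which `T_f` is built: `f` is not computable, `f(1) = 1`, and for every
`k ≥ 1`, `f` maps half of the numbers between `1` and `2ᵏ` to `1` and the other half to `0`. -/
def IsAdmissible (f : ℕ+ → Fin 2) : Prop :=
  ¬ Computable f ∧ f 1 = 1 ∧
    ∀ k : ℕ, 1 ≤ k → 2 * count f 1 (2 ^ k) = 2 ^ k ∧ 2 * count f 0 (2 ^ k) = 2 ^ k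

/-- The functions `g` from which `T_g` is built: in addition, `g(2n+1) = g(2n+2)` for all
`n ≥ 2`. -/
def IsPairedAdmissible (g : ℕ+ → Fin 2) : Prop :=
  IsAdmissible g ∧ ∀ n : ℕ, 2 ≤ n → g (2 * n).succPNat = g (2 * n + 1).succPNat

/-- `T_f`, axiomatized by
`[ψ^=_{≥f₁(k)} ∧ ψ^≠_{≥f₀(k)}] ∨ ⋁_{i=1}^{k} [ψ^=_{=f₁(i)} ∧ ψ^≠_{=f₀(i)}]` for `k ≥ 1`. -/
def TFun (f : ℕ+ → Fin 2) : sigS.Theory :=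
  {σ | ∃ k : ℕ+, σ =
    (psiFixGe 1 (count f 1 k) ⊓ psiFixGe 0 (count f 0 k)) ⊔
      BoundedFormula.iSup fun i : Fin k =>
        psiFixEq 1 (count f 1 (i + 1)) ⊓ psiFixEq 0 (count f 0 (i + 1))}

/-- `T_orb²`, axiomatized by `orb_n(a) → ψ_{≤2n}` for `n ≥ 1`. -/
def TOrb : sigT.Theory :=
  {σ | ∃ n : ℕ+, σ = (orbA n).imp (psiLe sigT (2 * n))}

end TheoryCombination

open TheoryCombination

/-! The idea is that `T_f` hides a noncomputable function behind the size of the domain. In a model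
of `T_f` with `n` elements, `s` has exactly `f₁(n)` fixed points (`encard_fixSet_of_card`), so
whoever can fix the size can read off `f`. Quantifier-free formulas over `s` alone cannot: they
bound the domain from below but never from above.

Why `T_f` is harmless alone. The truth of a quantifier-free formula of code `c` depends only on the
values of its subterms, a set `U` of at most `c + 1` elements (`exists_finset_formula`). Around `U`
one builds a structure with exactly `2 ^ (c + 1)` fixed and as many moved elements. Since `f` is
balanced at powers of two, this is a model of `T_f` of size `2 ^ (c + 2)`, for every admissible `f`
(`IsAdmissible.exists_model_card`). Hence satisfiability in `T_f` is satisfiability in arbitrary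
structures, which is decidable. A witness adjoins trivial equations between `2 ^ (c + 2)` fresh
variables, enough to name the whole domain. Smoothness holds because fixed and moved elements can be
added freely and `f₀`, `f₁` are monotone.

Why the combination is undecidable. In `T_=` the atom `Pₙ` forces `n` elements, so `Pₙ` together
with `n` distinct variables, `j` of them fixed by `s`, is satisfiable exactly when `j ≤ f₁(n)`. A
decision procedure would compute `f₁`, hence `f` (`computable_count_of_isDecidable`,
`computable_of_growth`). In `T_orb²` the equation `tⁿ(a) = a` forces at most `2n` elements, which
gives `g₁` at even arguments only; the pairing of the values of `g` makes this sufficient.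

Why the first theories are decidable. For `T_=`, either some relevant `Pₖ` is true and the model has
`k ≤ c` elements, or all of them are false and `U` suffices. For `T_orb²`, let `U` also contain `a`.
If the orbit of `a` stays in `U`, the model has at most `2 |U|` elements; if it leaves `U`, its
continuation can be replaced by a chain of new elements, long enough for the axioms.

All decision procedures are bounded searches through finite tables, with a primitive recursive
evaluation of codes of formulas (`Evaluator.isDecidable`, `isDecidable_of_tables`). -/

namespace TheoryCombination

open FirstOrder FirstOrder.Language EffectiveSignature

/-! ## Course-of-values recursion with a parameter -/

section CourseOfValues

variable {E σ : Type}

/-- The list of the first `n` values of the function defined by course-of-values recursion. -/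
def history (g : E → List σ → σ) (e : E) : ℕ → List σ
  | 0 => []
  | n + 1 => history g e n ++ [g e (history g e n)]

/-- The function defined by course-of-values recursion from `g`. -/
def courseRec (g : E → List σ → σ) (e : E) (n : ℕ) : σ := g e (history g e n)

theorem length_history (g : E → List σ → σ) (e : E) (n : ℕ) : (history g e n).length = n := by
  induction n with
  | zero => rfl
  | succ n ih => simp [history, ih]

theorem getD_history (g : E → List σ → σ) (e : E) {n k : ℕ} (h : k < n) (d : σ) :
    (history g e n).getD k d = courseRec g e k := by
  induction n with
  | zero => omega
  | succ n ih =>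
    have hl := length_history g e n
    rcases Nat.lt_succ_iff_lt_or_eq.1 h with h | rfl
    · rw [history, List.getD_append _ _ _ _ (by omega), ih h]
    · rw [history, List.getD_append_right _ _ _ _ (by omega), hl]
      simp [courseRec]

/-- Ordinary primitive recursion can carry the whole list of earlier values. Evaluation of codes
needs this because a code refers to arbitrary smaller codes; the parameter will be a structure with
an assignment. -/
theorem courseRec_primrec [Primcodable E] [Primcodable σ] {g : E → List σ → σ} (hg : Primrec₂ g) : Primrec₂ (courseRec g) := by
  have h : Primrec fun p : E × ℕ => history g p.1 p.2 := by
    refine (Primrec.nat_rec' (f := fun p : E × ℕ => p.2) (g := fun _ => ([] : List σ))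
      (h := fun p q => q.2 ++ [g p.1 q.2]) Primrec.snd (Primrec.const []) ?_).of_eq ?_
    · exact Primrec.list_concat.comp (Primrec.snd.comp Primrec.snd)
        (hg.comp (Primrec.fst.comp Primrec.fst) (Primrec.snd.comp Primrec.snd))
    · rintro ⟨e, n⟩
      induction n with
      | zero => rfl
      | succ n ih => exact congrArg (fun l => l ++ [g e l]) ih
  exact hg.comp Primrec.fst h

end CourseOfValues

/-! ## Evaluation of codes of terms and formulas -/

/-- The list of natural numbers with a given code. -/
def listOfCode (c : ℕ) : List ℕ := (Encodable.decode c).getD []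

theorem listOfCode_encode (l : List ℕ) : listOfCode (Encodable.encode l) = l := by
  simp [listOfCode]

theorem encode_listOfCode (c : ℕ) : Encodable.encode (listOfCode c) = c := by
  have h : (Encodable.decode c : Option (List ℕ)) = some (Denumerable.ofNat (List ℕ) c) :=
    Denumerable.decode_eq_ofNat _ c
  rw [listOfCode, h]
  exact Denumerable.encode_ofNat (α := List ℕ) c

theorem listOfCode_primrec : Primrec listOfCode :=
  Primrec.option_getD.comp Primrec.decode (Primrec.const [])

/-- Each list cell is coded as a successor of a pair, and a pair is at least the sum of its entries.
The summand `1` per entry later pays for the extra element in the bound on the number of subterm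
values. -/
theorem sum_le_encode (l : List ℕ) : (l.map (· + 1)).sum ≤ Encodable.encode l := by
  induction l with
  | nil => simp
  | cons a l ih =>
    have := Nat.add_le_pair a (Encodable.encode l)
    simp only [List.map_cons, List.sum_cons, Encodable.encode_list_cons, Encodable.encode_nat]
    omega

theorem lt_encode_of_mem {l : List ℕ} {a : ℕ} (h : a ∈ l) : a < Encodable.encode l := by
  have h1 : a + 1 ≤ (l.map (· + 1)).sum :=
    List.single_le_sum (by simp) _ (List.mem_map_of_mem h)
  have := sum_le_encode l
  omega

/-- A family of structures on the natural numbers, with assignments, whose function and relation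
symbols can be evaluated from their codes by primitive recursive functions. -/
structure Evaluator (L : FirstOrder.Language.{0, 0}) [EffectiveSignature L] (E : Type)
    [Primcodable E] where
  str : E → L.Structure ℕ
  val : E → ℕ → ℕ
  funVal : E → ℕ × ℕ × List (Option ℕ) → Option ℕ
  relVal : E → ℕ × ℕ × List (Option ℕ) → Option Bool
  val_primrec : Primrec₂ val
  funVal_primrec : Primrec₂ funVal
  relVal_primrec : Primrec₂ relVal
  funVal_code : ∀ (e : E) (n : ℕ) (f : L.Functions n) (xs : Fin n → ℕ),
    funVal e (n, funCode f, List.ofFn fun i => some (xs i)) = some ((str e).funMap f xs)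
  exists_of_funVal : ∀ (e : E) (n k : ℕ) (l : List (Option ℕ)) (r : ℕ),
    funVal e (n, k, l) = some r →
      ∃ (f : L.Functions n) (xs : Fin n → ℕ), funCode f = k ∧ l = List.ofFn fun i => some (xs i)
  relVal_code : ∀ (e : E) (n : ℕ) (R : L.Relations n) (xs : Fin n → ℕ), ∃ b : Bool,
    relVal e (n, relCode R, List.ofFn fun i => some (xs i)) = some b ∧
      (b = true ↔ (str e).RelMap R xs)
  exists_of_relVal : ∀ (e : E) (n k : ℕ) (l : List (Option ℕ)) (r : Bool),
    relVal e (n, k, l) = some r →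
      ∃ (R : L.Relations n) (xs : Fin n → ℕ), relCode R = k ∧ l = List.ofFn fun i => some (xs i)

namespace Evaluator

variable {L : FirstOrder.Language.{0, 0}} [EffectiveSignature L] {E : Type} [Primcodable E]
  (ev : Evaluator L E)

/-- One step in the evaluation of terms, given the list of the values of all smaller codes. -/
def termStep (e : E) (l : List (Option ℕ)) : Option ℕ :=
  if l.length.unpair.1 = 0 then some (ev.val e l.length.unpair.2)
  else if l.length.unpair.1 = 2 then
    ev.funVal e (l.length.unpair.2.unpair.1, l.length.unpair.2.unpair.2.unpair.1,
      (listOfCode l.length.unpair.2.unpair.2.unpair.2).map fun k => l.getD k none)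
  else none

/-- The value of the term with a given code, and `none` if there is no such term. -/
def termVal : E → ℕ → Option ℕ := courseRec ev.termStep

/-- One step in the evaluation of quantifier-free formulas. -/
def formulaStep (e : E) (l : List (Option Bool)) : Option Bool :=
  if l.length = 0 then some false
  else if l.length.unpair.1 = 1 then
    (ev.termVal e l.length.unpair.2.unpair.1).bind fun x =>
      (ev.termVal e l.length.unpair.2.unpair.2).map fun y => decide (x = y)
  else if l.length.unpair.1 = 2 then
    ev.relVal e (l.length.unpair.2.unpair.1, l.length.unpair.2.unpair.2.unpair.1,
      (listOfCode l.length.unpair.2.unpair.2.unpair.2).map fun k => ev.termVal e k)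
  else if l.length.unpair.1 = 3 then
    (l.getD l.length.unpair.2.unpair.1 none).bind fun x =>
      (l.getD l.length.unpair.2.unpair.2 none).map fun y => !x || y
  else none

/-- The truth value of the quantifier-free formula with a given code, and `none` if there is no
such formula. -/
def formulaVal : E → ℕ → Option Bool := courseRec ev.formulaStep

theorem termStep_primrec : Primrec₂ ev.termStep := by
  have hl : Primrec fun p : E × List (Option ℕ) => p.2.length :=
    Primrec.list_length.comp Primrec.snd
  have h1 {γ : Type} [Primcodable γ] {f : γ → ℕ} (hf : Primrec f) :
      Primrec fun p => (f p).unpair.1 := Primrec.fst.comp (Primrec.unpair.comp hf)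
  have h2 {γ : Type} [Primcodable γ] {f : γ → ℕ} (hf : Primrec f) :
      Primrec fun p => (f p).unpair.2 := Primrec.snd.comp (Primrec.unpair.comp hf)
  refine Primrec.ite (Primrec.eq.comp (h1 hl) (Primrec.const 0))
    (Primrec.option_some.comp (ev.val_primrec.comp Primrec.fst (h2 hl)))
    (Primrec.ite (Primrec.eq.comp (h1 hl) (Primrec.const 2))
      (ev.funVal_primrec.comp Primrec.fst ?_) (Primrec.const none))
  refine Primrec.pair (h1 (h2 hl)) (Primrec.pair (h1 (h2 (h2 hl))) ?_)
  exact Primrec.list_map (listOfCode_primrec.comp (h2 (h2 (h2 hl))))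
    ((Primrec.list_getD none).comp (Primrec.snd.comp Primrec.fst) Primrec.snd)

theorem termVal_primrec : Primrec₂ ev.termVal := courseRec_primrec ev.termStep_primrec

theorem formulaStep_primrec : Primrec₂ ev.formulaStep := by
  have hl : Primrec fun p : E × List (Option Bool) => p.2.length :=
    Primrec.list_length.comp Primrec.snd
  have h1 {γ : Type} [Primcodable γ] {f : γ → ℕ} (hf : Primrec f) :
      Primrec fun p => (f p).unpair.1 := Primrec.fst.comp (Primrec.unpair.comp hf)
  have h2 {γ : Type} [Primcodable γ] {f : γ → ℕ} (hf : Primrec f) :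
      Primrec fun p => (f p).unpair.2 := Primrec.snd.comp (Primrec.unpair.comp hf)
  have ht := ev.termVal_primrec
  refine Primrec.ite (Primrec.eq.comp hl (Primrec.const 0)) (Primrec.const _)
    (Primrec.ite (Primrec.eq.comp (h1 hl) (Primrec.const 1)) ?_
    (Primrec.ite (Primrec.eq.comp (h1 hl) (Primrec.const 2))
      (ev.relVal_primrec.comp Primrec.fst ?_)
    (Primrec.ite (Primrec.eq.comp (h1 hl) (Primrec.const 3)) ?_ (Primrec.const none))))
  · refine Primrec.option_bind (ht.comp Primrec.fst (h1 (h2 hl))) ?_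
    refine Primrec.option_map (ht.comp (Primrec.fst.comp Primrec.fst)
      ((h2 (h2 hl)).comp Primrec.fst)) ?_
    exact Primrec.eq.decide.comp (Primrec.snd.comp Primrec.fst) Primrec.snd
  · refine Primrec.pair (h1 (h2 hl)) (Primrec.pair (h1 (h2 (h2 hl))) ?_)
    exact Primrec.list_map (listOfCode_primrec.comp (h2 (h2 (h2 hl))))
      (ht.comp (Primrec.fst.comp Primrec.fst) Primrec.snd)
  · refine Primrec.option_bind ((Primrec.list_getD none).comp Primrec.snd (h1 (h2 hl))) ?_
    refine Primrec.option_map ((Primrec.list_getD none).comp (Primrec.snd.comp Primrec.fst)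
      ((h2 (h2 hl)).comp Primrec.fst)) ?_
    exact Primrec.or.comp (Primrec.not.comp (Primrec.snd.comp Primrec.fst)) Primrec.snd

theorem formulaVal_primrec : Primrec₂ ev.formulaVal := courseRec_primrec ev.formulaStep_primrec

theorem termVal_pair_zero (e : E) (x : ℕ) : ev.termVal e (Nat.pair 0 x) = some (ev.val e x) := by
  simp [termVal, courseRec, termStep, length_history]

theorem lt_pair_of_le {a b c : ℕ} (ha : 0 < a) (h : c ≤ b) : c < Nat.pair a b := by
  have := Nat.add_le_pair a b
  omega

theorem termVal_pair_two (e : E) (n k : ℕ) (l : List ℕ) :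
    ev.termVal e (Nat.pair 2 (Nat.pair n (Nat.pair k (Encodable.encode l)))) =
      ev.funVal e (n, k, l.map (ev.termVal e)) := by
  have h : ∀ c ∈ l, c < Nat.pair 2 (Nat.pair n (Nat.pair k (Encodable.encode l))) := by
    intro c hc
    have := lt_encode_of_mem hc
    have := Nat.right_le_pair k (Encodable.encode l)
    have := Nat.right_le_pair n (Nat.pair k (Encodable.encode l))
    exact lt_pair_of_le two_pos (by omega)
  have h' : l.map (fun c => (history ev.termStep e
      (Nat.pair 2 (Nat.pair n (Nat.pair k (Encodable.encode l))))).getD c none) =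
        l.map (ev.termVal e) :=
    List.map_congr_left fun c hc => getD_history _ e (h c hc) none
  rw [termVal, courseRec, termStep]
  simp only [length_history, Nat.unpair_pair, listOfCode_encode]
  rw [if_neg two_ne_zero, if_pos trivial, h', termVal]

theorem termVal_termCode (e : E) (t : L.Term (ℕ ⊕ Fin 0)) (xs : Fin 0 → ℕ) :
    ev.termVal e (termCode t) =
      some (@Term.realize L ℕ (ev.str e) _ (Sum.elim (ev.val e) xs) t) := by
  induction t with
  | var x =>
    rcases x with x | i
    · exact ev.termVal_pair_zero e x
    · exact i.elim0
  | func f ts ih =>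
    rw [termCode, termVal_pair_two, List.map_ofFn]
    have : (ev.termVal e ∘ fun i => termCode (ts i)) = fun i =>
        some (@Term.realize L ℕ (ev.str e) _ (Sum.elim (ev.val e) xs) (ts i)) := funext ih
    rw [this, ev.funVal_code]
    rfl

/-- Decidability concerns all natural numbers, so the evaluation must also reject those that code
nothing. The converse fields of `Evaluator` recover the symbol, and strong induction on the code
recovers the arguments. -/
theorem exists_of_termVal (e : E) (c : ℕ) : ∀ r, ev.termVal e c = some r →
    ∃ t : L.Term (ℕ ⊕ Fin 0), termCode t = c := by
  induction c using Nat.strong_induction_on with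
  | _ c ih =>
    intro r h
    obtain ⟨a, b, rfl⟩ : ∃ a b, c = Nat.pair a b := ⟨_, _, (Nat.pair_unpair c).symm⟩
    by_cases ha : a = 0
    · subst ha
      exact ⟨.var (Sum.inl b), rfl⟩
    by_cases ha' : a = 2
    · subst ha'
      obtain ⟨n, b, rfl⟩ : ∃ n b', b = Nat.pair n b' := ⟨_, _, (Nat.pair_unpair b).symm⟩
      obtain ⟨k, b, rfl⟩ : ∃ n b', b = Nat.pair n b' := ⟨_, _, (Nat.pair_unpair b).symm⟩
      obtain ⟨l, rfl⟩ : ∃ l : List ℕ, b = Encodable.encode l := ⟨_, (encode_listOfCode b).symm⟩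
      rw [termVal_pair_two] at h
      obtain ⟨f, xs, rfl, hl⟩ := ev.exists_of_funVal _ _ _ _ _ h
      have hlen : l.length = n := by simpa using congrArg List.length hl
      subst hlen
      have hget (i : Fin l.length) : ∃ t : L.Term (ℕ ⊕ Fin 0), termCode t = l.get i := by
        have hm : l.get i ∈ l := List.get_mem l i
        have := lt_encode_of_mem hm
        have := Nat.right_le_pair (funCode f) (Encodable.encode l)
        have := Nat.right_le_pair l.length (Nat.pair (funCode f) (Encodable.encode l))
        refine ih _ (lt_pair_of_le two_pos (by omega)) (xs i) ?_
        have := congrArg (fun l' => l'[(i : ℕ)]?) hl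
        simpa using this
      choose ts hts using hget
      refine ⟨.func f ts, ?_⟩
      rw [termCode, funext hts, List.ofFn_get]
    · simp [termVal, courseRec, termStep, length_history, ha, ha'] at h

theorem formulaVal_falsum (e : E) : ev.formulaVal e (Nat.pair 0 0) = some false := by
  simp [formulaVal, courseRec, formulaStep, length_history, show Nat.pair 0 0 = 0 from rfl]

theorem pair_ne_zero {a b : ℕ} (ha : 0 < a) : Nat.pair a b ≠ 0 :=
  (Nat.zero_le b |> lt_pair_of_le ha).ne'

theorem formulaVal_equal (e : E) (a b : ℕ) : ev.formulaVal e (Nat.pair 1 (Nat.pair a b)) =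
    (ev.termVal e a).bind fun x => (ev.termVal e b).map fun y => decide (x = y) := by
  rw [formulaVal, courseRec, formulaStep]
  simp [length_history, pair_ne_zero]

theorem formulaVal_rel (e : E) (n k : ℕ) (l : List ℕ) :
    ev.formulaVal e (Nat.pair 2 (Nat.pair n (Nat.pair k (Encodable.encode l)))) =
      ev.relVal e (n, k, l.map (ev.termVal e)) := by
  rw [formulaVal, courseRec, formulaStep]
  simp [length_history, pair_ne_zero, listOfCode_encode]

theorem formulaVal_imp (e : E) (a b : ℕ) : ev.formulaVal e (Nat.pair 3 (Nat.pair a b)) =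
    (ev.formulaVal e a).bind fun x => (ev.formulaVal e b).map fun y => !x || y := by
  rw [formulaVal, courseRec, formulaStep]
  simp only [length_history, Nat.unpair_pair]
  rw [if_neg (pair_ne_zero (by omega)), if_neg (by omega), if_neg (by omega), if_pos trivial,
    getD_history _ _ (lt_pair_of_le (by omega) (Nat.left_le_pair a b)),
    getD_history _ _ (lt_pair_of_le (by omega) (Nat.right_le_pair a b))]

theorem formulaVal_formulaCode (e : E) (φ : L.Formula ℕ) (hφ : φ.IsQF) :
    ∃ b : Bool, ev.formulaVal e (formulaCode φ) = some b ∧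
      (b = true ↔ @Formula.Realize L ℕ (ev.str e) _ φ (ev.val e)) := by
  classical
  let := ev.str e
  induction hφ with
  | falsum => exact ⟨false, ev.formulaVal_falsum e, by simp [Formula.Realize, BoundedFormula.Realize]⟩
  | of_isAtomic h =>
    cases h with
    | equal t₁ t₂ =>
      refine ⟨decide (t₁.realize (Sum.elim (ev.val e) default) =
        t₂.realize (Sum.elim (ev.val e) default)), (ev.formulaVal_equal e _ _).trans ?_,
        decide_eq_true_iff.trans ?_⟩
      swap
      · rw [Formula.Realize, Term.bdEqual, BoundedFormula.Realize]
        convert Iff.rfl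
      rw [ev.termVal_termCode e t₁ default, ev.termVal_termCode e t₂ default]
      simp only [Option.bind_some, Option.map_some]
    | rel R ts =>
      obtain ⟨b, hb, hb'⟩ := ev.relVal_code e _ R fun i =>
        (ts i).realize (Sum.elim (ev.val e) default)
      refine ⟨b, (ev.formulaVal_rel e _ _ _).trans ?_,
        hb'.trans ?_⟩
      swap
      · rw [Formula.Realize, Relations.boundedFormula, BoundedFormula.Realize]
        convert Iff.rfl
      rw [← hb, List.map_ofFn]
      congr 4
      exact funext fun i => ev.termVal_termCode e (ts i) default
  | imp _ _ ih₁ ih₂ =>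
    obtain ⟨b₁, h₁, h₁'⟩ := ih₁
    obtain ⟨b₂, h₂, h₂'⟩ := ih₂
    refine ⟨!b₁ || b₂, (ev.formulaVal_imp e _ _).trans ?_, ?_⟩
    · rw [h₁, h₂]
      rfl
    · rw [Formula.Realize, BoundedFormula.realize_imp, ← Formula.Realize, ← Formula.Realize,
        ← h₁', ← h₂']
      cases b₁ <;> cases b₂ <;> simp

theorem exists_of_formulaVal (e : E) (c : ℕ) : ∀ r, ev.formulaVal e c = some r →
    ∃ φ : L.Formula ℕ, φ.IsQF ∧ formulaCode φ = c := by
  induction c using Nat.strong_induction_on with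
  | _ c ih =>
    intro r h
    obtain ⟨a, b, rfl⟩ : ∃ a b, c = Nat.pair a b := ⟨_, _, (Nat.pair_unpair c).symm⟩
    by_cases h0 : Nat.pair a b = 0
    · exact ⟨.falsum, .falsum, by rw [h0]; rfl⟩
    by_cases h1 : a = 1
    · subst h1
      obtain ⟨x, y, rfl⟩ : ∃ x y, b = Nat.pair x y := ⟨_, _, (Nat.pair_unpair b).symm⟩
      rw [formulaVal_equal, Option.bind_eq_some_iff] at h
      obtain ⟨r₁, hr₁, h⟩ := h
      obtain ⟨r₂, hr₂, h⟩ := Option.map_eq_some_iff.1 h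
      obtain ⟨t₁, rfl⟩ := ev.exists_of_termVal e x _ hr₁
      obtain ⟨t₂, rfl⟩ := ev.exists_of_termVal e y _ hr₂
      exact ⟨.equal t₁ t₂, .of_isAtomic (.equal t₁ t₂), rfl⟩
    by_cases h2 : a = 2
    · subst h2
      obtain ⟨n, b, rfl⟩ : ∃ n b', b = Nat.pair n b' := ⟨_, _, (Nat.pair_unpair b).symm⟩
      obtain ⟨k, b, rfl⟩ : ∃ n b', b = Nat.pair n b' := ⟨_, _, (Nat.pair_unpair b).symm⟩
      obtain ⟨l, rfl⟩ : ∃ l : List ℕ, b = Encodable.encode l := ⟨_, (encode_listOfCode b).symm⟩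
      rw [formulaVal_rel] at h
      obtain ⟨R, xs, rfl, hl⟩ := ev.exists_of_relVal _ _ _ _ _ h
      have hlen : l.length = n := by simpa using congrArg List.length hl
      subst hlen
      have hget (i : Fin l.length) : ∃ t : L.Term (ℕ ⊕ Fin 0), termCode t = l.get i := by
        refine ev.exists_of_termVal e _ (xs i) ?_
        have := congrArg (fun l' => l'[(i : ℕ)]?) hl
        simpa using this
      choose ts hts using hget
      refine ⟨.rel R ts, .of_isAtomic (.rel R ts), ?_⟩
      rw [formulaCode, funext hts, List.ofFn_get]
    by_cases h3 : a = 3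
    · subst h3
      obtain ⟨x, y, rfl⟩ : ∃ x y, b = Nat.pair x y := ⟨_, _, (Nat.pair_unpair b).symm⟩
      rw [formulaVal_imp, Option.bind_eq_some_iff] at h
      obtain ⟨r₁, hr₁, h⟩ := h
      obtain ⟨r₂, hr₂, h⟩ := Option.map_eq_some_iff.1 h
      obtain ⟨φ, hφ, rfl⟩ := ih _ (lt_pair_of_le (by omega) (Nat.left_le_pair x y)) _ hr₁
      obtain ⟨ψ, hψ, rfl⟩ := ih _ (lt_pair_of_le (by omega) (Nat.right_le_pair _ y)) _ hr₂
      exact ⟨.imp φ ψ, .imp hφ hψ, rfl⟩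
    -- The remaining numbers, among them the codes of quantified formulas with tag `4`, have no
    -- value.
    · rw [formulaVal, courseRec, formulaStep] at h
      simp [length_history, h0, h1, h2, h3] at h

theorem formulaVal_eq_true_iff (e : E) (c : ℕ) : ev.formulaVal e c = some true ↔
    ∃ φ : QFFormula L, formulaCode φ.1 = c ∧
      @Formula.Realize L ℕ (ev.str e) _ φ.1 (ev.val e) := by
  constructor
  · intro h
    obtain ⟨φ, hφ, rfl⟩ := ev.exists_of_formulaVal e c _ h
    obtain ⟨b, hb, hb'⟩ := ev.formulaVal_formulaCode e φ hφ
    exact ⟨⟨φ, hφ⟩, rfl, hb'.1 (Option.some_injective _ (hb.symm.trans h))⟩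
  · rintro ⟨φ, rfl, h⟩
    obtain ⟨b, hb, hb'⟩ := ev.formulaVal_formulaCode e φ.1 φ.2
    rw [hb, hb'.2 h]

/-- A theory is decidable if satisfiability amounts to truth in one of the structures of an
evaluator, and the search for that structure can be bounded. -/
theorem isDecidable (T : L.Theory) (S : ℕ → List E) (hS : Primrec S)
    (sound : ∀ (φ : QFFormula L), ∀ e ∈ S (formulaCode φ.1),
      @Formula.Realize L ℕ (ev.str e) _ φ.1 (ev.val e) → IsSat.{w} T φ.1)
    (complete : ∀ φ : QFFormula L, IsSat.{w} T φ.1 → ∃ e ∈ S (formulaCode φ.1),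
      @Formula.Realize L ℕ (ev.str e) _ φ.1 (ev.val e)) :
    IsDecidable.{w} T := by
  have hrel : PrimrecRel fun (e : E) (c : ℕ) => ev.formulaVal e c = some true :=
    Primrec.eq.comp ev.formulaVal_primrec (Primrec.const _)
  have h := hrel.exists_mem_list.comp hS Primrec.id
  obtain ⟨_, h⟩ := h
  refine ⟨fun _ => Classical.propDecidable _, h.to_comp.of_eq fun c => ?_⟩
  rw [decide_eq_decide]
  constructor
  · rintro ⟨e, he, hval⟩
    obtain ⟨φ, rfl, hφ⟩ := (ev.formulaVal_eq_true_iff e _).1 hval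
    exact ⟨φ, rfl, sound φ e he hφ⟩
  · rintro ⟨φ, rfl, h⟩
    obtain ⟨e, he, h⟩ := complete φ h
    exact ⟨e, he, (ev.formulaVal_eq_true_iff e _).2 ⟨φ, rfl, h⟩⟩

end Evaluator

/-! ## Partial embeddings and satisfaction of quantifier-free formulas -/

section PartialEmbedding

universe u v

variable {L : FirstOrder.Language.{0, 0}} [EffectiveSignature L]

/-- `h` behaves on `U` like an embedding, as far as relation symbols of code at most `c` are
concerned. -/
structure IsPartialEmbedding {A : Type u} {B : Type v} [L.Structure A] [L.Structure B]
    (U : Set A) (c : ℕ) (h : A → B) : Prop where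
  injOn : Set.InjOn h U
  map_fun : ∀ (n : ℕ) (f : L.Functions n) (xs : Fin n → A), (∀ i, xs i ∈ U) →
    Structure.funMap f xs ∈ U → h (Structure.funMap f xs) = Structure.funMap f (h ∘ xs)
  map_rel : ∀ (n : ℕ) (R : L.Relations n) (xs : Fin n → A), (∀ i, xs i ∈ U) → relCode R ≤ c →
    (Structure.RelMap R (h ∘ xs) ↔ Structure.RelMap R xs)

theorem IsPartialEmbedding.mono {A : Type u} {B : Type v} [L.Structure A] [L.Structure B]
    {U V : Set A} {c d : ℕ} {h : A → B} (hh : IsPartialEmbedding (L := L) U c h) (hV : V ⊆ U)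
    (hd : d ≤ c) : IsPartialEmbedding (L := L) V d h where
  injOn := hh.injOn.mono hV
  map_fun n f xs hxs hf := hh.map_fun n f xs (fun i => hV (hxs i)) (hV hf)
  map_rel n R xs hxs hR := hh.map_rel n R xs (fun i => hV (hxs i)) (hR.trans hd)

/-- The values of the subterms of a term form a set whose size is bounded by the code, and the
value of the term is preserved by all partial embeddings of that set. -/
theorem exists_finset_term {A : Type u} [L.Structure A] (v : ℕ → A) (t : L.Term (ℕ ⊕ Fin 0)) :
    ∃ U : Finset A, U.card ≤ termCode t + 1 ∧ t.realize (Sum.elim v default) ∈ U ∧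
      ∀ (B : Type v) [L.Structure B] (h : A → B) (v' : ℕ → B) (c : ℕ),
        (∀ x ≤ termCode t, v' x = h (v x)) → IsPartialEmbedding (L := L) (U : Set A) c h →
          t.realize (Sum.elim v' default) = h (t.realize (Sum.elim v default)) := by
  classical
  induction t with
  | var x =>
    rcases x with x | i
    · refine ⟨{v x}, by simp, by simp, fun B _ h v' c hv' _ => ?_⟩
      exact hv' x (Nat.right_le_pair 0 x)
    · exact i.elim0
  | @func n f ts ih =>
    choose U hcard hmem hU using ih
    have hsum : ∑ i, (termCode (ts i) + 1) ≤ Encodable.encode (List.ofFn fun i => termCode (ts i)) := by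
      refine le_trans (le_of_eq ?_) (sum_le_encode _)
      rw [List.map_ofFn, List.sum_ofFn]
      rfl
    have hcode : Encodable.encode (List.ofFn fun i => termCode (ts i)) ≤ termCode (.func f ts) := by
      rw [termCode]
      exact ((Nat.right_le_pair _ _).trans (Nat.right_le_pair _ _)).trans (Nat.right_le_pair _ _)
    -- The sets of the arguments have together at most `termCode` many elements; the value of the
    -- whole term accounts for the `+ 1`.
    refine ⟨insert ((Term.func f ts).realize (Sum.elim v default)) (Finset.univ.biUnion U),
      ?_, Finset.mem_insert_self _ _, fun B _ h v' c hv' hh => ?_⟩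
    · refine (Finset.card_insert_le _ _).trans (Nat.succ_le_succ ?_)
      refine (Finset.card_biUnion_le.trans (Finset.sum_le_sum fun i _ => hcard i)).trans ?_
      omega
    · have hsub (i : Fin n) : (U i : Set A) ⊆
          ↑(insert ((Term.func f ts).realize (Sum.elim v default)) (Finset.univ.biUnion U)) :=
        fun x hx => Finset.mem_coe.2 (Finset.mem_insert_of_mem
          (Finset.mem_biUnion.2 ⟨i, Finset.mem_univ i, hx⟩))
      have hi (i : Fin n) : (ts i).realize (Sum.elim v' default) =
          h ((ts i).realize (Sum.elim v default)) := by
        refine hU i B h v' c (fun x hx => hv' x (hx.trans ?_)) (hh.mono (hsub i) le_rfl)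
        refine le_trans ?_ hcode
        exact (lt_encode_of_mem ((List.mem_ofFn' (fun i => termCode (ts i)) (termCode (ts i))).2 ⟨i, rfl⟩)).le
      rw [Term.realize_func, Term.realize_func, hh.map_fun n f _
        (fun i => hsub i (hmem i)) (Finset.mem_coe.2 (Finset.mem_insert_self _ _))]
      exact congrArg _ (funext hi)

/-- The values of the subterms of a quantifier-free formula form a set whose size is bounded by
the code, and partial embeddings of that set preserve the truth of the formula. -/
theorem exists_finset_formula {A : Type u} [L.Structure A] (v : ℕ → A) (φ : L.Formula ℕ)
    (hφ : φ.IsQF) :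
    ∃ U : Finset A, U.card ≤ formulaCode φ + 1 ∧
      ∀ (B : Type v) [L.Structure B] (h : A → B) (v' : ℕ → B),
        (∀ x ≤ formulaCode φ, v' x = h (v x)) →
          IsPartialEmbedding (L := L) (U : Set A) (formulaCode φ) h →
            (φ.Realize v' ↔ φ.Realize v) := by
  classical
  induction hφ with
  | falsum => exact ⟨∅, by simp, fun B _ h v' _ _ => Iff.rfl⟩
  | of_isAtomic ha =>
    cases ha with
    | equal t₁ t₂ =>
      obtain ⟨U₁, hc₁, hm₁, hU₁⟩ := exists_finset_term v t₁
      obtain ⟨U₂, hc₂, hm₂, hU₂⟩ := exists_finset_term v t₂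
      -- Each side contributes its code plus `1`; the tag `1` of the equation absorbs the surplus.
      have h1 := Nat.add_le_pair (termCode t₁) (termCode t₂)
      have h2 := Nat.add_le_pair 1 (Nat.pair (termCode t₁) (termCode t₂))
      have hcode : formulaCode (t₁ =' t₂) =
        Nat.pair 1 (Nat.pair (termCode t₁) (termCode t₂)) := rfl
      refine ⟨U₁ ∪ U₂, (Finset.card_union_le _ _).trans (by omega), fun B _ h v' hv' hh => ?_⟩
      have e₁ := hU₁ B h v' _ (fun x hx => hv' x (by omega)) (hh.mono (by simp) le_rfl)
      have e₂ := hU₂ B h v' _ (fun x hx => hv' x (by omega)) (hh.mono (by simp) le_rfl)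
      rw [Formula.Realize, Formula.Realize, BoundedFormula.realize_bdEqual,
        BoundedFormula.realize_bdEqual]
      refine Iff.trans (Eq.to_iff ?_) (hh.injOn.eq_iff (x := t₁.realize (Sum.elim v default))
        (y := t₂.realize (Sum.elim v default)) (by simp [hm₁]) (by simp [hm₂]))
      rw [← e₁, ← e₂]
    | @rel n R ts =>
      have ih := fun i => exists_finset_term v (ts i)
      choose U hcard hmem hU using ih
      have hsum : ∑ i, (termCode (ts i) + 1) ≤
          Encodable.encode (List.ofFn fun i => termCode (ts i)) := by
        refine le_trans (le_of_eq ?_) (sum_le_encode _)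
        rw [List.map_ofFn, List.sum_ofFn]
        rfl
      have hcode : formulaCode (R.boundedFormula ts) = Nat.pair 2 (Nat.pair n (Nat.pair (relCode R)
        (Encodable.encode (List.ofFn fun i => termCode (ts i))))) := rfl
      have h1 := Nat.add_le_pair (relCode R) (Encodable.encode (List.ofFn fun i => termCode (ts i)))
      have h2 := Nat.add_le_pair n (Nat.pair (relCode R)
        (Encodable.encode (List.ofFn fun i => termCode (ts i))))
      have h3 := Nat.add_le_pair 2 (Nat.pair n (Nat.pair (relCode R)
        (Encodable.encode (List.ofFn fun i => termCode (ts i)))))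
      refine ⟨Finset.univ.biUnion U, ?_, fun B _ h v' hv' hh => ?_⟩
      · refine (Finset.card_biUnion_le.trans (Finset.sum_le_sum fun i _ => hcard i)).trans ?_
        omega
      · have hsub (i : Fin n) : (U i : Set A) ⊆ ↑(Finset.univ.biUnion U) :=
          fun x hx => Finset.mem_coe.2 (Finset.mem_biUnion.2 ⟨i, Finset.mem_univ i, hx⟩)
        have hi (i : Fin n) : (ts i).realize (Sum.elim v' default) =
            h ((ts i).realize (Sum.elim v default)) := by
          refine hU i B h v' _ (fun x hx => hv' x (hx.trans ?_)) (hh.mono (hsub i) le_rfl)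
          have := lt_encode_of_mem ((List.mem_ofFn' (fun i => termCode (ts i))
            (termCode (ts i))).2 ⟨i, rfl⟩)
          omega
        rw [Formula.Realize, Formula.Realize, BoundedFormula.realize_rel,
          BoundedFormula.realize_rel, ← hh.map_rel n R _ (fun i => hsub i (hmem i)) (by omega)]
        exact Eq.to_iff (congrArg _ (funext hi))
  | @imp φ ψ _ _ ih₁ ih₂ =>
    obtain ⟨U₁, hc₁, hU₁⟩ := ih₁
    obtain ⟨U₂, hc₂, hU₂⟩ := ih₂
    have h1 := Nat.add_le_pair (formulaCode φ) (formulaCode ψ)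
    have h2 := Nat.add_le_pair 3 (Nat.pair (formulaCode φ) (formulaCode ψ))
    have hcode : formulaCode (φ.imp ψ) =
      Nat.pair 3 (Nat.pair (formulaCode φ) (formulaCode ψ)) := rfl
    refine ⟨U₁ ∪ U₂, (Finset.card_union_le _ _).trans (by omega), fun B _ h v' hv' hh => ?_⟩
    have e₁ := hU₁ B h v' (fun x hx => hv' x (by omega)) (hh.mono (by simp) (by omega))
    have e₂ := hU₂ B h v' (fun x hx => hv' x (by omega)) (hh.mono (by simp) (by omega))
    rw [Formula.realize_imp, Formula.realize_imp, e₁, e₂]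

/-- Truth of quantifier-free formulas is preserved by embeddings. -/
theorem realize_iff_of_isPartialEmbedding_univ {A : Type u} {B : Type v} [L.Structure A]
    [L.Structure B] {φ : L.Formula ℕ} (hφ : φ.IsQF) (h : A → B) (v : ℕ → A) (v' : ℕ → B)
    (hv : ∀ x ≤ formulaCode φ, v' x = h (v x))
    (hh : IsPartialEmbedding (L := L) Set.univ (formulaCode φ) h) :
    φ.Realize v' ↔ φ.Realize v := by
  obtain ⟨U, -, hU⟩ := exists_finset_formula.{u, v} v φ hφ
  exact hU B h v' hv (hh.mono (Set.subset_univ _) le_rfl)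

end PartialEmbedding

/-! ## Meaning of the axioms -/

section Semantics

theorem exists_fin_range {M : Type w} (F : Set M) (n : ℕ) (h : F.encard = n) :
    ∃ xs : Fin n → M, Function.Injective xs ∧ Set.range xs = F := by
  have hfin : F.Finite := Set.finite_of_encard_eq_coe h
  have := hfin.to_subtype
  have hc : Nat.card F = n := by
    have h' := hfin.cast_ncard_eq.trans h
    rw [Nat.card_coe_set_eq]
    exact_mod_cast h'
  let e := (Finite.equivFinOfCardEq hc).symm
  refine ⟨fun i => e i, Subtype.val_injective.comp e.injective, ?_⟩
  ext x
  constructor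
  · rintro ⟨i, rfl⟩
    exact (e i).2
  · intro hx
    exact ⟨e.symm ⟨x, hx⟩, by simp⟩

theorem encard_range_fin {M : Type w} {n : ℕ} {xs : Fin n → M} (h : Function.Injective xs) :
    (Set.range xs).encard = n := by
  rw [← Set.image_univ, h.encard_image, Set.encard_univ]
  simp

theorem exists_fin_injective_iff {M : Type w} (F : Set M) (n : ℕ) :
    (∃ xs : Fin n → M, Function.Injective xs ∧ ∀ i, xs i ∈ F) ↔ (n : ℕ∞) ≤ F.encard := by
  constructor
  · rintro ⟨xs, hxs, hF⟩
    rw [← encard_range_fin hxs]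
    exact Set.encard_le_encard (Set.range_subset_iff.2 hF)
  · intro h
    obtain ⟨t, ht, hn⟩ := Set.exists_subset_encard_eq h
    obtain ⟨xs, hxs, rfl⟩ := exists_fin_range t n hn
    exact ⟨xs, hxs, fun i => ht ⟨i, rfl⟩⟩

theorem exists_fin_bijective_iff {M : Type w} (F : Set M) (n : ℕ) :
    (∃ xs : Fin n → M, (Function.Injective xs ∧ ∀ i, xs i ∈ F) ∧ ∀ y ∈ F, ∃ i, y = xs i) ↔
      F.encard = n := by
  constructor
  · rintro ⟨xs, ⟨hxs, hF⟩, hF'⟩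
    rw [← encard_range_fin hxs]
    congr 1
    refine subset_antisymm (fun y hy => ?_) (Set.range_subset_iff.2 hF)
    obtain ⟨i, rfl⟩ := hF' y hy
    exact ⟨i, rfl⟩
  · intro h
    obtain ⟨xs, hxs, rfl⟩ := exists_fin_range F n h
    refine ⟨xs, ⟨hxs, fun i => ⟨i, rfl⟩⟩, ?_⟩
    rintro _ ⟨i, rfl⟩
    exact ⟨i, rfl⟩

theorem exists_fin_surjective_iff {M : Type w} [Nonempty M] (n : ℕ) :
    (∃ xs : Fin n → M, ∀ y, ∃ i, y = xs i) ↔ ENat.card M ≤ n := by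
  constructor
  · rintro ⟨xs, hxs⟩
    have h : (Set.univ : Set M) = Set.range xs :=
      (Set.eq_univ_of_forall fun y => (hxs y).imp fun _ h => h.symm).symm
    rw [← Set.encard_univ, h, ← Set.image_univ]
    refine (Set.encard_image_le _ _).trans ?_
    rw [Set.encard_univ]
    simp
  · intro h
    obtain ⟨k, hk⟩ := ENat.ne_top_iff_exists.1 (ne_top_of_le_ne_top (ENat.natCast_ne_top n) h)
    rw [← hk, Nat.cast_le] at h
    obtain ⟨xs, -, hxs⟩ := exists_fin_range (Set.univ : Set M) k (by rw [Set.encard_univ, hk])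
    refine ⟨fun i => if hi : i.1 < k then xs ⟨i, hi⟩ else Classical.arbitrary M, fun y => ?_⟩
    obtain ⟨i, rfl⟩ : y ∈ Set.range xs := hxs ▸ Set.mem_univ y
    exact ⟨⟨i, i.2.trans_le h⟩, by simp⟩

theorem realize_distinct {L : FirstOrder.Language.{0, 0}} {M : Type w} [L.Structure M] {n : ℕ}
    (v : Empty → M) (xs : Fin n → M) :
    (distinct L n).Realize v xs ↔ Function.Injective xs := by
  rw [distinct, BoundedFormula.realize_iInf]
  simp only [BoundedFormula.realize_not, BoundedFormula.realize_bdEqual, Subtype.forall, Prod.forall]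
  constructor
  · intro h i j hij
    rcases lt_trichotomy i j with hlt | rfl | hlt
    · exact absurd hij (h i j hlt)
    · rfl
    · exact absurd hij.symm (h j i hlt)
  · exact fun h i j hij he => hij.ne (h he)

theorem realize_psiGe {L : FirstOrder.Language.{0, 0}} {M : Type w} [L.Structure M] (n : ℕ) :
    M ⊨ psiGe L n ↔ (n : ℕ∞) ≤ ENat.card M := by
  rw [psiGe, Sentence.Realize, BoundedFormula.realize_exs, ← Set.encard_univ,
    ← exists_fin_injective_iff]
  simp [realize_distinct]

theorem realize_psiLe {L : FirstOrder.Language.{0, 0}} {M : Type w} [L.Structure M] [Nonempty M]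
    (n : ℕ) : M ⊨ psiLe L n ↔ ENat.card M ≤ n := by
  rw [psiLe, Sentence.Realize, BoundedFormula.realize_exs,
    ← exists_fin_surjective_iff]
  simp [BoundedFormula.realize_iSup, Fin.snoc]

theorem realize_psiEq {L : FirstOrder.Language.{0, 0}} {M : Type w} [L.Structure M] [Nonempty M]
    (n : ℕ) : M ⊨ psiEq L n ↔ ENat.card M = n := by
  rw [psiEq, Sentence.realize_inf, realize_psiGe, realize_psiLe, and_comm, le_antisymm_iff]

/-- The interpretation of `s`. -/
def sMap {M : Type w} [sigS.Structure M] (x : M) : M :=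
  Structure.funMap (L := sigS) SymS.s ![x]

/-- The set of the elements satisfying `s(x) = x` if `b = 1`, and `s(x) ≠ x` if `b = 0`. -/
def fixSet (M : Type w) [sigS.Structure M] (b : Fin 2) : Set M := {x | b = 1 ↔ sMap x = x}

theorem mem_fixSet_one {M : Type w} [sigS.Structure M] {x : M} :
    x ∈ fixSet M 1 ↔ sMap x = x := by
  simp [fixSet]

theorem mem_fixSet_zero {M : Type w} [sigS.Structure M] {x : M} :
    x ∈ fixSet M 0 ↔ sMap x ≠ x := by
  simp [fixSet]

theorem realize_fixLit {M : Type w} [sigS.Structure M] (b : Fin 2) {n : ℕ} (i : Fin n)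
    (v : Empty → M) (xs : Fin n → M) : (fixLit b i).Realize v xs ↔ xs i ∈ fixSet M b := by
  have h : (fixS i).Realize v xs ↔ sMap (xs i) = xs i := by
    rw [fixS, BoundedFormula.realize_bdEqual, Term.realize_functions_apply₁]
    rfl
  rw [fixLit]
  split
  · rename_i hb
    subst hb
    rw [h, mem_fixSet_one]
  · rename_i hb
    rw [BoundedFormula.realize_not, h, show b = 0 by omega, mem_fixSet_zero]

theorem realize_psiFixGe {M : Type w} [sigS.Structure M] (b : Fin 2) (n : ℕ) :
    M ⊨ psiFixGe b n ↔ (n : ℕ∞) ≤ (fixSet M b).encard := by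
  rw [psiFixGe, Sentence.Realize, BoundedFormula.realize_exs,
    ← exists_fin_injective_iff]
  simp [realize_distinct, BoundedFormula.realize_iInf, realize_fixLit]

theorem realize_psiFixEq {M : Type w} [sigS.Structure M] (b : Fin 2) (n : ℕ) :
    M ⊨ psiFixEq b n ↔ (fixSet M b).encard = n := by
  rw [psiFixEq, Sentence.Realize, BoundedFormula.realize_exs,
    ← exists_fin_bijective_iff]
  simp [realize_distinct, BoundedFormula.realize_iInf, BoundedFormula.realize_iSup,
    realize_fixLit, Fin.snoc]

theorem model_TFun_iff {M : Type w} [sigS.Structure M] (f : ℕ+ → Fin 2) :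
    M ⊨ TFun f ↔ ∀ k : ℕ, 1 ≤ k →
      ((count f 1 k : ℕ∞) ≤ (fixSet M 1).encard ∧ (count f 0 k : ℕ∞) ≤ (fixSet M 0).encard) ∨
        ∃ i < k, (fixSet M 1).encard = count f 1 (i + 1) ∧
          (fixSet M 0).encard = count f 0 (i + 1) := by
  have key (k : ℕ) : M ⊨ ((psiFixGe 1 (count f 1 k) ⊓ psiFixGe 0 (count f 0 k)) ⊔
      BoundedFormula.iSup fun i : Fin k =>
        psiFixEq 1 (count f 1 (i + 1)) ⊓ psiFixEq 0 (count f 0 (i + 1)) : sigS.Sentence) ↔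
      ((count f 1 k : ℕ∞) ≤ (fixSet M 1).encard ∧ (count f 0 k : ℕ∞) ≤ (fixSet M 0).encard) ∨
        ∃ i < k, (fixSet M 1).encard = count f 1 (i + 1) ∧
          (fixSet M 0).encard = count f 0 (i + 1) := by
    rw [Sentence.Realize, Formula.realize_sup, Formula.realize_inf, Formula.Realize,
      Formula.Realize, ← realize_psiFixGe, ← realize_psiFixGe]
    refine or_congr Iff.rfl ?_
    rw [Formula.Realize, BoundedFormula.realize_iSup]
    simp only [← realize_psiFixEq, BoundedFormula.realize_inf]
    constructor
    · rintro ⟨i, h⟩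
      exact ⟨i, i.2, h⟩
    · rintro ⟨i, hi, h⟩
      exact ⟨⟨i, hi⟩, h⟩
  rw [Theory.model_iff]
  constructor
  · intro h k hk
    exact (key k).1 (h _ ⟨⟨k, hk⟩, rfl⟩)
  · rintro h _ ⟨k, rfl⟩
    exact (key k).2 (h k k.2)

/-- The truth value of `Pₙ`. -/
def predP (M : Type w) [sigP.Structure M] (n : ℕ+) : Prop :=
  Structure.RelMap (L := sigP) (M := M) (SymP.P n) Fin.elim0

theorem model_TEq_iff {M : Type w} [sigP.Structure M] [Nonempty M] :
    M ⊨ TEq ↔ ∀ n : ℕ+, predP M n → ENat.card M = (n : ℕ) := by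
  have key (n : ℕ+) : M ⊨ atomP n ↔ predP M n := by
    rw [atomP, Sentence.Realize, Formula.realize_rel, predP]
    exact Eq.to_iff (congrArg _ (Subsingleton.elim _ _))
  rw [Theory.model_iff]
  constructor
  · intro h n hn
    exact (realize_psiEq (n : ℕ)).1 ((Sentence.realize_imp M).1 (h _ ⟨n, rfl⟩) ((key n).2 hn))
  · rintro h _ ⟨n, rfl⟩
    exact (Sentence.realize_imp M).2 fun hn => (realize_psiEq (n : ℕ)).2 (h n ((key n).1 hn))

/-- The interpretation of `a`. -/
def aVal (M : Type w) [sigT.Structure M] : M :=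
  Structure.funMap (L := sigT) SymT.a Fin.elim0

/-- The interpretation of `t`. -/
def tMap {M : Type w} [sigT.Structure M] (x : M) : M :=
  Structure.funMap (L := sigT) SymT.t ![x]

theorem realize_iterA {M : Type w} [sigT.Structure M] (v : Empty ⊕ Fin 0 → M) (i : ℕ) :
    (iterA i).realize v = tMap^[i] (aVal M) := by
  induction i with
  | zero =>
    rw [iterA, Function.iterate_zero, id, Term.realize_constants, Function.iterate_zero, id, aVal]
    exact congrArg (Structure.funMap (L := sigT) SymT.a) (Subsingleton.elim _ _)
  | succ i ih =>
    rw [Function.iterate_succ_apply', ← ih, iterA, Function.iterate_succ_apply',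
      Term.realize_functions_apply₁]
    rfl

theorem realize_difA {M : Type w} [sigT.Structure M] (n : ℕ) :
    M ⊨ difA n ↔ Set.InjOn (fun i => tMap^[i] (aVal M)) (Set.Iio n) := by
  rw [difA, Sentence.Realize, Formula.Realize, BoundedFormula.realize_iInf]
  simp only [BoundedFormula.realize_not, BoundedFormula.realize_bdEqual, realize_iterA,
    Subtype.forall, Prod.forall]
  constructor
  · intro h i hi j hj hij
    rcases lt_trichotomy i j with hlt | rfl | hlt
    · exact absurd hij (h ⟨i, hi⟩ ⟨j, hj⟩ hlt)
    · rfl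
    · exact absurd hij.symm (h ⟨j, hj⟩ ⟨i, hi⟩ hlt)
  · exact fun h i j hij he => hij.ne (Fin.ext (h i.2 j.2 he))

theorem not_injOn_of_realize_orbA {M : Type w} [sigT.Structure M] {n : ℕ} (h : M ⊨ orbA n) :
    ¬ Set.InjOn (fun i => tMap^[i] (aVal M)) (Set.Iio (n + 1)) := by
  rw [orbA] at h
  split at h
  · rename_i hn
    subst hn
    rw [Sentence.Realize, Formula.Realize, BoundedFormula.realize_bdEqual, realize_iterA,
      realize_iterA] at h
    exact fun hi => one_ne_zero (hi (by simp) (by simp) h)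
  · rw [Sentence.realize_inf, Sentence.realize_not, realize_difA, realize_difA] at h
    exact h.2

theorem realize_orbA {M : Type w} [sigT.Structure M] {n : ℕ} (hn : 1 ≤ n)
    (h : Set.InjOn (fun i => tMap^[i] (aVal M)) (Set.Iio n))
    (h' : ¬ Set.InjOn (fun i => tMap^[i] (aVal M)) (Set.Iio (n + 1))) : M ⊨ orbA n := by
  rw [orbA]
  split
  · rename_i hn
    subst hn
    rw [Sentence.Realize, Formula.Realize, BoundedFormula.realize_bdEqual, realize_iterA,
      realize_iterA]
    by_contra hne
    refine h' fun i hi j hj hij => ?_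
    simp only [Set.mem_Iio] at hi hj
    interval_cases i <;> interval_cases j <;> first | rfl | exact absurd hij hne |
      exact absurd hij.symm hne
  · rw [Sentence.realize_inf, Sentence.realize_not, realize_difA, realize_difA]
    exact ⟨h, h'⟩

/-- A structure is a model of `T_orb²` if the orbit of `a` has at least half of its size. -/
theorem model_TOrb_iff {M : Type w} [sigT.Structure M] [Nonempty M] :
    M ⊨ TOrb ↔ ∀ m : ℕ, ((2 * m : ℕ) : ℕ∞) < ENat.card M →
      Set.InjOn (fun i => tMap^[i] (aVal M)) (Set.Iio (m + 1)) := by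
  classical
  rw [Theory.model_iff]
  constructor
  · intro h m hm
    by_contra hinj
    -- The least `n` at which the first `n + 1` iterates repeat is the size of the orbit. It is at
    -- most `m`, so its axiom bounds the domain by `2 * m`. It is not `0`, since a single iterate
    -- cannot repeat.
    have hex : ∃ n, ¬ Set.InjOn (fun i => tMap^[i] (aVal M)) (Set.Iio (n + 1)) := ⟨m, hinj⟩
    have hn := Nat.find_spec hex
    have hmin {k : ℕ} (hk : k < Nat.find hex) := not_not.1 (Nat.find_min hex hk)
    have hle := Nat.find_min' hex hinj
    generalize Nat.find hex = n at hn hmin hle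
    rcases n with _ | n
    · refine hn fun i hi j hj _ => ?_
      simp only [Set.mem_Iio] at hi hj
      omega
    have hcard := (realize_psiLe (2 * (n + 1))).1 ((Sentence.realize_imp M).1
      (h _ ⟨⟨n + 1, n.succ_pos⟩, rfl⟩) (realize_orbA n.succ_pos (hmin n.lt_succ_self) hn))
    refine absurd (hm.trans_le hcard) ?_
    rw [Nat.cast_lt]
    omega
  · rintro h _ ⟨n, rfl⟩
    refine (Sentence.realize_imp M).2 fun hn => (realize_psiLe (2 * (n : ℕ))).2 ?_
    by_contra hlt
    exact not_injOn_of_realize_orbA hn (h n (not_le.1 hlt))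

end Semantics

/-! ## Iterated conjunctions and their codes -/

section Conjunction

variable {L : FirstOrder.Language.{0, 0}}

/-- The conjunction of `φ` and `α 0, …, α (n - 1)`. -/
def conjUpTo (α : ℕ → L.Formula ℕ) (φ : L.Formula ℕ) : ℕ → L.Formula ℕ
  | 0 => φ
  | n + 1 => conjUpTo α φ n ⊓ α n

theorem realize_conjUpTo {M : Type w} [L.Structure M] (α : ℕ → L.Formula ℕ) (φ : L.Formula ℕ)
    (n : ℕ) (v : ℕ → M) :
    (conjUpTo α φ n).Realize v ↔ φ.Realize v ∧ ∀ i < n, (α i).Realize v := by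
  induction n with
  | zero => simp [conjUpTo]
  | succ n ih =>
    rw [conjUpTo, Formula.realize_inf, ih, and_assoc, Nat.forall_lt_succ_right]

theorem isQF_conjUpTo {α : ℕ → L.Formula ℕ} {φ : L.Formula ℕ} (hφ : φ.IsQF)
    (hα : ∀ i, (α i).IsQF) (n : ℕ) : (conjUpTo α φ n).IsQF := by
  induction n with
  | zero => exact hφ
  | succ n ih => exact ih.inf (hα n)

theorem mem_freeVarFinset_conjUpTo (α : ℕ → L.Formula ℕ) (φ : L.Formula ℕ) (n x : ℕ) :
    x ∈ (conjUpTo α φ n).freeVarFinset ↔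
      x ∈ φ.freeVarFinset ∨ ∃ i < n, x ∈ (α i).freeVarFinset := by
  induction n with
  | zero => simp [conjUpTo]
  | succ n ih =>
    -- A conjunction unfolds to `(φ → (ψ → ⊥)) → ⊥`; the empty sets come from the two `⊥`.
    have h : (conjUpTo α φ n ⊓ α n).freeVarFinset =
        (conjUpTo α φ n).freeVarFinset ∪ ((α n).freeVarFinset ∪ ∅) ∪ ∅ := rfl
    rw [conjUpTo, h, Finset.union_empty, Finset.union_empty, Finset.mem_union, ih, or_assoc,
      Nat.exists_lt_succ_right]

/-- The code of a conjunction. -/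
def conjCode (a b : ℕ) : ℕ :=
  Nat.pair 3 (Nat.pair (Nat.pair 3 (Nat.pair a (Nat.pair 3 (Nat.pair b 0)))) 0)

theorem formulaCode_inf [EffectiveSignature L] (φ ψ : L.Formula ℕ) :
    formulaCode (φ ⊓ ψ) = conjCode (formulaCode φ) (formulaCode ψ) := rfl

/-- The code of an iterated conjunction. -/
def conjUpToCode (a : ℕ → ℕ) (c : ℕ) : ℕ → ℕ
  | 0 => c
  | n + 1 => conjCode (conjUpToCode a c n) (a n)

theorem formulaCode_conjUpTo [EffectiveSignature L] (α : ℕ → L.Formula ℕ) (φ : L.Formula ℕ)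
    (n : ℕ) : formulaCode (conjUpTo α φ n) =
      conjUpToCode (fun i => formulaCode (α i)) (formulaCode φ) n := by
  induction n with
  | zero => rfl
  | succ n ih => rw [conjUpTo, formulaCode_inf, ih, conjUpToCode]

theorem natPair_primrec {γ : Type} [Primcodable γ] {f g : γ → ℕ} (hf : Primrec f)
    (hg : Primrec g) : Primrec fun x => Nat.pair (f x) (g x) := Primrec₂.natPair.comp hf hg

theorem conjUpToCode_primrec {γ : Type} [Primcodable γ] {a : γ → ℕ → ℕ} {c n : γ → ℕ}
    (ha : Primrec₂ a) (hc : Primrec c) (hn : Primrec n) :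
    Primrec fun x => conjUpToCode (a x) (c x) (n x) := by
  refine (Primrec.nat_rec' (h := fun x q => conjCode q.2 (a x q.1)) hn hc ?_).of_eq ?_
  · have h1 : Primrec fun p : γ × ℕ × ℕ => p.2.2 := Primrec.snd.comp Primrec.snd
    have h2 : Primrec fun p : γ × ℕ × ℕ => a p.1 p.2.1 :=
      ha.comp Primrec.fst (Primrec.fst.comp Primrec.snd)
    have h0 (k : ℕ) : Primrec fun _ : γ × ℕ × ℕ => k := Primrec.const k
    exact natPair_primrec (h0 3) (natPair_primrec (natPair_primrec (h0 3) (natPair_primrec h1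
      (natPair_primrec (h0 3) (natPair_primrec h2 (h0 0))))) (h0 0))
  · intro x
    induction n x with
    | zero => rfl
    | succ n ih => exact congrArg (fun r => conjCode r (a x n)) ih

/-- The equation between two variables. -/
def varEq (x y : ℕ) : L.Formula ℕ := Term.equal (Term.var x) (Term.var y)

theorem realize_varEq {M : Type w} [L.Structure M] (x y : ℕ) (v : ℕ → M) :
    (varEq x y : L.Formula ℕ).Realize v ↔ v x = v y := by
  rw [varEq, Formula.realize_equal]
  rfl

theorem isQF_varEq (x y : ℕ) : (varEq x y : L.Formula ℕ).IsQF :=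
  .of_isAtomic (.equal _ _)

theorem freeVarFinset_varEq (x : ℕ) : (varEq x x : L.Formula ℕ).freeVarFinset = {x} :=
  Finset.union_self _

/-- The code of the equation between two variables. -/
def varEqCode (x y : ℕ) : ℕ := Nat.pair 1 (Nat.pair (Nat.pair 0 x) (Nat.pair 0 y))

theorem varEqCode_primrec : Primrec₂ varEqCode :=
  natPair_primrec (Primrec.const 1) (natPair_primrec
    (natPair_primrec (Primrec.const 0) Primrec.fst) (natPair_primrec (Primrec.const 0) Primrec.snd))

/-- Every variable is bounded by the code of a formula containing it, and the identity is a partial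
embedding. Consequently the variables beyond `formulaCode φ` are fresh. -/
theorem realize_congr_of_le_code {M : Type w} [L.Structure M] [EffectiveSignature L]
    {φ : L.Formula ℕ} (hφ : φ.IsQF) {v v' : ℕ → M} (h : ∀ x ≤ formulaCode φ, v' x = v x) :
    φ.Realize v' ↔ φ.Realize v :=
  realize_iff_of_isPartialEmbedding_univ hφ id v v' h
    ⟨Function.injective_id.injOn, fun _ _ _ _ _ => rfl, fun _ _ _ _ _ => Iff.rfl⟩

theorem natPow_primrec : Primrec₂ ((· ^ ·) : ℕ → ℕ → ℕ) :=
  Primrec₂.unpaired'.1 Nat.Primrec.pow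

/-- A theory is finitely witnessable if every satisfiable quantifier-free formula has a model
whose size is a primitive recursive function of the code of the formula. -/
theorem isFinitelyWitnessable_of_card [EffectiveSignature L] (T : L.Theory) (N : ℕ → ℕ)
    (hN : Primrec N)
    (h : ∀ φ : QFFormula L, IsSat.{w} T φ.1 → ∃ (M : Theory.ModelType.{0, 0, w} T) (v : ℕ → M),
      φ.1.Realize v ∧ ENat.card M = N (formulaCode φ.1)) :
    IsFinitelyWitnessable.{w} T := by
  -- The equations `x = x` say nothing; they only make the fresh variables `c + 1, c + 2, …` occur
  -- in the witness.
  let α (c : ℕ) (i : ℕ) : L.Formula ℕ := varEq (c + 1 + i) (c + 1 + i)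
  have hvars (φ : QFFormula L) (x : ℕ) :
      x ∈ (conjUpTo (α (formulaCode φ.1)) φ.1 (N (formulaCode φ.1))).freeVarFinset ↔
        x ∈ φ.1.freeVarFinset ∨ ∃ i < N (formulaCode φ.1), x = formulaCode φ.1 + 1 + i := by
    rw [mem_freeVarFinset_conjUpTo]
    simp [α, freeVarFinset_varEq]
  have hreal (φ : QFFormula L) {M : Type w} [L.Structure M] (v : ℕ → M) :
      (conjUpTo (α (formulaCode φ.1)) φ.1 (N (formulaCode φ.1))).Realize v ↔ φ.1.Realize v := by
    rw [realize_conjUpTo]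
    simp [α, realize_varEq]
  refine ⟨fun φ => ⟨conjUpTo (α (formulaCode φ.1)) φ.1 (N (formulaCode φ.1)),
    isQF_conjUpTo φ.2 (fun i => isQF_varEq _ _) _⟩, ⟨fun c =>
      conjUpToCode (fun i => varEqCode (c + 1 + i) (c + 1 + i)) c (N c), ?_, fun φ => ?_⟩,
    fun φ => ⟨fun M v => ?_, ?_⟩⟩
  · have hadd : Primrec fun p : ℕ × ℕ => p.1 + 1 + p.2 :=
      Primrec.nat_add.comp (Primrec.succ.comp Primrec.fst) Primrec.snd
    have h2 : Primrec₂ fun c i : ℕ => varEqCode (c + 1 + i) (c + 1 + i) :=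
      varEqCode_primrec.comp hadd hadd
    exact (conjUpToCode_primrec h2 Primrec.id hN).to_comp
  · rw [formulaCode_conjUpTo]
    rfl
  · constructor
    · exact fun hφ => ⟨v, fun _ _ => rfl, (hreal φ v).2 hφ⟩
    · rintro ⟨v', hv', hφ⟩
      refine (realize_congr_of_le_code φ.2 fun x hx => hv' x fun hmem => ?_).1 ((hreal φ v').1 hφ)
      obtain ⟨h1, h2⟩ := Finset.mem_sdiff.1 hmem
      rcases (hvars φ x).1 h1 with h1 | ⟨i, -, hi⟩
      · exact h2 h1
      · omega
  · rintro ⟨M, v, hφ⟩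
    obtain ⟨M', v', hφ', hcard⟩ := h φ ⟨M, v, (hreal φ v).1 hφ⟩
    obtain ⟨xs, -, hxs⟩ := exists_fin_range (Set.univ : Set M') (N (formulaCode φ.1))
      (by rw [Set.encard_univ, hcard])
    -- The old values are kept up to the code, and the `N` fresh variables enumerate the domain. The
    -- inner case distinction is needed because the truncated difference is `0` when `x` is at most
    -- the code.
    let u (x : ℕ) : M' := if hx : x - (formulaCode φ.1 + 1) < N (formulaCode φ.1) then
      if x ≤ formulaCode φ.1 then v' x else xs ⟨_, hx⟩ else v' x
    refine ⟨M', u, (hreal φ u).2 ((realize_congr_of_le_code φ.2 fun x hx => ?_).1 hφ'), ?_⟩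
    · simp [u, hx]
    · refine Set.eq_univ_of_forall fun y => ?_
      obtain ⟨i, rfl⟩ : y ∈ Set.range xs := hxs ▸ Set.mem_univ y
      refine ⟨formulaCode φ.1 + 1 + i, (hvars φ _).2 (Or.inr ⟨i, i.2, rfl⟩), ?_⟩
      have h1 : ¬ formulaCode φ.1 + 1 + i.1 ≤ formulaCode φ.1 := by omega
      simp [u, h1]

end Conjunction

/-! ## The models of `T_f` -/

section Counting

variable (f : ℕ+ → Fin 2)

theorem count_add_count (k : ℕ) : count f 1 k + count f 0 k = k := by
  have h : ((Finset.range k).filter fun i => f i.succPNat = 0) =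
      (Finset.range k).filter fun i => ¬ f i.succPNat = 1 :=
    Finset.filter_congr fun i _ => by omega
  rw [count, count, h, Finset.card_filter_add_card_filter_not, Finset.card_range]

theorem count_mono (b : Fin 2) : Monotone (count f b) := fun _ _ h =>
  Finset.card_le_card (Finset.filter_subset_filter _ (Finset.range_mono h))

theorem count_succ (b : Fin 2) (k : ℕ) :
    count f b (k + 1) = count f b k + if f k.succPNat = b then 1 else 0 := by
  rw [count, Finset.range_add_one, Finset.filter_insert]
  split
  · rw [Finset.card_insert_of_notMem (by simp), count]
  · rw [count, add_zero]

variable {f}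

/-- At powers of two the counts do not depend on `f`. This is the only information about `f` that
enters finite witnessability and decidability. -/
theorem IsAdmissible.count_pow (hf : IsAdmissible f) (b : Fin 2) (k : ℕ) :
    count f b (2 ^ (k + 1)) = 2 ^ k := by
  have h := hf.2.2 (k + 1) k.succ_pos
  rw [pow_succ'] at h ⊢
  rcases (by omega : b = 1 ∨ b = 0) with rfl | rfl <;> omega

/-- Because `f 1 = 1`, there is always a fixed point to which the moved elements can be sent in
`exists_sStructure`. -/
theorem IsAdmissible.count_pos (hf : IsAdmissible f) {n : ℕ} (hn : 1 ≤ n) : 1 ≤ count f 1 n := by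
  refine le_trans (le_of_eq ?_) (count_mono f 1 hn)
  rw [count_succ]
  have h : f (Nat.succPNat 0) = 1 := hf.2.1
  simp [count, h]

end Counting

section Models

variable {f : ℕ+ → Fin 2} {M : Type w} [sigS.Structure M]

theorem encard_fixSet_add : (fixSet M 1).encard + (fixSet M 0).encard = ENat.card M := by
  have h : fixSet M 0 = (fixSet M 1)ᶜ := by
    ext x
    rw [Set.mem_compl_iff, mem_fixSet_one, mem_fixSet_zero]
  rw [h, Set.encard_add_encard_compl, Set.encard_univ]

theorem model_TFun_of_count {n : ℕ} (hn : 1 ≤ n)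
    (h : ∀ b, (fixSet M b).encard = count f b n) : M ⊨ TFun f := by
  refine (model_TFun_iff f).2 fun k hk => ?_
  rw [h 1, h 0]
  rcases le_or_gt k n with hkn | hkn
  · exact Or.inl ⟨Nat.cast_le.2 (count_mono f 1 hkn), Nat.cast_le.2 (count_mono f 0 hkn)⟩
  · refine Or.inr ⟨n - 1, by omega, ?_⟩
    rw [Nat.sub_add_cancel hn]
    exact ⟨rfl, rfl⟩

theorem model_TFun_of_top (h : ∀ b, (fixSet M b).encard = ⊤) : M ⊨ TFun f := by
  refine (model_TFun_iff f).2 fun k hk => Or.inl ?_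
  rw [h 1, h 0]
  exact ⟨le_top, le_top⟩

/-- The axiom for `k = n + 1` decides: its first disjunct would require `f₁(n + 1) + f₀(n + 1) = n +
1` elements, and in any other disjunct the two counts add up to the index, which must therefore be
`n`. This rigidity is what the combined theories exploit. -/
theorem encard_fixSet_of_card {n : ℕ} (hM : M ⊨ TFun f) (hn : ENat.card M = n) (b : Fin 2) :
    (fixSet M b).encard = count f b n := by
  have hadd := encard_fixSet_add (M := M)
  rw [hn] at hadd
  rcases (model_TFun_iff f).1 hM (n + 1) n.succ_pos with ⟨h1, h0⟩ | ⟨i, -, h1, h0⟩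
  · have h := add_le_add h1 h0
    rw [hadd, ← Nat.cast_add, count_add_count, Nat.cast_le] at h
    omega
  · rw [h1, h0, ← Nat.cast_add, count_add_count, Nat.cast_inj] at hadd
    subst hadd
    rcases (by omega : b = 1 ∨ b = 0) with rfl | rfl
    exacts [h1, h0]

end Models

/-! ## Extending structures by fixed and by moved elements -/

section Extension

/-- The structure in which `s` is interpreted by `g`. -/
@[reducible] def sStructure {M : Type w} (g : M → M) : sigS.Structure M where
  funMap := fun {_} F xs => match F, xs with
    | SymS.s, xs => g (xs 0)
  RelMap := fun {_} R _ => Empty.elim R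

theorem sMap_sStructure {M : Type w} (g : M → M) (x : M) :
    @sMap M (sStructure g) x = g x := rfl

/-- `U` is the old part, and `z` will be one of the two inclusions of new elements: `X` for the
fixed ones, `Y` for the moved ones. -/
theorem encard_extension {A X Y Z : Type w} {U : Set A} (F : Set (U ⊕ (X ⊕ Y))) (G : Set A) (z : Z → X ⊕ Y)
    (hz : Function.Injective z) (hF : ∀ u : U, Sum.inl u ∈ F ↔ u.1 ∈ G)
    (hF' : ∀ y, Sum.inr y ∈ F ↔ y ∈ Set.range z) :
    F.encard = (U ∩ G).encard + ENat.card Z := by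
  have h : F = Sum.inl '' {u : U | u.1 ∈ G} ∪ Sum.inr '' Set.range z := by
    ext (u | y)
    · simp [hF]
    · simp [hF']
  rw [h, Set.encard_union_eq, Sum.inl_injective.encard_image, Sum.inr_injective.encard_image,
    ← Set.image_univ, hz.encard_image, Set.encard_univ, ← Subtype.val_injective.encard_image]
  · congr 2
    ext x
    simp [and_comm]
  · rw [Set.disjoint_left]
    rintro _ ⟨u, -, rfl⟩ ⟨y, -, h⟩
    cases h

universe u v

theorem isPartialEmbedding_sigS {A : Type u} {B : Type v} [sigS.Structure A] [sigS.Structure B]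
    {U : Set A} {c : ℕ} {h : A → B} (hinj : Set.InjOn h U)
    (hs : ∀ x ∈ U, sMap x ∈ U → h (sMap x) = sMap (h x)) :
    IsPartialEmbedding (L := sigS) U c h where
  injOn := hinj
  map_fun := by
    rintro _ ⟨⟩ xs hxs hf
    obtain ⟨x, rfl⟩ : ∃ x, xs = ![x] := ⟨xs 0, by ext i; fin_cases i; rfl⟩
    refine (hs x (hxs 0) hf).trans ?_
    rw [sMap]
    congr 1
    ext i
    fin_cases i
    rfl
  map_rel _ R := R.elim

variable {A : Type w} [sigS.Structure A] (U : Set A) (X Y : Type w)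

open Classical in
/-- On the extension of `U` by `X` and `Y`, the elements of `X` are fixed, while the elements of
`Y`, and the elements of `U` whose image is not in `U`, are mapped to `d`. -/
noncomputable def extMap (d : U ⊕ (X ⊕ Y)) : U ⊕ (X ⊕ Y) → U ⊕ (X ⊕ Y)
  | Sum.inl u => if h : sMap u.1 ∈ U then Sum.inl ⟨sMap u.1, h⟩ else d
  | Sum.inr (Sum.inl x) => Sum.inr (Sum.inl x)
  | Sum.inr (Sum.inr _) => d

variable {U X Y}

/-- Old elements keep their kind: if `sMap u` lies outside `U`, then `u` was moved, and `hd` keeps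
it moved. New elements of `Y` are moved because the sink `d` is none of them. -/
theorem encard_fixSet_extension {d : U ⊕ (X ⊕ Y)}
    (hd : ∀ u : U, sMap u.1 ∉ U → d ≠ Sum.inl u) (hd' : ∀ y, d ≠ Sum.inr (Sum.inr y))
    (b : Fin 2) :
    (@fixSet _ (sStructure (extMap U X Y d)) b).encard =
      (U ∩ fixSet A b).encard + if b = 1 then ENat.card X else ENat.card Y := by
  let := sStructure (extMap U X Y d)
  have hu (u : U) : sMap (Sum.inl u : U ⊕ (X ⊕ Y)) = Sum.inl u ↔ sMap u.1 = u.1 := by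
    rw [sMap_sStructure, extMap]
    split
    · rw [Sum.inl.injEq, Subtype.ext_iff]
    · rename_i h
      exact ⟨fun h' => absurd h' (hd u h), fun h' => absurd (h'.symm ▸ u.2) h⟩
  have hx (x : X) : sMap (Sum.inr (Sum.inl x) : U ⊕ (X ⊕ Y)) = Sum.inr (Sum.inl x) := rfl
  have hy (y : Y) : sMap (Sum.inr (Sum.inr y) : U ⊕ (X ⊕ Y)) ≠ Sum.inr (Sum.inr y) := hd' y
  rcases (by omega : b = 1 ∨ b = 0) with rfl | rfl
  · rw [if_pos rfl]
    refine encard_extension _ _ Sum.inl Sum.inl_injective (fun u => ?_) fun y => ?_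
    · rw [mem_fixSet_one, mem_fixSet_one, hu]
    · rw [mem_fixSet_one]
      rcases y with x | y
      · simp [hx]
      · simp [hy]
  · rw [if_neg zero_ne_one]
    refine encard_extension _ _ Sum.inr Sum.inr_injective (fun u => ?_) fun y => ?_
    · rw [mem_fixSet_zero, mem_fixSet_zero, Ne, hu]
    · rw [mem_fixSet_zero]
      rcases y with x | y
      · simp [hx]
      · simp [hy]

theorem isPartialEmbedding_extension (d : U ⊕ (X ⊕ Y)) (c : ℕ) (h : A → U ⊕ (X ⊕ Y))
    (hh : ∀ u : U, h u = Sum.inl u) :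
    @IsPartialEmbedding sigS _ A _ _ (sStructure (extMap U X Y d)) U c h := by
  let := sStructure (extMap U X Y d)
  refine isPartialEmbedding_sigS (fun x hx y hy hxy => ?_) fun x hx hs => ?_
  · rw [hh ⟨x, hx⟩, hh ⟨y, hy⟩, Sum.inl.injEq, Subtype.mk.injEq] at hxy
    exact hxy
  · rw [hh ⟨_, hs⟩, hh ⟨x, hx⟩, sMap_sStructure, extMap, dif_pos hs]

end Extension

/-! ## Politeness of `T_f` -/

section Politeness

variable {f : ℕ+ → Fin 2}

/-- A quantifier-free formula with a model of whatever kind has models of `T_f` of a size that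
depends only on its code. -/
theorem IsAdmissible.exists_model_card (hf : IsAdmissible f) {A : Type w} [sigS.Structure A]
    (v : ℕ → A) (φ : QFFormula sigS) (h : φ.1.Realize v) :
    ∃ (M : Theory.ModelType.{0, 0, w} (TFun f)) (v' : ℕ → M),
      φ.1.Realize v' ∧ ENat.card M = (2 ^ (formulaCode φ.1 + 2) : ℕ) := by
  classical
  obtain ⟨U, hcard, hU⟩ := exists_finset_formula.{w, w} v φ.1 φ.2
  set c := formulaCode φ.1
  have hlt : U.card < 2 ^ (c + 1) := hcard.trans_lt (c + 1).lt_two_pow_self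
  let k (b : Fin 2) : ℕ := ((U : Set A) ∩ fixSet A b).ncard
  have hfin (b : Fin 2) : ((U : Set A) ∩ fixSet A b).Finite := U.finite_toSet.inter_of_left _
  have hk (b : Fin 2) : k b < 2 ^ (c + 1) := by
    refine lt_of_le_of_lt ?_ hlt
    rw [← Set.ncard_coe_finset]
    exact Set.ncard_le_ncard Set.inter_subset_left U.finite_toSet
  -- New elements fill each kind up to `2 ^ (c + 1)`, which exceeds the number of elements of `U`.
  let X (b : Fin 2) : Type w := ULift.{w} (Fin (2 ^ (c + 1) - k b))
  have hX (b : Fin 2) : ENat.card (X b) = (2 ^ (c + 1) - k b : ℕ) := by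
    simp [X, ENat.card_eq_coe_fintype_card]
  -- The sink is a new fixed element, so it differs from all elements of `U` and from all new moved
  -- ones; one exists because `k 1 < 2 ^ (c + 1)`.
  let d : (U : Set A) ⊕ (X 1 ⊕ X 0) := Sum.inr (Sum.inl ⟨⟨0, Nat.sub_pos_of_lt (hk 1)⟩⟩)
  let : sigS.Structure ((U : Set A) ⊕ (X 1 ⊕ X 0)) := sStructure (extMap (U : Set A) (X 1) (X 0) d)
  have hfix (b : Fin 2) : (fixSet ((U : Set A) ⊕ (X 1 ⊕ X 0)) b).encard = (2 ^ (c + 1) : ℕ) := by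
    rw [encard_fixSet_extension (d := d) (fun _ _ => by simp [d]) (fun _ => by simp [d]),
      ← (hfin b).cast_ncard_eq]
    have hb : (if b = 1 then ENat.card (X 1) else ENat.card (X 0)) = (2 ^ (c + 1) - k b : ℕ) := by
      rcases (by omega : b = 1 ∨ b = 0) with rfl | rfl
      · exact hX 1
      · exact hX 0
    rw [hb, ← Nat.cast_add, Nat.cast_inj]
    exact Nat.add_sub_cancel' (hk b).le
  -- Both kinds have the size that a balanced `f` prescribes for a domain of `2 ^ (c + 2)` elements.
  have hmodel : ((U : Set A) ⊕ (X 1 ⊕ X 0)) ⊨ TFun f :=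
    model_TFun_of_count (n := 2 ^ (c + 2)) Nat.one_le_two_pow fun b => by
      rw [hfix, hf.count_pow b (c + 1)]
  have : Nonempty ((U : Set A) ⊕ (X 1 ⊕ X 0)) := ⟨d⟩
  let h' (x : A) : (U : Set A) ⊕ (X 1 ⊕ X 0) := if hx : x ∈ (U : Set A) then Sum.inl ⟨x, hx⟩ else d
  have hh' (u : (U : Set A)) : h' u = Sum.inl u := dif_pos u.2
  refine ⟨Theory.ModelType.of (TFun f) ((U : Set A) ⊕ (X 1 ⊕ X 0)), h' ∘ v,
    (hU _ h' (h' ∘ v) (fun _ _ => rfl) (isPartialEmbedding_extension d c h' hh')).2 h, ?_⟩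
  refine (encard_fixSet_add (M := (U : Set A) ⊕ (X 1 ⊕ X 0))).symm.trans ?_
  rw [hfix, hfix, ← Nat.cast_add, ← mul_two, ← pow_succ]

theorem IsAdmissible.isFinitelyWitnessable (hf : IsAdmissible f) :
    IsFinitelyWitnessable.{w} (TFun f) := by
  refine isFinitelyWitnessable_of_card (TFun f) (fun c => 2 ^ (c + 2)) ?_ ?_
  · exact natPow_primrec.comp (Primrec.const 2) (Primrec.nat_add.comp Primrec.id (Primrec.const 2))
  · rintro φ ⟨M, v, h⟩
    exact hf.exists_model_card v φ h

/-- When the whole model is extended, no image leaves the old part, so any old element can serve as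
the sink for the new moved elements. -/
theorem exists_model_of_extension (φ : QFFormula sigS) (M : Theory.ModelType.{0, 0, w} (TFun f))
    (v : ℕ → M) (hv : φ.1.Realize v) (X : Fin 2 → Type w)
    (h : (∃ n : ℕ, 1 ≤ n ∧ ∀ b, (fixSet M b).encard + ENat.card (X b) = count f b n) ∨
      ∀ b, (fixSet M b).encard + ENat.card (X b) = ⊤) :
    ∃ (N : Theory.ModelType.{0, 0, w} (TFun f)) (v' : ℕ → N),
        φ.1.Realize v' ∧ Cardinal.mk N =
          Cardinal.mk M + (Cardinal.mk (X 1) + Cardinal.mk (X 0)) := by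
  let d : (Set.univ : Set M) ⊕ (X 1 ⊕ X 0) := Sum.inl ⟨v 0, trivial⟩
  let : sigS.Structure ((Set.univ : Set M) ⊕ (X 1 ⊕ X 0)) :=
    sStructure (extMap (Set.univ : Set M) (X 1) (X 0) d)
  have hfix (b : Fin 2) : (fixSet ((Set.univ : Set M) ⊕ (X 1 ⊕ X 0)) b).encard =
      (fixSet M b).encard + ENat.card (X b) := by
    rw [encard_fixSet_extension (d := d) (fun _ h => absurd trivial h) (fun _ => by simp [d]),
      Set.univ_inter]
    rcases (by omega : b = 1 ∨ b = 0) with rfl | rfl <;> rfl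
  have hmodel : ((Set.univ : Set M) ⊕ (X 1 ⊕ X 0)) ⊨ TFun f := by
    rcases h with ⟨n, hn, h⟩ | h
    · exact model_TFun_of_count hn fun b => (hfix b).trans (h b)
    · exact model_TFun_of_top fun b => (hfix b).trans (h b)
  have : Nonempty ((Set.univ : Set M) ⊕ (X 1 ⊕ X 0)) := ⟨d⟩
  let h' (x : M) : (Set.univ : Set M) ⊕ (X 1 ⊕ X 0) := Sum.inl ⟨x, trivial⟩
  refine ⟨Theory.ModelType.of (TFun f) ((Set.univ : Set M) ⊕ (X 1 ⊕ X 0)), h' ∘ v,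
    (realize_iff_of_isPartialEmbedding_univ φ.2 h' v (h' ∘ v) (fun _ _ => rfl)
      (isPartialEmbedding_extension d _ h' fun _ => rfl)).2 hv, ?_⟩
  change Cardinal.mk ((Set.univ : Set M) ⊕ (X 1 ⊕ X 0)) = _
  simp

variable (f) in
-- A finite model of size `n` has exactly `f_b(n)` elements of each kind, and monotonicity allows
-- adding the missing `f_b(k) - f_b(n)`. For infinite `κ`, adding `κ` elements of both kinds
-- satisfies every axiom through its first disjunct.
theorem isSmooth_TFun : IsSmooth.{w} (TFun f) := by
  intro φ M v hv κ hκ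
  have hM : M ⊨ TFun f := M.is_model
  rcases lt_or_ge κ Cardinal.aleph0 with hfin | hinf
  · obtain ⟨k, rfl⟩ := Cardinal.lt_aleph0.1 hfin
    obtain ⟨n, hn⟩ := Cardinal.lt_aleph0.1 (hκ.trans hfin)
    rw [hn, Nat.cast_lt] at hκ
    have hcard : ENat.card M = n := by
      rw [ENat.card, hn]
      simp
    have hle (b : Fin 2) := count_mono f b hκ.le
    obtain ⟨N, v', h, hN⟩ := exists_model_of_extension φ M v hv
      (fun b => ULift.{w} (Fin (count f b k - count f b n))) (Or.inl ⟨k, by omega, fun b => by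
        rw [encard_fixSet_of_card hM hcard, ENat.card_eq_coe_fintype_card, Fintype.card_ulift,
          Fintype.card_fin, ← Nat.cast_add, Nat.add_sub_cancel' (hle b)]⟩)
    refine ⟨N, v', h, hN.trans ?_⟩
    have h1 := count_add_count f n
    have h2 := count_add_count f k
    have h3 := hle 1
    have h4 := hle 0
    rw [hn, Cardinal.mk_uLift, Cardinal.mk_uLift, Cardinal.mk_fin, Cardinal.mk_fin,
      Cardinal.lift_natCast, Cardinal.lift_natCast, ← Nat.cast_add, ← Nat.cast_add, Nat.cast_inj]
    omega
  · have hX : ENat.card κ.out = ⊤ := by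
      rw [ENat.card, Cardinal.mk_out]
      exact Cardinal.toENat_eq_top.2 hinf
    obtain ⟨N, v', h, hN⟩ := exists_model_of_extension φ M v hv (fun _ => κ.out)
      (Or.inr fun b => by rw [hX, add_top])
    refine ⟨N, v', h, hN.trans ?_⟩
    rw [Cardinal.mk_out, Cardinal.add_eq_self hinf, Cardinal.add_eq_right hinf hκ.le]

theorem IsAdmissible.isPolite (hf : IsAdmissible f) : IsPolite.{w} (TFun f) :=
  ⟨isSmooth_TFun f, hf.isFinitelyWitnessable⟩

end Politeness

/-! ## Finite structures given by tables -/

section Tables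

/-- The entry number `i` of the table `(N, e)`, whose entries are less than `N`. -/
def digit (e : ℕ × ℕ) (i : ℕ) : ℕ := e.2 / 2 / e.1 ^ i % e.1

theorem digit_lt {e : ℕ × ℕ} (he : 1 ≤ e.1) (i : ℕ) : digit e i < e.1 := Nat.mod_lt _ he

theorem digit_primrec : Primrec₂ digit := by
  have hN : Primrec fun p : (ℕ × ℕ) × ℕ => p.1.1 := Primrec.fst.comp Primrec.fst
  have he : Primrec fun p : (ℕ × ℕ) × ℕ => p.1.2 := Primrec.snd.comp Primrec.fst
  exact Primrec.nat_mod.comp (Primrec.nat_div.comp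
    (Primrec.nat_div.comp he (Primrec.const 2)) (natPow_primrec.comp hN Primrec.snd)) hN

/-- The value of the variable `x` in the table `e`. -/
def varDigit (e : ℕ × ℕ) (x : ℕ) : ℕ := digit e (e.1 + 1 + x)

theorem varDigit_primrec : Primrec₂ varDigit :=
  digit_primrec.comp Primrec.fst (Primrec.nat_add.comp
    (Primrec.succ.comp (Primrec.fst.comp Primrec.fst)) Primrec.snd)

/-- A table is a number in base `N` shifted by one binary digit. That digit `b` is a free flag; for
`T_=` it says whether `P_N` is true. -/
theorem exists_digits {N : ℕ} (b : ℕ) (hb : b < 2) (g : ℕ → ℕ) (hg : ∀ i, g i < N) (K : ℕ) :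
    ∃ e < 2 * N ^ K, e % 2 = b ∧ ∀ i < K, digit (N, e) i = g i := by
  let a := finFunctionFinEquiv fun i : Fin K => (⟨g i, hg i⟩ : Fin N)
  refine ⟨2 * a.1 + b, by omega, by omega, fun i hi => ?_⟩
  have h := finFunctionFinEquiv_symm_apply_val a ⟨i, hi⟩
  rw [digit, show (2 * a.1 + b) / 2 = a.1 by omega, ← h, Equiv.symm_apply_apply]

/-- Entries below `N` tabulate a unary function, entry `N` is the constant, and the values of the
variables follow. With `N ≤ 2 * c + 4` the last entry needed has number `N + 1 + c ≤ 3 * c + 5`. -/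
theorem exists_table {N c : ℕ} (hN : N < 2 * c + 5) (b : ℕ) (hb : b < 2) (t : ℕ → ℕ)
    (ht : ∀ i, t i < N) (a : ℕ) (ha : a < N) (v : ℕ → ℕ) (hv : ∀ i, v i < N) :
    ∃ e < 2 * N ^ (3 * c + 10), e % 2 = b ∧ (∀ x < N, digit (N, e) x = t x) ∧
      digit (N, e) N = a ∧ ∀ x ≤ c, varDigit (N, e) x = v x := by
  obtain ⟨e, he, heb, h⟩ := exists_digits b hb
    (fun i => if i < N then t i else if i = N then a else v (i - (N + 1)))
    (fun i => by split_ifs; exacts [ht i, ha, hv _]) (3 * c + 10)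
  refine ⟨e, he, heb, fun x hx => ?_, ?_, fun x hx => ?_⟩
  · rw [h x (by omega), if_pos hx]
  · rw [h N (by omega), if_neg (lt_irrefl N), if_pos rfl]
  · rw [varDigit, h _ (by dsimp only; omega), if_neg (by dsimp only; omega),
      if_neg (by dsimp only; omega), Nat.add_sub_cancel_left]

/-- This renames the elements of `U` as numbers below `N`. The map is total and bounded everywhere,
so that whatever is read through it is a legitimate table entry. -/
theorem exists_injOn {A : Type w} {U : Set A} {N : ℕ} (hU : U.encard ≤ N) (hN : 1 ≤ N) :
    ∃ h : A → ℕ, (∀ x, h x < N) ∧ Set.InjOn h U := by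
  classical
  obtain ⟨k, hk⟩ := ENat.ne_top_iff_exists.1 (ne_top_of_le_ne_top (ENat.natCast_ne_top N) hU)
  rw [← hk, Nat.cast_le] at hU
  obtain ⟨xs, -, rfl⟩ := exists_fin_range U k hk.symm
  refine ⟨fun x => if hx : ∃ i, xs i = x then hx.choose.1 else 0, fun x => ?_, ?_⟩
  · dsimp only
    split_ifs with hx
    · exact hx.choose.2.trans_le hU
    · exact hN
  · intro x hx y hy hxy
    simp only [dif_pos (show ∃ i, xs i = x from hx), dif_pos (show ∃ i, xs i = y from hy)] at hxy
    have h1 := Exists.choose_spec (show ∃ i, xs i = x from hx)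
    have h2 := Exists.choose_spec (show ∃ i, xs i = y from hy)
    rw [← h1, ← h2, Fin.ext hxy]

/-- A theory is decidable if satisfiability amounts to truth in one of the structures given by
tables of bounded size. -/
theorem isDecidable_of_tables {L : FirstOrder.Language.{0, 0}} [EffectiveSignature L]
    (ev : Evaluator L (ℕ × ℕ)) (T : L.Theory) (V : ℕ × ℕ → Prop) (hV : PrimrecPred V)
    (sound : ∀ (φ : QFFormula L) (e : ℕ × ℕ), V e →
      @Formula.Realize L ℕ (ev.str e) _ φ.1 (ev.val e) → IsSat.{w} T φ.1)
    (complete : ∀ φ : QFFormula L, IsSat.{w} T φ.1 → ∃ N < 2 * formulaCode φ.1 + 5,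
      ∃ e < 2 * N ^ (3 * formulaCode φ.1 + 10), V (N, e) ∧
        @Formula.Realize L ℕ (ev.str (N, e)) _ φ.1 (ev.val (N, e))) :
    IsDecidable.{w} T := by
  classical
  have hmul {γ : Type} [Primcodable γ] {f : γ → ℕ} (k m : ℕ) (hf : Primrec f) :
      Primrec fun x => k * f x + m :=
    Primrec.nat_add.comp (Primrec.nat_mul.comp (Primrec.const k) hf) (Primrec.const m)
  refine ev.isDecidable T (fun c => (((List.range (2 * c + 5)).flatMap fun N =>
    (List.range (2 * N ^ (3 * c + 10))).map fun e => (N, e)).filter fun e => V e)) ?_ ?_ ?_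
  · refine (Primrec.listFilter hV).comp (Primrec.list_flatMap
      (Primrec.list_range.comp (hmul 2 5 Primrec.id)) (Primrec.list_map (Primrec.list_range.comp
        (Primrec.nat_mul.comp (Primrec.const 2) (natPow_primrec.comp Primrec.snd
          (hmul 3 10 Primrec.fst)))) ?_))
    exact Primrec.pair (Primrec.snd.comp Primrec.fst) Primrec.snd
  · intro φ e he h
    refine sound φ e ?_ h
    simpa using (List.mem_filter.1 he).2
  · intro φ h
    obtain ⟨N, hN, e, he, hVe, h⟩ := complete φ h
    refine ⟨(N, e), List.mem_filter.2 ⟨List.mem_flatMap.2 ⟨N, List.mem_range.2 hN,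
      List.mem_map.2 ⟨e, List.mem_range.2 he, rfl⟩⟩, by simpa using hVe⟩, h⟩

end Tables

/-! ## Decidability of `T_f` -/

section DecidableTFun

theorem eq_ofFn_one {l : List (Option ℕ)} {x : ℕ} (h : l.length = 1) (hx : l.getD 0 none = some x) :
    l = List.ofFn fun i => some ((![x] : Fin 1 → ℕ) i) := by
  obtain ⟨y, rfl⟩ := List.length_eq_one_iff.1 h
  simpa using hx

/-- The evaluator for the signature of `s`. -/
def evaluatorS : Evaluator sigS (ℕ × ℕ) where
  str e := sStructure (digit e)
  val := varDigit
  funVal e p := if p.1 = 1 ∧ p.2.1 = 0 ∧ p.2.2.length = 1 then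
    (p.2.2.getD 0 none).map fun x => digit e x else none
  relVal _ _ := none
  val_primrec := varDigit_primrec
  funVal_primrec := by
    have h2 : Primrec fun p : (ℕ × ℕ) × ℕ × ℕ × List (Option ℕ) => p.2.2 :=
      Primrec.snd.comp Primrec.snd
    have hl := Primrec.snd.comp h2
    refine Primrec.ite ((Primrec.eq.comp (Primrec.fst.comp Primrec.snd) (Primrec.const 1)).and
      ((Primrec.eq.comp (Primrec.fst.comp h2) (Primrec.const 0)).and
        (Primrec.eq.comp (Primrec.list_length.comp hl) (Primrec.const 1)))) ?_ (Primrec.const none)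
    exact Primrec.option_map ((Primrec.list_getD none).comp hl (Primrec.const 0))
      (digit_primrec.comp (Primrec.fst.comp Primrec.fst) Primrec.snd)
  relVal_primrec := Primrec.const none
  funVal_code := by
    rintro e _ ⟨⟩ xs
    simp [EffectiveSignature.funCode]
    rfl
  exists_of_funVal := by
    intro e n k l r h
    split at h
    · rename_i hc
      obtain ⟨rfl : n = 1, rfl : k = 0, hl : l.length = 1⟩ := hc
      obtain ⟨x, hx, -⟩ := Option.map_eq_some_iff.1 h
      exact ⟨SymS.s, ![x], rfl, eq_ofFn_one hl hx⟩
    · cases h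
  relVal_code _ _ R := R.elim
  exists_of_relVal _ _ _ _ _ h := by cases h

/-- By `exists_model_card`, truth in any structure whatsoever gives a model of `T_f`, so every table
is admitted and `f` plays no role in the search. Conversely, the subterm values of a model fit into
a table of size `formulaCode φ + 1`. -/
theorem IsAdmissible.isDecidable_TFun {f : ℕ+ → Fin 2} (hf : IsAdmissible f) :
    IsDecidable.{w} (TFun f) := by
  refine isDecidable_of_tables evaluatorS (TFun f) (fun _ => True) ⟨fun _ => .isTrue trivial, Primrec.const true⟩ ?_ ?_
  · intro φ e _ h
    let : sigS.Structure ℕ := evaluatorS.str e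
    -- The structure on `ℕ` is copied to the universe of the domains before a model of `T_f` is
    -- built from it.
    let : sigS.Structure (ULift.{w} ℕ) := sStructure fun x => ULift.up (digit e x.down)
    have h' : φ.1.Realize (fun x => ULift.up.{w} (evaluatorS.val e x)) :=
      (realize_iff_of_isPartialEmbedding_univ φ.2 ULift.down
        (fun x => ULift.up.{w} (evaluatorS.val e x)) (evaluatorS.val e) (fun _ _ => rfl)
        (isPartialEmbedding_sigS ULift.down_injective.injOn fun _ _ _ => rfl)).1 h
    obtain ⟨M, v', hv', -⟩ := hf.exists_model_card _ φ h'
    exact ⟨M, v', hv'⟩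
  · rintro φ ⟨M, v, hv⟩
    obtain ⟨U, hcard, hU⟩ := exists_finset_formula.{w, 0} v φ.1 φ.2
    obtain ⟨h, hlt, hinj⟩ := exists_injOn (U := (U : Set M)) (N := formulaCode φ.1 + 1)
      (by rw [Set.encard_coe_eq_coe_finsetCard, Nat.cast_le]; exact hcard) (Nat.succ_pos _)
    have : Nonempty M := ⟨v 0⟩
    -- The table transports `s` along `h`; where the image leaves `U` its entry is irrelevant.
    obtain ⟨e, he, -, hes, -, hev⟩ := exists_table (N := formulaCode φ.1 + 1)
      (c := formulaCode φ.1) (by omega) 0 two_pos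
      (fun y => h (sMap (Function.invFunOn h (U : Set M) y))) (fun _ => hlt _) 0 (by omega)
      (h ∘ v) (fun _ => hlt _)
    let : sigS.Structure ℕ := evaluatorS.str (formulaCode φ.1 + 1, e)
    refine ⟨formulaCode φ.1 + 1, by omega, e, he, trivial, (hU ℕ h _ (fun x hx => hev x hx)
      (isPartialEmbedding_sigS hinj fun x hx _ => ?_)).2 hv⟩
    refine Eq.trans ?_ (hes (h x) (hlt x)).symm
    rw [hinj.leftInvOn_invFunOn hx]

end DecidableTFun

/-! ## Decidability of `T_=` -/

section DecidableTEq

universe u v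

/-- The structure in which `Pₙ` is interpreted by `p n`. -/
@[reducible] def pStructure {M : Type w} (p : ℕ+ → Prop) : sigP.Structure M where
  funMap := fun {_} F _ => Empty.elim F
  RelMap := fun {_} R _ => match R with
    | SymP.P n => p n

theorem predP_pStructure {M : Type w} (p : ℕ+ → Prop) (n : ℕ+) :
    @predP M (pStructure p) n ↔ p n := Iff.rfl

theorem isPartialEmbedding_sigP {A : Type u} {B : Type v} [sigP.Structure A] [sigP.Structure B]
    {U : Set A} {c : ℕ} {h : A → B} (hinj : Set.InjOn h U)
    (hp : ∀ n : ℕ+, (n : ℕ) ≤ c → (predP B n ↔ predP A n)) :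
    IsPartialEmbedding (L := sigP) U c h where
  injOn := hinj
  map_fun _ F := F.elim
  map_rel := by
    rintro _ ⟨n⟩ xs - hn
    rw [Subsingleton.elim (h ∘ xs) Fin.elim0, Subsingleton.elim xs Fin.elim0]
    exact hp n hn

/-- The evaluator for the signature of the predicates `Pₙ`. -/
def evaluatorP : Evaluator sigP (ℕ × ℕ) where
  str e := pStructure fun n => (n : ℕ) = e.1 ∧ e.2 % 2 = 1
  val := varDigit
  funVal _ _ := none
  relVal e p := if p.1 = 0 ∧ 0 < p.2.1 ∧ p.2.2.length = 0 then
    some (decide (p.2.1 = e.1 ∧ e.2 % 2 = 1)) else none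
  val_primrec := varDigit_primrec
  funVal_primrec := Primrec.const none
  relVal_primrec := by
    have h2 : Primrec fun p : (ℕ × ℕ) × ℕ × ℕ × List (Option ℕ) => p.2.2 :=
      Primrec.snd.comp Primrec.snd
    have hl := Primrec.snd.comp h2
    refine Primrec.ite ((Primrec.eq.comp (Primrec.fst.comp Primrec.snd) (Primrec.const 0)).and
      ((Primrec.nat_lt.comp (Primrec.const 0) (Primrec.fst.comp h2)).and
        (Primrec.eq.comp (Primrec.list_length.comp hl) (Primrec.const 0)))) ?_ (Primrec.const none)
    refine Primrec.option_some.comp (PrimrecPred.decide ((Primrec.eq.comp (Primrec.fst.comp h2)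
      (Primrec.fst.comp Primrec.fst)).and (Primrec.eq.comp (Primrec.nat_mod.comp
        (Primrec.snd.comp Primrec.fst) (Primrec.const 2)) (Primrec.const 1))))
  funVal_code _ _ F := F.elim
  exists_of_funVal _ _ _ _ _ h := by cases h
  relVal_code := by
    rintro e _ ⟨n⟩ xs
    refine ⟨decide ((n : ℕ) = e.1 ∧ e.2 % 2 = 1), ?_, decide_eq_true_iff⟩
    simp only [EffectiveSignature.relCode, SymP.code, n.pos, List.length_ofFn, and_true, if_true]
    congr
  exists_of_relVal := by
    intro e n k l r h
    split at h
    · rename_i hc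
      obtain ⟨rfl : n = 0, hk : 0 < k, hl : l.length = 0⟩ := hc
      refine ⟨SymP.P ⟨k, hk⟩, Fin.elim0, rfl, ?_⟩
      rw [List.length_eq_zero_iff.1 hl, List.ofFn_zero]
    · cases h

theorem card_uLift_fin (N : ℕ) : ENat.card (ULift.{w} (Fin N)) = N := by
  simp [ENat.card_eq_coe_fintype_card]

theorem uLift_fin_val_injective (N : ℕ) :
    Function.Injective fun x : ULift.{w} (Fin N) => x.down.1 :=
  Fin.val_injective.comp ULift.down_injective

/-- Only the predicates `Pₙ` with `n ≤ formulaCode φ` matter. If one of them holds, the model is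
finite of that size and is copied entirely, with flag `1`. Otherwise a copy of the subterm values
with flag `0`, where all predicates are false, suffices. -/
theorem isDecidable_TEq : IsDecidable.{w} TEq := by
  refine isDecidable_of_tables evaluatorP TEq (fun e => 1 ≤ e.1)
    (Primrec.nat_le.comp (Primrec.const 1) Primrec.fst) ?_ ?_
  · intro φ e he h
    let : sigP.Structure ℕ := evaluatorP.str e
    let : sigP.Structure (ULift.{w} (Fin e.1)) := pStructure fun n => (n : ℕ) = e.1 ∧ e.2 % 2 = 1
    have : Nonempty (ULift.{w} (Fin e.1)) := ⟨⟨⟨0, he⟩⟩⟩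
    have hM : ULift.{w} (Fin e.1) ⊨ TEq := by
      refine model_TEq_iff.2 fun n hn => ?_
      rw [card_uLift_fin, ((predP_pStructure _ n).1 hn).1]
    refine ⟨Theory.ModelType.of TEq (ULift.{w} (Fin e.1)),
      fun x => ⟨⟨varDigit e x, digit_lt he _⟩⟩, ?_⟩
    exact (realize_iff_of_isPartialEmbedding_univ φ.2 (fun x : ULift.{w} (Fin e.1) => x.down.1)
      (fun x => ⟨⟨varDigit e x, digit_lt he _⟩⟩) (evaluatorP.val e) (fun _ _ => rfl)
        (isPartialEmbedding_sigP (uLift_fin_val_injective e.1).injOn fun _ _ => Iff.rfl)).1 h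
  · rintro φ ⟨M, v, hv⟩
    have hM : ∀ n : ℕ+, predP M n → ENat.card M = (n : ℕ) := model_TEq_iff.1 M.is_model
    by_cases hk : ∃ k : ℕ+, predP M k ∧ (k : ℕ) ≤ formulaCode φ.1
    · obtain ⟨k, hk, hkc⟩ := hk
      have hcard := hM k hk
      obtain ⟨h, hlt, hinj⟩ := exists_injOn (U := (Set.univ : Set M)) (N := k)
        (by rw [Set.encard_univ, hcard]) k.pos
      obtain ⟨e, he, heb, -, -, hev⟩ := exists_table (N := k) (c := formulaCode φ.1) (by omega)
        1 one_lt_two (fun _ => 0) (fun _ => k.pos) 0 k.pos (h ∘ v) (fun _ => hlt _)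
      let : sigP.Structure ℕ := evaluatorP.str (k, e)
      refine ⟨k, by omega, e, he, k.pos, (realize_iff_of_isPartialEmbedding_univ φ.2 h v _
        (fun x hx => hev x hx) (isPartialEmbedding_sigP hinj fun n _ => ?_)).2 hv⟩
      constructor
      · rintro ⟨hn : (n : ℕ) = k, -⟩
        rwa [PNat.coe_injective hn]
      · intro hn
        exact ⟨Nat.cast_injective (R := ℕ∞) ((hM n hn).symm.trans hcard), heb⟩
    · obtain ⟨U, hcard, hU⟩ := exists_finset_formula.{w, 0} v φ.1 φ.2
      obtain ⟨h, hlt, hinj⟩ := exists_injOn (U := (U : Set M)) (N := formulaCode φ.1 + 1)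
        (by rw [Set.encard_coe_eq_coe_finsetCard, Nat.cast_le]; exact hcard) (Nat.succ_pos _)
      obtain ⟨e, he, heb, -, -, hev⟩ := exists_table (N := formulaCode φ.1 + 1)
        (c := formulaCode φ.1) (by omega) 0 two_pos (fun _ => 0) (fun _ => Nat.succ_pos _) 0
        (Nat.succ_pos _) (h ∘ v) (fun _ => hlt _)
      let : sigP.Structure ℕ := evaluatorP.str (formulaCode φ.1 + 1, e)
      refine ⟨formulaCode φ.1 + 1, by omega, e, he, Nat.succ_pos _, (hU ℕ h _
        (fun x hx => hev x hx) (isPartialEmbedding_sigP hinj fun n hn => ?_)).2 hv⟩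
      constructor
      · rintro ⟨-, he1 : e % 2 = 1⟩
        omega
      · intro hn'
        exact absurd ⟨n, hn', hn⟩ hk

end DecidableTEq

/-! ## Decidability of `T_orb²` -/

section DecidableTOrb

universe u v

/-- The structure in which `a` is interpreted by `a₀` and `t` by `g`. -/
@[reducible] def tStructure {M : Type w} (a₀ : M) (g : M → M) : sigT.Structure M where
  funMap := fun {_} F xs => match F, xs with
    | SymT.a, _ => a₀
    | SymT.t, xs => g (xs 0)
  RelMap := fun {_} R _ => Empty.elim R

theorem tMap_tStructure {M : Type w} (a₀ : M) (g : M → M) (x : M) :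
    @tMap M (tStructure a₀ g) x = g x := rfl

theorem isPartialEmbedding_sigT {A : Type u} {B : Type v} [sigT.Structure A] [sigT.Structure B]
    {U : Set A} {c : ℕ} {h : A → B} (hinj : Set.InjOn h U) (ha : h (aVal A) = aVal B)
    (ht : ∀ x ∈ U, tMap x ∈ U → h (tMap x) = tMap (h x)) :
    IsPartialEmbedding (L := sigT) U c h where
  injOn := hinj
  map_fun := by
    rintro _ ⟨⟩ xs hxs hf
    · rw [Subsingleton.elim (h ∘ xs) Fin.elim0, Subsingleton.elim xs Fin.elim0]
      exact ha
    · obtain ⟨x, rfl⟩ : ∃ x, xs = ![x] := ⟨xs 0, by ext i; fin_cases i; rfl⟩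
      refine (ht x (hxs 0) hf).trans ?_
      rw [tMap]
      congr 1
      ext i
      fin_cases i
      rfl
  map_rel _ R := R.elim

/-- The evaluator for the signature of `a` and `t`. -/
def evaluatorT : Evaluator sigT (ℕ × ℕ) where
  str e := tStructure (digit e e.1) (digit e)
  val := varDigit
  funVal e p := if p.1 = 1 ∧ p.2.1 = 0 ∧ p.2.2.length = 1 then
      (p.2.2.getD 0 none).map fun x => digit e x
    else if p.1 = 0 ∧ p.2.1 = 0 ∧ p.2.2.length = 0 then some (digit e e.1) else none
  relVal _ _ := none
  val_primrec := varDigit_primrec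
  funVal_primrec := by
    have h2 : Primrec fun p : (ℕ × ℕ) × ℕ × ℕ × List (Option ℕ) => p.2.2 :=
      Primrec.snd.comp Primrec.snd
    have hl := Primrec.snd.comp h2
    have hc (i : ℕ) : PrimrecPred fun p : (ℕ × ℕ) × ℕ × ℕ × List (Option ℕ) =>
        p.2.1 = i ∧ p.2.2.1 = 0 ∧ p.2.2.2.length = i :=
      (Primrec.eq.comp (Primrec.fst.comp Primrec.snd) (Primrec.const i)).and
        ((Primrec.eq.comp (Primrec.fst.comp h2) (Primrec.const 0)).and
          (Primrec.eq.comp (Primrec.list_length.comp hl) (Primrec.const i)))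
    refine Primrec.ite (hc 1) ?_ (Primrec.ite (hc 0) (Primrec.option_some.comp
      (digit_primrec.comp Primrec.fst (Primrec.fst.comp Primrec.fst))) (Primrec.const none))
    exact Primrec.option_map ((Primrec.list_getD none).comp hl (Primrec.const 0))
      (digit_primrec.comp (Primrec.fst.comp Primrec.fst) Primrec.snd)
  relVal_primrec := Primrec.const none
  funVal_code := by
    rintro e _ ⟨⟩ xs <;> simp [EffectiveSignature.funCode] <;> rfl
  exists_of_funVal := by
    intro e n k l r h
    split at h
    · rename_i hc
      obtain ⟨rfl : n = 1, rfl : k = 0, hl : l.length = 1⟩ := hc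
      obtain ⟨x, hx, -⟩ := Option.map_eq_some_iff.1 h
      exact ⟨SymT.t, ![x], rfl, eq_ofFn_one hl hx⟩
    · split at h
      · rename_i hc
        obtain ⟨rfl : n = 0, rfl : k = 0, hl : l.length = 0⟩ := hc
        refine ⟨SymT.a, Fin.elim0, rfl, ?_⟩
        rw [List.length_eq_zero_iff.1 hl, List.ofFn_zero]
      · cases h
  relVal_code _ _ R := R.elim
  exists_of_relVal _ _ _ _ _ h := by cases h

theorem primrecRel_forall_lt {γ : Type} [Primcodable γ] {R : ℕ → γ → Prop} (hR : PrimrecRel R) :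
    PrimrecRel fun (n : ℕ) (y : γ) => ∀ i < n, R i y :=
  (hR.forall_mem_list.comp (Primrec.list_range.comp Primrec.fst) Primrec.snd).of_eq (by simp)

/-- In the structure given by the table `e`, the orbit of `a` has at least half of the size. -/
def HasLargeOrbit (e : ℕ × ℕ) : Prop :=
  1 ≤ e.1 ∧ ∀ j < e.1, 2 * j < e.1 → ∀ i < j, (digit e)^[i] (digit e e.1) ≠ (digit e)^[j] (digit e e.1)

/-- All quantifiers are bounded. The bound `j < e.1` follows from `2 * j < e.1` and is there to give
the quantifier this form. -/
theorem hasLargeOrbit_primrec : PrimrecPred HasLargeOrbit := by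
  have hit : Primrec₂ fun (e : ℕ × ℕ) (i : ℕ) => (digit e)^[i] (digit e e.1) :=
    Primrec.nat_iterate Primrec.snd (digit_primrec.comp Primrec.fst
      (Primrec.fst.comp Primrec.fst)) (digit_primrec.comp (Primrec.fst.comp Primrec.fst) Primrec.snd)
  have h1 : PrimrecRel fun (i : ℕ) (p : (ℕ × ℕ) × ℕ) =>
      (digit p.1)^[i] (digit p.1 p.1.1) ≠ (digit p.1)^[p.2] (digit p.1 p.1.1) :=
    (Primrec.eq.comp (hit.comp (Primrec.fst.comp Primrec.snd) Primrec.fst)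
      (hit.comp (Primrec.fst.comp Primrec.snd) (Primrec.snd.comp Primrec.snd))).not
  have h2 : PrimrecRel fun (j : ℕ) (e : ℕ × ℕ) => 2 * j < e.1 →
      ∀ i < j, (digit e)^[i] (digit e e.1) ≠ (digit e)^[j] (digit e e.1) := by
    have h1' := primrecRel_forall_lt h1
    have h3 : PrimrecRel fun (j : ℕ) (e : ℕ × ℕ) =>
        ∀ i < j, (digit e)^[i] (digit e e.1) ≠ (digit e)^[j] (digit e e.1) :=
      h1'.comp Primrec.fst (Primrec.pair Primrec.snd Primrec.fst)
    have h4 : PrimrecRel fun (j : ℕ) (e : ℕ × ℕ) => 2 * j < e.1 :=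
      Primrec.nat_lt.comp (Primrec.nat_mul.comp (Primrec.const 2) Primrec.fst)
        (Primrec.fst.comp Primrec.snd)
    exact (h4.not.or h3).of_eq fun _ => imp_iff_not_or.symm
  have h2' := primrecRel_forall_lt h2
  exact (Primrec.nat_le.comp (Primrec.const 1) Primrec.fst).and
    (h2'.comp Primrec.fst Primrec.id)

theorem injOn_Iio_of_lt {A : Type w} {g : ℕ → A} {m : ℕ}
    (h : ∀ j < m, ∀ i < j, g i ≠ g j) : Set.InjOn g (Set.Iio m) := by
  intro i hi j hj hij
  rcases lt_trichotomy i j with hlt | rfl | hlt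
  · exact absurd hij (h j hj i hlt)
  · rfl
  · exact absurd hij.symm (h i hi j hlt)

/-- A formula is satisfiable if it holds in the structure given by a table with a large orbit. -/
theorem isSat_TOrb_of_table (φ : QFFormula sigT) {e : ℕ × ℕ} (he : HasLargeOrbit e)
    (h : @Formula.Realize sigT ℕ (evaluatorT.str e) _ φ.1 (evaluatorT.val e)) :
    IsSat.{w} TOrb φ.1 := by
  obtain ⟨hN, horb⟩ := he
  let : sigT.Structure ℕ := evaluatorT.str e
  let : sigT.Structure (ULift.{w} (Fin e.1)) := tStructure ⟨⟨digit e e.1, digit_lt hN _⟩⟩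
    fun x => ⟨⟨digit e x.down.1, digit_lt hN _⟩⟩
  have : Nonempty (ULift.{w} (Fin e.1)) := ⟨⟨⟨0, hN⟩⟩⟩
  have hiter (i : ℕ) : (tMap^[i] (aVal (ULift.{w} (Fin e.1)))).down.1 =
      (digit e)^[i] (digit e e.1) := by
    induction i with
    | zero => rfl
    | succ i ih =>
      rw [Function.iterate_succ_apply', Function.iterate_succ_apply', ← ih]
      rfl
  have hM : ULift.{w} (Fin e.1) ⊨ TOrb := by
    refine model_TOrb_iff.2 fun m hm => injOn_Iio_of_lt fun j hj i hij heq => ?_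
    rw [card_uLift_fin, Nat.cast_lt] at hm
    refine horb j (by omega) (by omega) i hij ?_
    rw [← hiter, ← hiter, heq]
  refine ⟨Theory.ModelType.of TOrb (ULift.{w} (Fin e.1)),
    fun x => ⟨⟨varDigit e x, digit_lt hN _⟩⟩, ?_⟩
  exact (realize_iff_of_isPartialEmbedding_univ φ.2 (fun x : ULift.{w} (Fin e.1) => x.down.1)
    (fun x => ⟨⟨varDigit e x, digit_lt hN _⟩⟩) (evaluatorT.val e) (fun _ _ => rfl)
      (isPartialEmbedding_sigT (uLift_fin_val_injective e.1).injOn rfl fun _ _ _ => rfl)).1 h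

/-- A finite model can be given by a table. -/
theorem exists_table_of_card {M : Type w} [sigT.Structure M] [Nonempty M] (hM : M ⊨ TOrb)
    (φ : QFFormula sigT) (v : ℕ → M) (hv : φ.1.Realize v) {N : ℕ} (hcard : ENat.card M = N)
    (hN : N < 2 * formulaCode φ.1 + 5) :
    ∃ e < 2 * N ^ (3 * formulaCode φ.1 + 10), HasLargeOrbit (N, e) ∧
      @Formula.Realize sigT ℕ (evaluatorT.str (N, e)) _ φ.1 (evaluatorT.val (N, e)) := by
  have hpos : 1 ≤ N := by
    rw [Nat.one_le_iff_ne_zero]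
    rintro rfl
    exact (not_isEmpty_of_nonempty M) ((ENat.card_eq_zero_iff_empty M).1 (by exact_mod_cast hcard))
  obtain ⟨h, hlt, hinj⟩ := exists_injOn (U := (Set.univ : Set M)) (N := N)
    (by rw [Set.encard_univ, hcard]) hpos
  obtain ⟨e, he, -, het, hea, hev⟩ := exists_table hN 0 two_pos
    (fun y => h (tMap (Function.invFun h y))) (fun _ => hlt _) (h (aVal M)) (hlt _)
    (h ∘ v) (fun _ => hlt _)
  have hinj' : Function.Injective h := Set.injOn_univ.1 hinj
  have hstep (x : M) : digit (N, e) (h x) = h (tMap x) := by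
    rw [het _ (hlt x), Function.leftInverse_invFun hinj' x]
  have hiter (i : ℕ) : (digit (N, e))^[i] (digit (N, e) N) = h (tMap^[i] (aVal M)) := by
    induction i with
    | zero => exact hea
    | succ i ih => rw [Function.iterate_succ_apply', Function.iterate_succ_apply', ih, hstep]
  refine ⟨e, he, ⟨hpos, fun j _ hj i hij heq => ?_⟩, ?_⟩
  · dsimp only at heq hj
    rw [hiter, hiter] at heq
    have := model_TOrb_iff.1 hM j (by rw [hcard, Nat.cast_lt]; exact hj)
      (Set.mem_Iio.2 (by omega)) (Set.mem_Iio.2 j.lt_succ_self) (hinj' heq)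
    omega
  · let : sigT.Structure ℕ := evaluatorT.str (N, e)
    exact (realize_iff_of_isPartialEmbedding_univ φ.2 h v _ (fun x hx => hev x hx)
      (isPartialEmbedding_sigT hinj hea.symm fun x _ _ => (hstep x).symm)).2 hv

/-- If the orbit of `a` leaves the finite set `U`, then `U` can be completed to a finite structure
in which this orbit is large, by attaching a chain of new elements. -/
theorem exists_table_of_orbit {M : Type w} [sigT.Structure M] (φ : QFFormula sigT) (v : ℕ → M)
    (U : Finset M) (hcard : U.card ≤ formulaCode φ.1 + 2) (ha : aVal M ∈ U)
    (horb : ∃ i, tMap^[i] (aVal M) ∉ U)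
    (hU : ∀ (B : Type) [sigT.Structure B] (h : M → B) (v' : ℕ → B),
      (∀ x ≤ formulaCode φ.1, v' x = h (v x)) →
        IsPartialEmbedding (L := sigT) (U : Set M) (formulaCode φ.1) h → φ.1.Realize v') :
    ∃ e < 2 * (2 * (formulaCode φ.1 + 2)) ^ (3 * formulaCode φ.1 + 10),
      HasLargeOrbit (2 * (formulaCode φ.1 + 2), e) ∧
        @Formula.Realize sigT ℕ (evaluatorT.str (2 * (formulaCode φ.1 + 2), e)) _ φ.1
          (evaluatorT.val (2 * (formulaCode φ.1 + 2), e)) := by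
  classical
  set c := formulaCode φ.1
  -- Let `n` be the first time at which the orbit of `a` is outside `U`; it is positive since `a ∈
  -- U`.
  have hspec := Nat.find_spec horb
  have hmin {k : ℕ} (hk : k < Nat.find horb) := not_not.1 (Nat.find_min horb hk)
  have hpos : 0 < Nat.find horb := (Nat.find_pos horb).2 (not_not.2 ha)
  generalize Nat.find horb = n at hspec hmin hpos
  have : Nonempty M := ⟨v 0⟩
  obtain ⟨h, hlt, hinj⟩ := exists_injOn (U := (U : Set M)) (N := c + 2)
    (by rw [Set.encard_coe_eq_coe_finsetCard, Nat.cast_le]; exact hcard) (Nat.succ_pos _)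
  -- The numbers below `c + 2` house the copy of `U`, and `c + 2, …, 2 * c + 3` form the chain.
  -- Every arrow out of `U` is redirected to the start of the chain. The chain alone is half of the
  -- domain, so an orbit running through it is large enough.
  obtain ⟨e, he, -, het, hea, hev⟩ := exists_table (N := 2 * (c + 2)) (c := c) (by omega) 0 two_pos
    (fun y => if y < c + 2 then
      if tMap (Function.invFunOn h (U : Set M) y) ∈ U
        then h (tMap (Function.invFunOn h (U : Set M) y)) else c + 2
      else if y + 1 < 2 * (c + 2) then y + 1 else 0)
    (fun y => by
      have := hlt (tMap (Function.invFunOn h (U : Set M) y))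
      split_ifs <;> omega)
    (h (aVal M)) (by have := hlt (aVal M); omega)
    (h ∘ v) (fun y => by have := hlt (v y); rw [Function.comp_apply]; omega)
  have hstep (x : M) (hx : x ∈ U) : digit (2 * (c + 2), e) (h x) =
      if tMap x ∈ U then h (tMap x) else c + 2 := by
    have h1 := hlt x
    rw [het _ (by omega), if_pos h1, hinj.leftInvOn_invFunOn (Finset.mem_coe.2 hx)]
  have hstep' (y : ℕ) (hy : c + 2 ≤ y) (hy' : y + 1 < 2 * (c + 2)) :
      digit (2 * (c + 2), e) y = y + 1 := by
    rw [het _ (by omega), if_neg (by omega), if_pos hy']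
  have hiter (i : ℕ) (hi : i < n) :
      (digit (2 * (c + 2), e))^[i] (digit (2 * (c + 2), e) (2 * (c + 2))) =
        h (tMap^[i] (aVal M)) := by
    induction i with
    | zero => exact hea
    | succ i ih =>
      rw [Function.iterate_succ_apply', Function.iterate_succ_apply', ih (by omega),
        hstep _ (hmin (by omega)), if_pos]
      rw [← Function.iterate_succ_apply' (f := tMap)]
      exact hmin hi
  have hiter' (i : ℕ) (hi : i < c + 2) :
      (digit (2 * (c + 2), e))^[n + i] (digit (2 * (c + 2), e) (2 * (c + 2))) = c + 2 + i := by
    induction i with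
    | zero =>
      obtain ⟨n, rfl⟩ := Nat.exists_eq_succ_of_ne_zero hpos.ne'
      rw [add_zero, Nat.succ_eq_add_one, Function.iterate_succ_apply', hiter n (by omega),
        hstep _ (hmin (by omega)), if_neg, add_zero]
      rwa [← Function.iterate_succ_apply' (f := tMap)]
    | succ i ih =>
      rw [← add_assoc, Function.iterate_succ_apply', ih (by omega), hstep' _ (by omega) (by omega)]
      rfl
  -- A repetition before time `n` would make the `n`-th iterate equal to an earlier one, which lies
  -- in `U`.
  have hne {i j : ℕ} (hij : i < j) (hj : j < n) : tMap^[i] (aVal M) ≠ tMap^[j] (aVal M) := by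
    intro heq
    have h1 : tMap^[n - j + j] (aVal M) = tMap^[n - j + i] (aVal M) := by
      rw [Function.iterate_add_apply, ← heq, ← Function.iterate_add_apply]
    rw [Nat.sub_add_cancel hj.le] at h1
    exact hspec (h1 ▸ hmin (by omega))
  refine ⟨e, he, ⟨by dsimp only; omega, fun j _ hj i hij => ?_⟩, ?_⟩
  · dsimp only at hj ⊢
    rcases lt_or_ge j n with hjn | hjn
    · rw [hiter i (by omega), hiter j hjn]
      exact fun heq => hne hij hjn (hinj (hmin (by omega)) (hmin hjn) heq)
    · obtain ⟨j, rfl⟩ := Nat.exists_eq_add_of_le hjn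
      rw [hiter' j (by omega)]
      rcases lt_or_ge i n with hin | hin
      · rw [hiter i hin]
        have := hlt (tMap^[i] (aVal M))
        omega
      · obtain ⟨i, rfl⟩ := Nat.exists_eq_add_of_le hin
        rw [hiter' i (by omega)]
        omega
  · let : sigT.Structure ℕ := evaluatorT.str (2 * (c + 2), e)
    refine hU ℕ h _ (fun x hx => hev x hx)
      (isPartialEmbedding_sigT hinj hea.symm fun x hx hx' => ?_)
    exact ((hstep x hx).trans (if_pos hx')).symm

/-- The dichotomy is whether the orbit of `a` stays in the set of subterm values enlarged by `a`. If
it does, it has at most `formulaCode φ + 2` elements and the axioms bound the whole model by twice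
that number; if not, `exists_table_of_orbit` applies. -/
theorem isDecidable_TOrb : IsDecidable.{w} TOrb := by
  classical
  refine isDecidable_of_tables evaluatorT TOrb HasLargeOrbit hasLargeOrbit_primrec
    (fun φ e he h => isSat_TOrb_of_table φ he h) ?_
  rintro φ ⟨M, v, hv⟩
  have hM : M ⊨ TOrb := M.is_model
  obtain ⟨U, hcard, hU⟩ := exists_finset_formula.{w, 0} v φ.1 φ.2
  have hcard' : (insert (aVal M) U).card ≤ formulaCode φ.1 + 2 :=
    (Finset.card_insert_le _ _).trans (Nat.succ_le_succ hcard)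
  by_cases horb : ∃ i, tMap^[i] (aVal M) ∉ insert (aVal M) U
  · refine ⟨2 * (formulaCode φ.1 + 2), by omega, ?_⟩
    refine exists_table_of_orbit φ v _ hcard' (Finset.mem_insert_self _ _) horb
      fun B _ h v' hv' hh => (hU B h v' hv' (hh.mono ?_ le_rfl)).2 hv
    exact fun x hx => Finset.mem_coe.2 (Finset.mem_insert_of_mem hx)
  · push Not at horb
    have hle : ENat.card M ≤ (2 * (formulaCode φ.1 + 2) : ℕ) := by
      by_contra hlt
      have hinj := model_TOrb_iff.1 hM _ (not_le.1 hlt)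
      have h1 := Finset.card_le_card_of_injOn (s := Finset.range (formulaCode φ.1 + 2 + 1))
        (t := insert (aVal M) U) _ (fun i _ => horb i) (by
          rw [Finset.coe_range]
          exact hinj)
      rw [Finset.card_range] at h1
      omega
    obtain ⟨N, hN⟩ := ENat.ne_top_iff_exists.1 (ne_top_of_le_ne_top (ENat.natCast_ne_top _) hle)
    rw [← hN, Nat.cast_le] at hle
    exact ⟨N, by omega, exists_table_of_card hM φ v hv hN.symm (by omega)⟩

end DecidableTOrb

/-! ## Injectivity of the codes -/

section Injectivity

variable {L : FirstOrder.Language.{0, 0}} [EffectiveSignature L]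

theorem termCode_injective {m : ℕ} : Function.Injective (termCode (L := L) (m := m)) := by
  intro t
  induction t with
  | var x =>
    rintro (y | ⟨f, ts⟩) h
    · rcases x with x | x <;> rcases y with y | y <;> simp only [termCode, Nat.pair_eq_pair] at h
      · rw [h.2]
      · omega
      · omega
      · rw [Fin.ext h.2]
    · rcases x with x | x <;> simp only [termCode, Nat.pair_eq_pair] at h <;> omega
  | @func n f ts ih =>
    rintro ((y | y) | @⟨n', f', ts'⟩) h
    · simp only [termCode, Nat.pair_eq_pair] at h
      omega
    · simp only [termCode, Nat.pair_eq_pair] at h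
      omega
    · simp only [termCode, Nat.pair_eq_pair] at h
      obtain ⟨-, rfl, hf, hts⟩ := h
      rw [funCode_injective _ hf]
      have := List.ofFn_injective (Encodable.encode_injective hts)
      rw [funext fun i => ih i (congrFun this i)]

/-- `IsDecidable` speaks of some formula with a given code; injectivity makes the answer one about
the intended formula. Symbols are coded injectively only within each arity, but the arity is part of
the code. -/
theorem formulaCode_injective {m : ℕ} :
    Function.Injective (formulaCode (L := L) (m := m)) := by
  intro φ
  induction φ with
  | falsum =>
    rintro (_ | _ | _ | _ | _) h <;> first
      | rfl
      | (simp only [formulaCode, Nat.pair_eq_pair] at h; omega)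
  | equal t₁ t₂ =>
    rintro (_ | ⟨t₁', t₂'⟩ | _ | _ | _) h <;> simp only [formulaCode, Nat.pair_eq_pair] at h <;>
      first
      | omega
      | rw [termCode_injective h.2.1, termCode_injective h.2.2]
  | rel R ts =>
    rintro (_ | _ | ⟨R', ts'⟩ | _ | _) h <;> simp only [formulaCode, Nat.pair_eq_pair] at h <;>
      try omega
    obtain ⟨-, rfl, hR, hts⟩ := h
    rw [relCode_injective _ hR]
    have := List.ofFn_injective (Encodable.encode_injective hts)
    rw [funext fun i => termCode_injective (congrFun this i)]
  | imp φ₁ φ₂ ih₁ ih₂ =>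
    rintro (_ | _ | _ | ⟨ψ₁, ψ₂⟩ | _) h <;> simp only [formulaCode, Nat.pair_eq_pair] at h <;>
      first
      | omega
      | rw [ih₁ h.2.1, ih₂ h.2.2]
  | all φ ih =>
    rintro (_ | _ | _ | _ | ψ) h <;> simp only [formulaCode, Nat.pair_eq_pair] at h <;>
      first
      | omega
      | rw [ih h.2]

end Injectivity

/-! ## Undecidability of combinations with `T_f` -/

section Undecidability

variable {L₁ : FirstOrder.Language.{0, 0}}

theorem isSat_combine_iff {L₂ : FirstOrder.Language.{0, 0}} (T₁ : L₁.Theory) (T₂ : L₂.Theory)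
    (φ : (L₁.sum L₂).Formula ℕ) :
    IsSat.{w} (combine T₁ T₂) φ ↔ ∃ (M : Type w) (_ : Nonempty M) (_ : L₁.Structure M)
      (_ : L₂.Structure M) (v : ℕ → M), M ⊨ T₁ ∧ M ⊨ T₂ ∧ φ.Realize v := by
  constructor
  · rintro ⟨M, v, h⟩
    let S₁ : L₁.Structure M := (LHom.sumInl : L₁ →ᴸ L₁.sum L₂).reduct M
    let S₂ : L₂.Structure M := (LHom.sumInr : L₂ →ᴸ L₁.sum L₂).reduct M
    -- A structure for the joint signature is put together from its two reducts.
    have hS : M.struc = Language.sumStructure L₁ L₂ M := by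
      ext n F
      · rcases F with F | F <;> rfl
      · rcases F with F | F <;> rfl
    obtain ⟨h₁, h₂⟩ := Theory.model_union_iff.1 M.is_model
    exact ⟨M, inferInstance, S₁, S₂, v, (LHom.onTheory_model _ _).1 h₁,
      (LHom.onTheory_model _ _).1 h₂, hS ▸ h⟩
  · rintro ⟨M, _, _, _, v, h₁, h₂, h⟩
    have hM : M ⊨ combine T₁ T₂ := Theory.model_union_iff.2
      ⟨(LHom.onTheory_model _ _).2 h₁, (LHom.onTheory_model _ _).2 h₂⟩
    exact ⟨Theory.ModelType.of (combine T₁ T₂) M, v, h⟩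

/-- The formula `s(xᵢ) = xᵢ` over a signature that contains `s`. -/
def fixedVar (i : ℕ) : (L₁.sum sigS).Formula ℕ :=
  Term.bdEqual (Term.func (L := L₁.sum sigS) (LHom.sumInr.onFunction (L := sigS) SymS.s)
    ![Term.var (Sum.inl i)])
    (Term.var (Sum.inl i))

/-- For `i = K * a + b` with `a < b`, the formula `xₐ ≠ x_b`. -/
def distinctVars {L : FirstOrder.Language.{0, 0}} (K i : ℕ) : L.Formula ℕ :=
  if i / K < i % K then (varEq (i / K) (i % K)).imp ⊥ else BoundedFormula.imp ⊥ ⊥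

theorem realize_fixedVar {M : Type w} [L₁.Structure M] [sigS.Structure M] (i : ℕ) (v : ℕ → M) :
    (fixedVar i : (L₁.sum sigS).Formula ℕ).Realize v ↔ sMap (v i) = v i := by
  rw [fixedVar, Formula.Realize, BoundedFormula.realize_bdEqual, Term.realize_func]
  refine Eq.congr ?_ rfl
  rw [sMap]
  refine congrArg (Structure.funMap (L := sigS) SymS.s) ?_
  ext i
  fin_cases i
  rfl

theorem isQF_fixedVar (i : ℕ) : (fixedVar i : (L₁.sum sigS).Formula ℕ).IsQF :=
  .of_isAtomic (.equal _ _)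

theorem formulaCode_fixedVar [EffectiveSignature L₁] (i : ℕ) :
    formulaCode (fixedVar i : (L₁.sum sigS).Formula ℕ) =
      Nat.pair 1 (Nat.pair (Nat.pair 2 (Nat.pair 1 (Nat.pair 1
        (Encodable.encode [Nat.pair 0 i])))) (Nat.pair 0 i)) := rfl

/-- Quotient and remainder by `K` run through all pairs, so pairwise distinctness becomes a single
iterated conjunction, whose code is primitive recursive by `conjUpToCode_primrec`. -/
theorem realize_distinctVars {L : FirstOrder.Language.{0, 0}} {M : Type w} [L.Structure M] (K : ℕ)
    (v : ℕ → M) :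
    (∀ i < K * K, (distinctVars K i : L.Formula ℕ).Realize v) ↔ Set.InjOn v (Set.Iio K) := by
  have h (i : ℕ) : (distinctVars K i : L.Formula ℕ).Realize v ↔
      (i / K < i % K → v (i / K) ≠ v (i % K)) := by
    rw [distinctVars]
    split
    · rename_i hlt
      rw [Formula.realize_imp, realize_varEq]
      exact ⟨fun h _ => h, fun h => h hlt⟩
    · rename_i hlt
      exact iff_of_true id fun h => absurd h hlt
  constructor
  · intro hall
    refine injOn_Iio_of_lt fun b hb a hab => ?_
    have hdiv : (K * a + b) / K = a := by
      rw [Nat.mul_add_div (by omega), Nat.div_eq_of_lt hb, add_zero]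
    have hmod : (K * a + b) % K = b := by rw [Nat.mul_add_mod, Nat.mod_eq_of_lt hb]
    have := (h (K * a + b)).1 (hall _ (by nlinarith))
    rw [hdiv, hmod] at this
    exact this hab
  · intro hinj i hi
    have hK : 0 < K := Nat.pos_of_ne_zero (by rintro rfl; simp at hi)
    have hmod := Nat.mod_lt i hK
    refine (h i).2 fun hlt heq => hlt.ne (hinj ?_ ?_ heq)
    · exact hlt.trans hmod
    · exact hmod

theorem isQF_distinctVars {L : FirstOrder.Language.{0, 0}} (K i : ℕ) :
    (distinctVars K i : L.Formula ℕ).IsQF := by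
  rw [distinctVars]
  split
  · exact (isQF_varEq _ _).imp .falsum
  · exact .imp .falsum .falsum

theorem formulaCode_distinctVars {L : FirstOrder.Language.{0, 0}} [EffectiveSignature L]
    (K i : ℕ) : formulaCode (distinctVars K i : L.Formula ℕ) =
      if i / K < i % K then Nat.pair 3 (Nat.pair (varEqCode (i / K) (i % K)) 0)
        else Nat.pair 3 (Nat.pair 0 0) := by
  rw [distinctVars]
  split <;> rfl

/-- The conjunction of `β` with the formulas saying that `x₀, …, x_{K-1}` are distinct and that
`x₀, …, x_{j-1}` are fixed points of `s`. -/
def fixedPointsFormula (β : (L₁.sum sigS).Formula ℕ) (K j : ℕ) : (L₁.sum sigS).Formula ℕ :=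
  conjUpTo fixedVar (conjUpTo (distinctVars K) β (K * K)) j

theorem isQF_fixedPointsFormula {β : (L₁.sum sigS).Formula ℕ} (hβ : β.IsQF) (K j : ℕ) :
    (fixedPointsFormula β K j).IsQF :=
  isQF_conjUpTo (isQF_conjUpTo hβ (isQF_distinctVars K) _) isQF_fixedVar j

theorem realize_fixedPointsFormula {M : Type w} [L₁.Structure M] [sigS.Structure M]
    (β : (L₁.sum sigS).Formula ℕ) (K j : ℕ) (v : ℕ → M) :
    (fixedPointsFormula β K j).Realize v ↔
      (β.Realize v ∧ Set.InjOn v (Set.Iio K)) ∧ ∀ i < j, sMap (v i) = v i := by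
  rw [fixedPointsFormula, realize_conjUpTo, realize_conjUpTo, realize_distinctVars]
  simp only [realize_fixedVar]

theorem encode_singleton (c : ℕ) : Encodable.encode [c] = Nat.succ (Nat.pair c 0) := rfl

theorem fixedPointsFormula_primrec [EffectiveSignature L₁] {γ : Type} [Primcodable γ]
    {β : γ → (L₁.sum sigS).Formula ℕ} (hβ : Primrec fun x => formulaCode (β x)) {K j : γ → ℕ}
    (hK : Primrec K) (hj : Primrec j) :
    Primrec fun x => formulaCode (fixedPointsFormula (β x) (K x) (j x)) := by
  have hc (k : ℕ) {δ : Type} [Primcodable δ] : Primrec fun _ : δ => k := Primrec.const k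
  have h1 : Primrec₂ fun (_ : γ) (i : ℕ) =>
      formulaCode (fixedVar i : (L₁.sum sigS).Formula ℕ) := by
    simp only [formulaCode_fixedVar, encode_singleton]
    have hv : Primrec fun p : γ × ℕ => Nat.pair 0 p.2 := natPair_primrec (hc 0) Primrec.snd
    exact natPair_primrec (hc 1) (natPair_primrec (natPair_primrec (hc 2)
      (natPair_primrec (hc 1) (natPair_primrec (hc 1)
        (Primrec.succ.comp (natPair_primrec hv (hc 0)))))) hv)
  have h2 : Primrec₂ fun (x : γ) (i : ℕ) =>
      formulaCode (distinctVars (K x) i : (L₁.sum sigS).Formula ℕ) := by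
    simp only [formulaCode_distinctVars]
    have hK' : Primrec fun p : γ × ℕ => K p.1 := hK.comp Primrec.fst
    have hd : Primrec fun p : γ × ℕ => p.2 / K p.1 := Primrec.nat_div.comp Primrec.snd hK'
    have hm : Primrec fun p : γ × ℕ => p.2 % K p.1 := Primrec.nat_mod.comp Primrec.snd hK'
    exact Primrec.ite (Primrec.nat_lt.comp hd hm) (natPair_primrec (hc 3)
      (natPair_primrec (varEqCode_primrec.comp hd hm) (hc 0))) (hc _)
  simp only [fixedPointsFormula, formulaCode_conjUpTo]
  exact conjUpToCode_primrec h1 (conjUpToCode_primrec h2 hβ (Primrec.nat_mul.comp hK hK)) hj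

/-- On a finite domain, `s` can be interpreted with any positive number of fixed points. -/
theorem exists_sStructure {N k : ℕ} (hk : 1 ≤ k) (hkN : k ≤ N) :
    ∃ _ : sigS.Structure (ULift.{w} (Fin N)),
      (∀ x : ULift.{w} (Fin N), sMap x = x ↔ x.down.1 < k) ∧
      (fixSet (ULift.{w} (Fin N)) 1).encard = k ∧
        (fixSet (ULift.{w} (Fin N)) 0).encard = (N - k : ℕ) := by
  let inst : sigS.Structure (ULift.{w} (Fin N)) :=
    -- All moved elements go to `0`, which is a fixed point because `1 ≤ k`.
    sStructure fun x => if x.down.1 < k then x else ⟨⟨0, by omega⟩⟩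
  have hs (x : ULift.{w} (Fin N)) : sMap x = x ↔ x.down.1 < k := by
    rw [sMap_sStructure]
    split
    · rename_i h
      exact iff_of_true rfl h
    · rename_i h
      refine iff_of_false (fun heq => ?_) h
      rw [← heq] at h
      exact h hk
  have h1 : (fixSet (ULift.{w} (Fin N)) 1).encard = k := by
    have hr : fixSet (ULift.{w} (Fin N)) 1 =
        Set.range fun i : Fin k => (⟨Fin.castLE hkN i⟩ : ULift.{w} (Fin N)) := by
      ext x
      rw [mem_fixSet_one, hs]
      constructor
      · exact fun h => ⟨⟨x.down.1, h⟩, rfl⟩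
      · rintro ⟨i, rfl⟩
        exact i.2
    rw [hr]
    exact encard_range_fin (ULift.up_injective.comp (Fin.castLE_injective hkN))
  refine ⟨inst, hs, h1, ?_⟩
  have hadd := encard_fixSet_add (M := ULift.{w} (Fin N))
  rw [h1, card_uLift_fin] at hadd
  obtain ⟨r, hr⟩ := ENat.ne_top_iff_exists.1 (ne_top_of_le_ne_top (ENat.natCast_ne_top N)
    (le_add_self.trans hadd.le))
  rw [← hr, ← Nat.cast_add, Nat.cast_inj] at hadd
  rw [← hr, Nat.cast_inj]
  omega

/-- `F n` is the least `j` with `¬ j + 1 ≤ F n`, and an unbounded search finds it. -/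
theorem computable_of_computablePred_le {F : ℕ → ℕ}
    (h : ComputablePred fun p : ℕ × ℕ => p.2 ≤ F p.1) : Computable F := by
  obtain ⟨_, h⟩ := h
  have h' : Computable₂ fun n j : ℕ => !decide (j + 1 ≤ F n) :=
    (Primrec.not.to_comp.comp (h.comp (Computable.pair Computable.fst
      (Computable.succ.comp Computable.snd)))).of_eq fun p => by simp
  refine (Partrec.rfind h'.partrec₂).of_eq fun n => ?_
  refine Part.eq_some_iff.2 (Nat.mem_rfind.2 ⟨?_, fun {m} hm => ?_⟩)
  · exact Part.mem_some_iff.2 (by simp)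
  · exact Part.mem_some_iff.2 (by simp; omega)

/-- If the first theory can bound the size of its models by `m n`, then a decision procedure for
the combination with `T_f` computes the values `f₁(m n)`. -/
theorem computable_count_of_isDecidable [EffectiveSignature L₁] {T₁ : L₁.Theory}
    {f : ℕ+ → Fin 2} (hf : IsAdmissible f) {m : ℕ → ℕ} (hm : Primrec m) (hm1 : ∀ n, 1 ≤ m n)
    {β : ℕ → (L₁.sum sigS).Formula ℕ} (hβ : ∀ n, (β n).IsQF)
    (hβ' : Primrec fun n => formulaCode (β n))
    (hle : ∀ (n : ℕ) (M : Type w) [Nonempty M] [L₁.Structure M] [sigS.Structure M] (v : ℕ → M),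
      M ⊨ T₁ → (β n).Realize v → ENat.card M ≤ m n)
    (hex : ∀ n, ∃ _ : L₁.Structure (ULift.{w} (Fin (m n))), ULift.{w} (Fin (m n)) ⊨ T₁ ∧
      ∀ [sigS.Structure (ULift.{w} (Fin (m n)))] (v : ℕ → ULift.{w} (Fin (m n))),
        (β n).Realize v)
    (hT : IsDecidable.{w} (combine T₁ (TFun f))) : Computable fun n => count f 1 (m n) := by
  refine computable_of_computablePred_le ?_
  -- With `max (m n) j` distinct variables, the size is forced to be exactly `m n` when `j ≤ m n`,
  -- and the formula is unsatisfiable when `j > m n`. Hence it is satisfiable exactly when `j ≤ f₁(m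
  -- n)`.
  have hcode : Primrec fun p : ℕ × ℕ =>
      formulaCode (fixedPointsFormula (β p.1) (max (m p.1) p.2) p.2) :=
    fixedPointsFormula_primrec (hβ'.comp Primrec.fst)
      (Primrec.nat_max.comp (hm.comp Primrec.fst) Primrec.snd) Primrec.snd
  obtain ⟨_, hT⟩ := hT
  refine ⟨fun _ => inferInstance, (hT.comp hcode.to_comp).of_eq ?_⟩
  rintro ⟨n, j⟩
  rw [decide_eq_decide]
  constructor
  · rintro ⟨φ, hφ, M, v, hv⟩
    rw [formulaCode_injective hφ] at hv
    obtain ⟨M, _, _, _, v, h₁, h₂, h⟩ := (isSat_combine_iff T₁ (TFun f) _).1 ⟨M, v, hv⟩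
    obtain ⟨⟨hb, hinj⟩, hfix⟩ := (realize_fixedPointsFormula _ _ _ _).1 h
    have hcard := hle n M v h₁ hb
    have hge : ((max (m n) j : ℕ) : ℕ∞) ≤ ENat.card M := by
      rw [← Set.encard_univ, ← exists_fin_injective_iff]
      exact ⟨fun i => v i, fun i i' hii => Fin.ext (hinj i.2 i'.2 hii), fun _ => trivial⟩
    have hmax : max (m n) j ≤ m n := by exact_mod_cast hge.trans hcard
    have heq : ENat.card M = m n :=
      le_antisymm hcard (le_trans (by exact_mod_cast le_max_left _ _) hge)
    have h1 := encard_fixSet_of_card h₂ heq 1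
    have h2 : (j : ℕ∞) ≤ (fixSet M 1).encard := by
      rw [← exists_fin_injective_iff]
      refine ⟨fun i : Fin j => v i, fun i i' hii => Fin.ext (hinj ?_ ?_ hii), fun i =>
        mem_fixSet_one.2 (hfix i i.2)⟩
      · exact i.2.trans_le (le_max_right _ _)
      · exact i'.2.trans_le (le_max_right _ _)
    rw [h1] at h2
    exact_mod_cast h2
  · intro hj
    have hj : j ≤ count f 1 (m n) := hj
    have hadd := count_add_count f (m n)
    refine ⟨⟨_, isQF_fixedPointsFormula (hβ n) (max (m n) j) j⟩, rfl,
      (isSat_combine_iff T₁ (TFun f) _).2 ?_⟩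
    obtain ⟨_, h₁, hb⟩ := hex n
    obtain ⟨_, hs, h1, h0⟩ := exists_sStructure.{w} (hf.count_pos (hm1 n))
      (show count f 1 (m n) ≤ m n by omega)
    refine ⟨ULift.{w} (Fin (m n)), ⟨⟨⟨0, hm1 n⟩⟩⟩, inferInstance, inferInstance,
      -- This assignment enumerates the domain by the first `m n` variables, the fixed points coming
      -- first.
      fun i => ⟨⟨i % m n, Nat.mod_lt _ (hm1 n)⟩⟩, h₁, model_TFun_of_count (hm1 n) fun b => ?_,
      (realize_fixedPointsFormula _ _ _ _).2 ⟨⟨hb _, fun i hi i' hi' hii => ?_⟩, fun i hi => ?_⟩⟩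
    · rcases (by omega : b = 1 ∨ b = 0) with rfl | rfl
      · exact h1
      · rw [h0, Nat.cast_inj]
        omega
    · rw [max_eq_left (by omega), Set.mem_Iio] at hi hi'
      have := congrArg (fun x => x.down.1) hii
      dsimp only at this
      rwa [Nat.mod_eq_of_lt hi, Nat.mod_eq_of_lt hi'] at this
    · rw [hs]
      dsimp only
      rw [Nat.mod_eq_of_lt (by omega)]
      omega

end Undecidability

section Reductions

/-- A function on the positive integers is computable if its values can be read off from the
growth of a computable function, with finitely many exceptions. -/
theorem computable_of_growth {f : ℕ+ → Fin 2} {F d : ℕ → ℕ} (hF : Computable F) (hd : Primrec d)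
    (n₀ : ℕ) (h : ∀ i, n₀ ≤ i → (f i.succPNat = 1 ↔ F (d i - 1) < F (d i))) : Computable f := by
  -- The finitely many exceptional values are stored in a list.
  let l : List (Fin 2) := (List.range n₀).map fun i => f i.succPNat
  have hpred : Primrec fun k : ℕ+ => k.natPred := Primrec.encode
  have hlt : Computable fun k : ℕ+ => decide (k.natPred < n₀) :=
    (PrimrecPred.decide (Primrec.nat_lt.comp hpred (Primrec.const n₀))).to_comp
  have hgrow : Computable fun k : ℕ+ => decide (F (d k.natPred - 1) < F (d k.natPred)) := by
    have h1 := hF.comp (Primrec.pred.comp (hd.comp hpred)).to_comp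
    have h2 := hF.comp (hd.comp hpred).to_comp
    exact (Primrec.nat_lt.decide.to_comp.comp h1 h2).of_eq fun _ => rfl
  have hl : Computable fun k : ℕ+ => l.getD k.natPred 0 :=
    ((Primrec.list_getD (0 : Fin 2)).comp (Primrec.const l) hpred).to_comp
  refine (Computable.cond hlt hl (Computable.cond hgrow (Computable.const 1)
    (Computable.const 0))).of_eq fun k => ?_
  obtain ⟨i, rfl⟩ : ∃ i : ℕ, k = i.succPNat := ⟨k.natPred, (PNat.succPNat_natPred k).symm⟩
  rw [Nat.natPred_succPNat]
  rcases lt_or_ge i n₀ with hi | hi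
  · simp [hi, l]
  · have := h i hi
    by_cases hg : F (d i - 1) < F (d i)
    · simp [not_lt.2 hi, hg, this.2 hg]
    · have h0 : f i.succPNat ≠ 1 := fun h1 => hg (this.1 h1)
      simp only [not_lt.2 hi, hg, decide_false, cond_false]
      omega

/-! ### The combination with `T_=` -/

/-- The formula `Pₙ₊₁` over the joint signature. -/
def atomSum (n : ℕ) : (sigP.sum sigS).Formula ℕ :=
  BoundedFormula.rel (L := sigP.sum sigS) (LHom.sumInl.onRelation (L := sigP) (SymP.P n.succPNat))
    Fin.elim0

theorem realize_atomSum {M : Type w} [sigP.Structure M] [sigS.Structure M] (n : ℕ) (v : ℕ → M) :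
    (atomSum n).Realize v ↔ predP M n.succPNat := by
  rw [atomSum, Formula.Realize, BoundedFormula.Realize, LHom.map_onRelation, predP]
  exact Eq.to_iff (congrArg _ (Subsingleton.elim _ _))

theorem formulaCode_atomSum (n : ℕ) : formulaCode (atomSum n) =
    Nat.pair 2 (Nat.pair 0 (Nat.pair (2 * (n + 1)) 0)) := rfl

theorem IsAdmissible.not_isDecidable_combine_TEq {f : ℕ+ → Fin 2} (hf : IsAdmissible f) :
    ¬ IsDecidable.{w} (combine TEq (TFun f)) := by
  intro hT
  -- Here `F (i - 1)` and `F i` are `f₁(i)` and `f₁(i + 1)`, which differ exactly when `f(i + 1) =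
  -- 1`. The case `i = 0` is excepted because truncated subtraction would compare `F 0` with itself.
  refine hf.1 (computable_of_growth (F := fun n => count f 1 (n + 1)) (d := id) ?_ Primrec.id 1
    fun i hi => ?_)
  · refine computable_count_of_isDecidable hf Primrec.succ (fun n => n.succ_pos) (β := atomSum)
      (fun n => .of_isAtomic (.rel _ _)) ?_ ?_ ?_ hT
    · simp only [formulaCode_atomSum]
      exact natPair_primrec (Primrec.const 2) (natPair_primrec (Primrec.const 0)
        (natPair_primrec (Primrec.nat_mul.comp (Primrec.const 2) Primrec.succ) (Primrec.const 0)))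
    · intro n M _ _ _ v hM hv
      exact (model_TEq_iff.1 hM _ ((realize_atomSum n v).1 hv)).le
    · intro n
      let inst : sigP.Structure (ULift.{w} (Fin (n + 1))) := pStructure fun k => k = n.succPNat
      refine ⟨inst, model_TEq_iff.2 fun k hk => ?_, fun v => ?_⟩
      · rw [card_uLift_fin, (predP_pStructure _ k).1 hk]
        rfl
      · exact (realize_atomSum n v).2 rfl
  · obtain ⟨i, rfl⟩ := Nat.exists_eq_succ_of_ne_zero (Nat.one_le_iff_ne_zero.1 hi)
    simp only [id, Nat.succ_eq_add_one, Nat.add_sub_cancel]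
    rw [count_succ f 1 (i + 1)]
    split <;> simp_all

/-! ### The combination with `T_orb²` -/

/-- The term `tⁿ(a)` over the joint signature. -/
def iterSum : ℕ → (sigT.sum sigS).Term (ℕ ⊕ Fin 0)
  | 0 => Term.func (L := sigT.sum sigS) (LHom.sumInl.onFunction (L := sigT) SymT.a) Fin.elim0
  | n + 1 => Term.func (L := sigT.sum sigS) (LHom.sumInl.onFunction (L := sigT) SymT.t) ![iterSum n]

/-- The formula `tⁿ⁺¹(a) = a` over the joint signature. -/
def cycleSum (n : ℕ) : (sigT.sum sigS).Formula ℕ :=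
  Term.bdEqual (iterSum (n + 1)) (iterSum 0)

theorem realize_iterSum {M : Type w} [sigT.Structure M] [sigS.Structure M] (n : ℕ)
    (v : ℕ ⊕ Fin 0 → M) : (iterSum n).realize v = tMap^[n] (aVal M) := by
  induction n with
  | zero =>
    rw [iterSum, Term.realize_func, LHom.map_onFunction]
    exact congrArg (Structure.funMap (L := sigT) SymT.a) (Subsingleton.elim _ _)
  | succ n ih =>
    rw [iterSum, Term.realize_func, LHom.map_onFunction, Function.iterate_succ_apply', ← ih]
    refine congrArg (Structure.funMap (L := sigT) SymT.t) ?_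
    ext i
    fin_cases i
    rfl

theorem realize_cycleSum {M : Type w} [sigT.Structure M] [sigS.Structure M] (n : ℕ) (v : ℕ → M) :
    (cycleSum n).Realize v ↔ tMap^[n + 1] (aVal M) = aVal M := by
  rw [cycleSum, Formula.Realize, BoundedFormula.realize_bdEqual, realize_iterSum, realize_iterSum]
  rfl

theorem termCode_iterSum (n : ℕ) : termCode (iterSum n) =
    (fun c => Nat.pair 2 (Nat.pair 1 (Nat.pair 0 (Nat.succ (Nat.pair c 0)))))^[n]
      (Nat.pair 2 (Nat.pair 0 (Nat.pair 0 0))) := by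
  induction n with
  | zero => rfl
  | succ n ih =>
    rw [Function.iterate_succ_apply', ← ih]
    rfl

theorem termCode_iterSum_primrec : Primrec fun n => termCode (iterSum n) := by
  simp only [termCode_iterSum]
  have hc (k : ℕ) : Primrec fun _ : ℕ × ℕ => k := Primrec.const k
  exact Primrec.nat_iterate Primrec.id (Primrec.const _) (natPair_primrec (hc 2)
    (natPair_primrec (hc 1) (natPair_primrec (hc 0)
      (Primrec.succ.comp (natPair_primrec Primrec.snd (hc 0))))))

/-- The orbit of `a` is the cycle `0, 1, …, n`, half of the domain; the other elements are sent to
`0`. So the bound that the axiom puts on the size is attained. -/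
theorem exists_model_TOrb (n : ℕ) : ∃ _ : sigT.Structure (ULift.{w} (Fin (2 * (n + 1)))),
    ULift.{w} (Fin (2 * (n + 1))) ⊨ TOrb ∧
      tMap^[n + 1] (aVal (ULift.{w} (Fin (2 * (n + 1))))) = aVal _ := by
  let inst : sigT.Structure (ULift.{w} (Fin (2 * (n + 1)))) :=
    tStructure ⟨⟨0, by omega⟩⟩ fun x =>
      if h : x.down.1 < n then ⟨⟨x.down.1 + 1, by omega⟩⟩ else ⟨⟨0, by omega⟩⟩
  have : Nonempty (ULift.{w} (Fin (2 * (n + 1)))) := ⟨⟨⟨0, by omega⟩⟩⟩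
  have hiter (i : ℕ) (hi : i ≤ n) :
      tMap^[i] (aVal (ULift.{w} (Fin (2 * (n + 1))))) = ⟨⟨i, by omega⟩⟩ := by
    induction i with
    | zero => rfl
    | succ i ih =>
      rw [Function.iterate_succ_apply', ih (by omega), tMap_tStructure, dif_pos (by dsimp only; omega)]
  refine ⟨inst, model_TOrb_iff.2 fun m hm => injOn_Iio_of_lt fun j hj i hij heq => ?_, ?_⟩
  · rw [card_uLift_fin, Nat.cast_lt] at hm
    rw [hiter i (by omega), hiter j (by omega)] at heq
    have := congrArg (fun x => x.down.1) heq
    dsimp only at this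
    omega
  · rw [Function.iterate_succ_apply', hiter n le_rfl, tMap_tStructure,
      dif_neg (by dsimp only; omega)]
    rfl

theorem IsPairedAdmissible.not_isDecidable_combine_TOrb {g : ℕ+ → Fin 2}
    (hg : IsPairedAdmissible g) : ¬ IsDecidable.{w} (combine TOrb (TFun g)) := by
  intro hT
  have hhalf : Primrec fun i : ℕ => i / 2 := Primrec.nat_div.comp Primrec.id (Primrec.const 2)
  -- Only `g₁` at even arguments is available. From `2n` to `2n + 2` it grows by `2` or not at all,
  -- since `g(2n + 1) = g(2n + 2)`; so `d` halves the index. The pairing starts at `n = 2`, that is,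
  -- at `i = 4`.
  refine hg.1.1 (computable_of_growth (F := fun n => count g 1 (2 * (n + 1))) ?_ hhalf 4
    fun i hi => ?_)
  · refine computable_count_of_isDecidable hg.1
      (Primrec.nat_mul.comp (Primrec.const 2) Primrec.succ) (fun n => by omega) (β := cycleSum)
      (fun n => .of_isAtomic (.equal _ _)) ?_ ?_ ?_ hT
    · exact natPair_primrec (Primrec.const 1) (natPair_primrec
        (termCode_iterSum_primrec.comp Primrec.succ)
        (termCode_iterSum_primrec.comp (Primrec.const 0)))
    · intro n M _ _ _ v hM hv
      by_contra hlt
      have hinj := model_TOrb_iff.1 hM (n + 1) (not_le.1 hlt)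
      have := hinj (Set.mem_Iio.2 (show n + 1 < n + 1 + 1 by omega))
        (Set.mem_Iio.2 (show 0 < n + 1 + 1 by omega)) ((realize_cycleSum n v).1 hv)
      omega
    · intro n
      obtain ⟨inst, h₁, h₂⟩ := exists_model_TOrb.{w} n
      exact ⟨inst, h₁, fun v => (realize_cycleSum n v).2 h₂⟩
  · obtain ⟨n, hn, hin⟩ : ∃ n, 2 ≤ n ∧ (i = 2 * n ∨ i = 2 * n + 1) := ⟨i / 2, by omega, by omega⟩
    have hpair := hg.2 n hn
    have hi2 : i / 2 = n := by omega
    have hgi : g i.succPNat = g (2 * n).succPNat := by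
      rcases hin with rfl | rfl
      exacts [rfl, hpair.symm]
    rw [hi2, hgi, Nat.sub_add_cancel (by omega), show 2 * (n + 1) = 2 * n + 1 + 1 by ring,
      count_succ, count_succ, ← hpair]
    split <;> simp_all

end Reductions

/-! ## Existence of admissible functions -/

section Existence

theorem count_add_of_forall {f : ℕ+ → Fin 2} {b : Fin 2} {a c : ℕ}
    (h : ∀ i, a ≤ i → i < a + c → f i.succPNat = b) : count f b (a + c) = count f b a + c := by
  induction c with
  | zero => rfl
  | succ c ih =>
    rw [← add_assoc, count_succ, ih fun i h1 h2 => h i h1 (by omega),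
      if_pos (h (a + c) (by omega) (by omega)), add_assoc]

/-- Two adjacent blocks of equal length with opposite constant values preserve balance, in whichever
order they come. The choice of the order can therefore encode one bit. -/
theorem two_mul_count_of_blocks {f : ℕ+ → Fin 2} {a c : ℕ} {b : Fin 2}
    (h : ∀ i, a ≤ i → i < a + c → f i.succPNat = b)
    (h' : ∀ i, a + c ≤ i → i < a + c + c → f i.succPNat ≠ b)
    (ha : 2 * count f 1 a = a) : 2 * count f 1 (a + c + c) = a + c + c := by
  have h0 := count_add_of_forall h
  have h1 : count f (1 - b) (a + c + c) = count f (1 - b) (a + c) + c :=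
    count_add_of_forall fun i hi hi' => by
      have := h' i hi hi'
      omega
  have e0 := count_add_count f a
  have e1 := count_add_count f (a + c)
  have e2 := count_add_count f (a + c + c)
  rcases (by omega : b = 1 ∨ b = 0) with rfl | rfl
  · rw [sub_self] at h1
    omega
  · rw [sub_zero] at h1
    omega

theorem succPNat_primrec : Primrec Nat.succPNat :=
  Primrec.encode_iff.1 (Primrec.id.of_eq fun n => (Nat.natPred_succPNat n).symm)

theorem exists_not_computablePred : ∃ p : ℕ → Prop, ¬ ComputablePred p := by
  refine ⟨fun n => ((Denumerable.ofNat Nat.Partrec.Code n).eval 0).Dom, fun h => ?_⟩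
  refine ComputablePred.halting_problem 0 ?_
  obtain ⟨_, h⟩ := h
  refine ⟨fun _ => Classical.propDecidable _, (h.comp Computable.encode).of_eq fun c => ?_⟩
  simp

theorem exists_isPairedAdmissible : ∃ g : ℕ+ → Fin 2, IsPairedAdmissible g := by
  classical
  obtain ⟨p, hp⟩ := exists_not_computablePred
  -- `G m` is the value at `m + 1`. The block `2 ^ l ≤ m < 2 ^ (l + 1)` consists of two constant
  -- halves, and their order records whether `p l` holds.
  let G (m : ℕ) : Fin 2 :=
    if m = 0 then 1 else if m = 1 then 0
    else if (p (Nat.log 2 m) ↔ 3 * 2 ^ Nat.log 2 m ≤ 2 * m) then 1 else 0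
  let g (k : ℕ+) : Fin 2 := G k.natPred
  have hg (m : ℕ) : g m.succPNat = G m := by simp [g]
  have hlog {l m : ℕ} (h1 : 2 ^ l ≤ m) (h2 : m < 2 ^ (l + 1)) : Nat.log 2 m = l :=
    Nat.log_eq_of_pow_le_of_lt_pow h1 h2
  have hG {l m : ℕ} (hl : 1 ≤ l) (h1 : 2 ^ l ≤ m) (h2 : m < 2 ^ (l + 1)) :
      G m = if (p l ↔ 3 * 2 ^ l ≤ 2 * m) then 1 else 0 := by
    have h3 : 2 ^ 1 ≤ 2 ^ l := Nat.pow_le_pow_right two_pos hl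
    dsimp only [G]
    rw [if_neg (by omega), if_neg (by omega), hlog h1 h2]
  have hhalf (k : ℕ) : 2 * count g 1 (2 ^ (k + 1)) = 2 ^ (k + 1) := by
    induction k with
    | zero =>
      rw [zero_add, pow_one, count_succ, count_succ, hg, hg]
      simp [count, G]
    | succ k ih =>
      have e : 2 ^ (k + 1 + 1) = 2 ^ (k + 1) + 2 ^ k + 2 ^ k := by ring
      have e' : 2 ^ (k + 1) = 2 * 2 ^ k := by ring
      rw [e]
      by_cases hk : p (k + 1)
      · refine two_mul_count_of_blocks (b := 0) (fun i h1 h2 => ?_) (fun i h1 h2 => ?_) ih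
        · rw [hg, hG (by omega) h1 (by omega), if_neg]
          simp only [hk, true_iff]
          omega
        · rw [hg, hG (l := k + 1) (by omega) (by omega) (by omega), if_pos]
          · simp
          · simp only [hk, true_iff]
            omega
      · refine two_mul_count_of_blocks (b := 1) (fun i h1 h2 => ?_) (fun i h1 h2 => ?_) ih
        · rw [hg, hG (by omega) h1 (by omega), if_pos]
          simp only [hk, false_iff]
          omega
        · rw [hg, hG (l := k + 1) (by omega) (by omega) (by omega), if_neg]
          · simp
          · simp only [hk, false_iff]
            omega
  refine ⟨g, ⟨fun hcomp => hp ?_, ?_, fun k hk => ?_⟩, fun n hn => ?_⟩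
  -- For `n ≥ 1`, the first value of block `n` is `0` exactly when `p n` holds; `p 0` is not encoded
  -- and is supplied as a constant.
  · have hpow : Computable fun n : ℕ => (2 ^ n).succPNat :=
      (succPNat_primrec.comp (natPow_primrec.comp (Primrec.const 2) Primrec.id)).to_comp
    have hval : Computable fun n : ℕ => decide (g (2 ^ n).succPNat = 0) :=
      Primrec.eq.decide.to_comp.comp (hcomp.comp hpow) (Computable.const 0)
    have hzero : Computable fun n : ℕ => decide (n = 0) :=
      (PrimrecPred.decide (Primrec.eq.comp Primrec.id (Primrec.const 0))).to_comp
    refine ⟨inferInstance, (Computable.cond hzero (Computable.const (decide (p 0))) hval).of_eq ?_⟩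
    intro n
    rcases Nat.eq_zero_or_pos n with rfl | hn
    · simp
    · have hlt : ¬ 3 * 2 ^ n ≤ 2 * 2 ^ n := by
        have := Nat.two_pow_pos n
        omega
      rw [hg, hG hn le_rfl (Nat.pow_lt_pow_right one_lt_two n.lt_succ_self)]
      simp [hn.ne', hlt]
  · exact hg 0
  · obtain ⟨k, rfl⟩ := Nat.exists_eq_succ_of_ne_zero (Nat.one_le_iff_ne_zero.1 hk)
    have h1 := hhalf k
    have h2 := count_add_count g (2 ^ (k + 1))
    rw [Nat.succ_eq_add_one]
    omega
  -- For `n ≥ 2` the block of `2 * n` has index at least `2`, so its end points and its midpoint are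
  -- even, and `2 * n` and `2 * n + 1` lie in the same half.
  · have hl : Nat.log 2 (2 * n) = Nat.log 2 n + 1 := by
      rw [mul_comm, Nat.log_mul_base one_lt_two (by omega)]
    have h1 := Nat.pow_log_le_self 2 (show 2 * n ≠ 0 by omega)
    have h2 := Nat.lt_pow_succ_log_self one_lt_two (2 * n)
    have h3 : 1 ≤ Nat.log 2 n := Nat.log_pos one_lt_two hn
    rw [hl] at h1 h2
    obtain ⟨l, hl'⟩ := Nat.exists_eq_add_of_le h3
    rw [hl'] at h1 h2
    have e : 2 ^ (1 + l + 1) = 4 * 2 ^ l := by ring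
    have e' : 2 ^ ((1 + l + 1).succ) = 8 * 2 ^ l := by
      rw [Nat.succ_eq_add_one]
      ring
    rw [hg, hg, hG (l := 1 + l + 1) (by omega) h1 h2,
      hG (l := 1 + l + 1) (by omega) (by omega) (by rw [Nat.succ_eq_add_one] at *; omega)]
    have : (3 * 2 ^ (1 + l + 1) ≤ 2 * (2 * n)) ↔ (3 * 2 ^ (1 + l + 1) ≤ 2 * (2 * n + 1)) := by
      omega
    simp only [this]

end Existence

/-! ### Finiteness of the two signatures -/

theorem isFiniteSignature_sigT : IsFiniteSignature sigT := by
  refine ⟨Finite.of_injective (β := Bool) (fun x => match x with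
    | ⟨_, SymT.a⟩ => true
    | ⟨_, SymT.t⟩ => false) ?_, Finite.of_injective (β := Bool) (fun x => Empty.elim x.2) ?_⟩
  · rintro ⟨_, ⟨⟩⟩ ⟨_, ⟨⟩⟩ h
    · rfl
    · cases h
    · cases h
    · rfl
  · rintro ⟨_, ⟨⟩⟩

theorem isFiniteSignature_sigS : IsFiniteSignature sigS := by
  refine ⟨Finite.of_injective (β := Unit) (fun _ => ()) ?_,
    Finite.of_injective (β := Bool) (fun x => Empty.elim x.2) ?_⟩
  · rintro ⟨_, ⟨⟩⟩ ⟨_, ⟨⟩⟩ _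
    rfl
  · rintro ⟨_, ⟨⟩⟩

end TheoryCombination

/-! ### The main theorem -/

theorem mainTheorem1 :
    -- there are decidable `T₁`, `T₂` with `T₂` polite and `T₁ ⊕ T₂` undecidable
    (∃ (L₁ L₂ : FirstOrder.Language.{0, 0}) (_ : EffectiveSignature L₁) (_ : EffectiveSignature L₂)
      (T₁ : L₁.Theory) (T₂ : L₂.Theory),
      IsDecidable.{w} T₁ ∧ IsDecidable.{w} T₂ ∧ IsPolite.{w} T₂ ∧
        ¬ IsDecidable.{w} (combine T₁ T₂)) ∧
    -- the claim that politeness suffices for theory combination is false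
    (¬ ∀ (L₁ L₂ : FirstOrder.Language.{0, 0}) (_ : EffectiveSignature L₁)
      (_ : EffectiveSignature L₂) (T₁ : L₁.Theory) (T₂ : L₂.Theory),
      IsDecidable.{w} T₁ → IsDecidable.{w} T₂ → IsPolite.{w} T₂ →
        IsDecidable.{w} (combine T₁ T₂)) ∧
    -- the witnesses `T₁ = T_=` and `T₂ = T_f`
    (∃ f : ℕ+ → Fin 2, IsAdmissible f) ∧
    (∀ f : ℕ+ → Fin 2, IsAdmissible f →
      IsDecidable.{w} TEq ∧ IsDecidable.{w} (TFun f) ∧ IsPolite.{w} (TFun f) ∧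
        ¬ IsDecidable.{w} (combine TEq (TFun f))) ∧
    -- the variant over finite signatures
    (∃ (L₁ L₂ : FirstOrder.Language.{0, 0}) (_ : EffectiveSignature L₁) (_ : EffectiveSignature L₂)
      (T₁ : L₁.Theory) (T₂ : L₂.Theory),
      IsFiniteSignature L₁ ∧ IsFiniteSignature L₂ ∧
        IsDecidable.{w} T₁ ∧ IsDecidable.{w} T₂ ∧ IsPolite.{w} T₂ ∧
        ¬ IsDecidable.{w} (combine T₁ T₂)) ∧
    -- its witnesses `T₁ = T_orb²` and `T₂ = T_g`
    (∃ g : ℕ+ → Fin 2, IsPairedAdmissible g) ∧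
    (∀ g : ℕ+ → Fin 2, IsPairedAdmissible g →
      IsFiniteSignature sigT ∧ IsFiniteSignature sigS ∧
        IsDecidable.{w} TOrb ∧ IsDecidable.{w} (TFun g) ∧ IsPolite.{w} (TFun g) ∧
        ¬ IsDecidable.{w} (combine TOrb (TFun g))) := by
  -- One paired admissible function serves all existence claims, since it is in particular
  -- admissible.
  obtain ⟨g, hg⟩ := exists_isPairedAdmissible
  have infinite : ∀ f : ℕ+ → Fin 2, IsAdmissible f →
      IsDecidable.{w} TEq ∧ IsDecidable.{w} (TFun f) ∧ IsPolite.{w} (TFun f) ∧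
        ¬ IsDecidable.{w} (combine TEq (TFun f)) := fun f hf =>
    ⟨isDecidable_TEq, hf.isDecidable_TFun, hf.isPolite, hf.not_isDecidable_combine_TEq⟩
  have finite : ∀ g : ℕ+ → Fin 2, IsPairedAdmissible g →
      IsFiniteSignature sigT ∧ IsFiniteSignature sigS ∧
        IsDecidable.{w} TOrb ∧ IsDecidable.{w} (TFun g) ∧ IsPolite.{w} (TFun g) ∧
        ¬ IsDecidable.{w} (combine TOrb (TFun g)) := fun g hg =>
    ⟨isFiniteSignature_sigT, isFiniteSignature_sigS, isDecidable_TOrb, hg.1.isDecidable_TFun,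
      hg.1.isPolite, hg.not_isDecidable_combine_TOrb⟩
  obtain ⟨h1, h2, h3, h4⟩ := infinite g hg.1
  exact ⟨⟨_, _, _, _, _, _, h1, h2, h3, h4⟩, fun h => h4 (h _ _ _ _ _ _ h1 h2 h3), ⟨g, hg.1⟩,
    infinite, ⟨_, _, _, _, _, _, finite g hg⟩, ⟨g, hg⟩, finite⟩
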